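/- Let $\Delta>1$ and let $q\in(0,1)$ be the solution of $\Delta=\tfrac12(q+q^{-1})$. Put $A(\Delta)=\tfrac12\sqrt{1-\Delta^{-2}}$ and $\gamma=1-\Delta^{-1}$. On $\mathcal H_L=(\mathbb C^2)^{\otimes L}$, with spin-$\tfrac12$ matrices $S^i_x$ (eigenvalues $\pm\tfrac12$), consider $$H^{++}_{[1,L]}=\sum_{x=1}^{L-1}\Big[-\Delta^{-1}\big(\vec S_x\cdot\vec S_{x+1}-\tfrac14\big)-(1-\Delta^{-1})\big(S^3_xS^3_{x+1}-\tfrac14\big)\Big]-A(\Delta)\,(S^3_1+S^3_L).$$ For $1\le n\le L$ let $\mathcal H_{L,n}\subset\mathcal H_L$ be the subspace of states with exactly $n$ down spins; it is invariant under $H^{++}_{[1,L]}$. For an integer interval $[a,b]$ (possibly empty) put $$\psi^{+-}_{[a,b]}(m)=\sum_{a\le x_1<\dots<x_m\le b}q^{\sum_k(b+1-x_k)}\Big(\prod_{k}S^-_{x_k}\Big)|{\uparrow\cdots\uparrow}\rangle,\qquad \psi^{-+}_{[a,b]}(m)=\sum_{a\le x_1<\dots<x_m\le b}q^{\sum_k(x_k+1-a)}\Big(\prod_{k}S^-_{x_k}\Big)|{\uparrow\cdots\uparrow}\rangle,$$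 and let $$\mathcal K_{L,n}=\operatorname{span}\big\{\psi^{+-}_{[1,x]}(\lfloor n/2\rfloor)\otimes\psi^{-+}_{[x+1,L]}(\lceil n/2\rceil)\;:\;\lfloor n/2\rfloor\le x\le L-\lceil n/2\rceil\big\}.$$ Let $\lambda_{L,n}(1)\le\lambda_{L,n}(2)\le\cdots$ be the eigenvalues, with multiplicity, of $H^{++}_{[1,L]}$ restricted to $\mathcal H_{L,n}$, let $\psi^{++}_{L,n}(1),\psi^{++}_{L,n}(2),\dots$ be any orthonormal basis of $\mathcal H_{L,n}$ of corresponding eigenvectors (one exists by self-adjointness), and let $\mathcal H^{k}_{L,n}=\operatorname{span}\{\psi^{++}_{L,n}(j):1\le j\le k\}$. Then $\dim\mathcal H_{L,n}\ge L-n+1$, and there is a constant $C<\infty$ depending only on $q$ such that for all integers $1\le n\le L$: (a) $\lambda_{L,n}(1),\dots,\lambda_{L,n}(L-n+1)\in[A(\Delta)-Cq^n,\;A(\Delta)+Cq^n]$; (b) $\lambda_{L,n}(L-n+2)\ge A(\Delta)+\gamma-Cn^{-1/4}$, whenever $\dim\mathcal H_{L,n}\ge L-n+2$; (c) $\big\|\operatorname{Proj}(\mathcal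 K_{L,n})-\operatorname{Proj}(\mathcal H^{L-n+1}_{L,n})\big\|\le Cq^{n/2}$, where $\operatorname{Proj}$ denotes orthogonal projection and the norm is the operator norm; and moreover $$\sup_{0\ne\psi\in\mathcal K_{L,n}}\ \inf_{\psi'\in\mathcal H^{L-n+1}_{L,n}}\frac{\|\psi-\psi'\|^2}{\|\psi\|^2}\le Cq^n,\qquad \sup_{0\ne\psi'\in\mathcal H^{L-n+1}_{L,n}}\ \inf_{\psi\in\mathcal K_{L,n}}\frac{\|\psi-\psi'\|^2}{\|\psi'\|^2}\le Cq^n.$$ -/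

import Mathlib

open scoped BigOperators

namespace XXZ

noncomputable section

/-- The sites of the integer interval `[a, b]` (empty when `b < a`). -/
abbrev Sites (a b : ℤ) : Type := Set.Icc a b

/-- Spin configurations on `[a, b]`: the value `0` is spin up, the value `1` is spin down. -/
abbrev Config (a b : ℤ) : Type := Sites a b → Fin 2

/-- The Hilbert space `ℂ² ⊗ ⋯ ⊗ ℂ²` with one factor for each site of `[a, b]`, in coordinates
with respect to the orthonormal product basis, which is indexed by the spin configurations. -/
abbrev Space (a b : ℤ) : Type := EuclideanSpace ℂ (Config a b)

/-- Operators on `Space a b`, as matrices in the product basis. -/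
abbrev Op (a b : ℤ) : Type := Matrix (Config a b) (Config a b) ℂ

/-- The spin-1/2 matrix `S¹`. -/
def spin1 : Matrix (Fin 2) (Fin 2) ℂ := !![0, 1 / 2; 1 / 2, 0]

/-- The spin-1/2 matrix `S²`. -/
def spin2 : Matrix (Fin 2) (Fin 2) ℂ := !![0, -Complex.I / 2; Complex.I / 2, 0]

/-- The spin-1/2 matrix `S³`. -/
def spin3 : Matrix (Fin 2) (Fin 2) ℂ := !![1 / 2, 0; 0, -1 / 2]

open Classical in
/-- The matrix `M` acting on the tensor factor of the site `x`, and as the identity on all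
other factors. -/
def siteOp {a b : ℤ} (M : Matrix (Fin 2) (Fin 2) ℂ) (x : Sites a b) : Op a b :=
  fun σ τ => if ∀ y, y ≠ x → σ y = τ y then M (σ x) (τ x) else 0

/-- The XXZ interaction
`-Δ⁻¹ (S_x · S_y - 1/4) - (1 - Δ⁻¹) (S³_x S³_y - 1/4)` between the sites `x` and `y`. -/
def bond {a b : ℤ} (Δ : ℝ) (x y : Sites a b) : Op a b :=
  (-(Δ : ℂ)⁻¹) • (siteOp spin1 x * siteOp spin1 y + siteOp spin2 x * siteOp spin2 y
      + siteOp spin3 x * siteOp spin3 y - (1 / 4 : ℂ) • (1 : Op a b))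
    - (1 - (Δ : ℂ)⁻¹) • (siteOp spin3 x * siteOp spin3 y - (1 / 4 : ℂ) • (1 : Op a b))

/-- The boundary field strength (and droplet energy) `A(Δ) = √(1 - Δ⁻²) / 2`. -/
def fieldA (Δ : ℝ) : ℝ := (1 / 2) * Real.sqrt (1 - (Δ ^ 2)⁻¹)

/-- The XXZ Hamiltonian with boundary fields
`H^{αβ}_{[a,b]} = ∑_{x=a}^{b-1} H_{x,x+1} - A(Δ) (α S³_a + β S³_b)`, as a matrix. -/
def hamMatrix (Δ α β : ℝ) (a b : ℤ) : Op a b :=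
  (∑ p : Sites a b × Sites a b with p.2.1 = p.1.1 + 1, bond Δ p.1 p.2)
    - (fieldA Δ : ℂ) • ((α : ℂ) • (∑ x : Sites a b with x.1 = a, siteOp spin3 x)
        + (β : ℂ) • (∑ x : Sites a b with x.1 = b, siteOp spin3 x))

/-- The droplet Hamiltonian `H^{++}_{[1,L]}`. -/
def droplet (Δ : ℝ) (L : ℕ) : Space 1 L →L[ℂ] Space 1 L :=
  Matrix.toEuclideanCLM (𝕜 := ℂ) (hamMatrix Δ 1 1 1 L)

/-- The product basis vector with down spins exactly at the sites in `D`; this is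
`(∏_{x ∈ D} S⁻_x) |↑ ⋯ ↑⟩`. -/
def ket {a b : ℤ} (D : Finset (Sites a b)) : Space a b :=
  EuclideanSpace.single (fun x => if x ∈ D then 1 else 0) 1

/-- The sector `𝓗_{L,n}` of states with exactly `n` down spins. -/
def sector (L n : ℕ) : Submodule ℂ (Space 1 L) :=
  Submodule.span ℂ {v | ∃ D : Finset (Sites 1 L), D.card = n ∧ v = ket D}

/-- `ψ^{+-}_{[a,b]}(n)`: the sum over all positions of `n` down spins, each down spin at `x`
contributing a factor `q ^ (b + 1 - x)`. -/
def kinkPM (q : ℝ) (a b : ℤ) (n : ℕ) : Space a b :=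
  ∑ D : Finset (Sites a b) with D.card = n,
    ((q ^ (∑ x ∈ D, (b + 1 - (x : ℤ))) : ℝ) : ℂ) • ket D

/-- `ψ^{-+}_{[a,b]}(n)`: the sum over all positions of `n` down spins, each down spin at `x`
contributing a factor `q ^ (x + 1 - a)`. -/
def kinkMP (q : ℝ) (a b : ℤ) (n : ℕ) : Space a b :=
  ∑ D : Finset (Sites a b) with D.card = n,
    ((q ^ (∑ x ∈ D, ((x : ℤ) + 1 - a)) : ℝ) : ℂ) • ket D

/-- The tensor product `f ⊗ g` of a state on `[a, x]` and a state on `[x + 1, b]`. -/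
def tensor {a x b : ℤ} (hax : a ≤ x + 1) (hxb : x ≤ b) (f : Space a x) (g : Space (x + 1) b) :
    Space a b :=
  WithLp.toLp 2 fun σ =>
    f (fun y => σ (Set.inclusion (Set.Icc_subset_Icc_right hxb) y))
      * g (fun y => σ (Set.inclusion (Set.Icc_subset_Icc_left hax) y))

/-- The approximate droplet state
`ξ_{L,n}(x) = ψ^{+-}_{[1,x]}(⌊n/2⌋) ⊗ ψ^{-+}_{[x+1,L]}(⌈n/2⌉)`. -/
def xi (q : ℝ) (L n : ℕ) (x : ℤ) (h0 : 1 ≤ x + 1) (hL : x ≤ L) : Space 1 L :=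
  tensor h0 hL (kinkPM q 1 x (n / 2)) (kinkMP q (x + 1) L ((n + 1) / 2))

/-- The space `𝓚_{L,n}` spanned by the `ξ_{L,n}(x)` with `⌊n/2⌋ ≤ x ≤ L - ⌈n/2⌉`. -/
def approxDroplets (q : ℝ) (L n : ℕ) : Submodule ℂ (Space 1 L) :=
  Submodule.span ℂ {v | ∃ (x : ℤ) (h0 : 1 ≤ x + 1) (hL : x ≤ L),
    ((n / 2 : ℕ) : ℤ) ≤ x ∧ x ≤ (L : ℤ) - ((n + 1) / 2 : ℕ) ∧ v = xi q L n x h0 hL}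

/-- `lam` lists the eigenvalues of `H^{++}_{[1,L]}` on the sector `𝓗_{L,n}` in nondecreasing
order and with multiplicity, and `ψ` is an orthonormal basis of the sector formed by
corresponding eigenvectors. The indices start at `0`. -/
structure IsOrderedEigenbasis (Δ : ℝ) (L n : ℕ)
    (lam : Fin (Module.finrank ℂ (sector L n)) → ℝ)
    (ψ : OrthonormalBasis (Fin (Module.finrank ℂ (sector L n))) ℂ (sector L n)) : Prop where
  mono : Monotone lam
  eigen : ∀ j, droplet Δ L (ψ j : Space 1 L) = (lam j : ℂ) • (ψ j : Space 1 L)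

/-- The span `𝓗^k_{L,n}` of the first `k` eigenvectors. -/
def lowSpan {L n : ℕ}
    (ψ : OrthonormalBasis (Fin (Module.finrank ℂ (sector L n))) ℂ (sector L n)) (k : ℕ) :
    Submodule ℂ (Space 1 L) :=
  Submodule.span ℂ {v | ∃ j, j.val < k ∧ v = (ψ j : Space 1 L)}

end

end XXZ

/-!
The reason for the droplet spectrum: a chain with `n` down spins is, at low energy, a single
compact droplet, and a droplet consists of two kinks that hardly influence each other.

**Cutting the chain.** For every `x` the Hamiltonian is `A(Δ)` plus two kink chains, on `[1, x]`
and on `[x + 1, L]` (together `cutOp`), plus a coupling `seamOp` across the bond `(x, x + 1)` that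
annihilates the states in which both neighbouring spins are down (`droplet_eq_cut`). Kink chains
are sums of projections; distant ones commute and neighbouring ones satisfy a Temperley–Lieb
bound, so that `cutOp ^ 2 ≥ γ cutOp` (`cutOp_sq_ge`). The zero modes of a cut chain are the kink
pairs, one for each distribution of the down spins (`exists_eq_kinkPair`), and above them there is
a gap `γ = 1 - Δ⁻¹` (`cutOp_gap`). The kink pairs with `⌊n / 2⌋` down spins to the left of the cut
are the droplet states (`xi_eq_kinkPair`).

**The gap above the droplets.** Every domain wall costs at least `γ / 2` (`energy_ge_walls`). The
size of the cluster of down spins around the `k`-th down spin serves as a coordinate for a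
localization with functions `sin` and `cos`, at a price of order `walls / R ^ 2` when the
transition extends over cluster sizes up to `R` (`energy_split`). On the part with a cluster there
is a cut between two down spins, which decouples the state into two kink chains and gives it their
gap, except in the direction of a kink pair (`energy_block_ge`). If there is no cluster around any
of `N` well separated down spins, there are `N` domain walls (`le_walls`), which cost more than the
gap. Kink pairs concentrate exponentially on compact droplets, as the cyclic rearrangements which
fill a hole show (`hole_tail`, `holes_right`); hence a state without a cluster around the middle
down spin is almost orthogonal to all kink pairs, and a state orthogonal to the droplet states
remains so, up to small errors, when it is localized. With `R` proportional to `n` the total error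
is of order `1 / n` (`energy_gap`, `exists_droplet_gap`), which is better than `n ^ (-1 / 4)`.

**The droplets.** The overlap of two droplet states decays exponentially in `n` times the distance
of their cuts (`norm_inner_diag_kinkHat_le`), so that they are almost orthonormal and span a space
of dimension `L - n + 1` (`finrank_approxDroplets`). On a droplet state only the coupling across
its own cut deviates from `A(Δ)`, and the matrix elements of these couplings are of order
`q ^ n q ^ |x - y|` (`norm_inner_seamOp_kinkHat`). By Schur's test the space of droplet states is
invariant and of energy `A(Δ)` up to an error `q ^ n` in the quadratic form, and `q ^ (n / 2)` in
norm (`droplet_near_eigen`).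

**Conclusion.** A nearly invariant subspace with a gap above it (`NearlyInvariant`) determines the
low eigenvalues by the min-max principle, and its distance to the low eigenspace by the residual
divided by the gap. For boundedly many down spins all energies are bounded, and the estimates hold
with a large constant (`exists_spectralBounds_small`).
-/

namespace XXZ

/-! ### Spectral perturbation in finite dimension -/

section Abstract

variable {E : Type*} [NormedAddCommGroup E] [InnerProductSpace ℂ E]

/-- Operator-norm distance of two orthogonal projections, from the two one-sided distances of
their ranges. -/
theorem norm_starProjection_sub_le [FiniteDimensional ℂ E] (K M : Submodule ℂ E) (η : ℝ)
    (h0 : 0 ≤ η)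
    (hK : ∀ x ∈ K, ∃ y ∈ M, ‖x - y‖ ≤ η * ‖x‖) (hM : ∀ x ∈ M, ∃ y ∈ K, ‖x - y‖ ≤ η * ‖x‖) :
    ‖K.starProjection - M.starProjection‖ ≤ 2 * η := by
  have key : ∀ (U V : Submodule ℂ E), (∀ x ∈ U, ∃ y ∈ V, ‖x - y‖ ≤ η * ‖x‖) → ∀ x : E,
      ‖U.starProjection x - V.starProjection (U.starProjection x)‖ ≤ η * ‖x‖ := by
    intro U V h x
    obtain ⟨y, hy, hxy⟩ := h (U.starProjection x) (U.starProjection_apply_mem x)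
    have h1 : ‖U.starProjection x - V.starProjection (U.starProjection x)‖
        ≤ ‖U.starProjection x - y‖ := by
      rw [Submodule.starProjection_minimal]
      exact ciInf_le ⟨0, by rintro _ ⟨z, rfl⟩; positivity⟩ (⟨y, hy⟩ : V)
    have h2 := U.norm_starProjection_apply_le x
    exact h1.trans (hxy.trans (by gcongr))
  have key2 : ∀ x : E, ‖M.starProjection (x - K.starProjection x)‖ ≤ η * ‖x‖ := by
    intro x
    set u := x - K.starProjection x
    set p := M.starProjection u with hp
    have hpM : p ∈ M := M.starProjection_apply_mem u
    obtain ⟨y, hy, hpy⟩ := hM p hpM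
    have h1 : inner ℂ p u = (‖p‖ : ℂ) ^ 2 := by
      have h0 : inner ℂ p p = (‖p‖ : ℂ) ^ 2 := inner_self_eq_norm_sq_to_K p
      rw [← h0]
      have := M.starProjection_inner_eq_zero u p hpM
      rw [inner_sub_left] at this
      have h3 := sub_eq_zero.1 this
      have h4 := congrArg (starRingEnd ℂ) h3
      rwa [inner_conj_symm, inner_conj_symm] at h4
    have h2 : inner ℂ y u = 0 := by
      have := K.starProjection_inner_eq_zero x y hy
      rw [← inner_conj_symm, this]; simp
    have h3 : (‖p‖ : ℝ) ^ 2 ≤ η * ‖p‖ * ‖u‖ := by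
      have : inner ℂ (p - y) u = (‖p‖ : ℂ) ^ 2 := by rw [inner_sub_left, h1, h2, sub_zero]
      calc ‖p‖ ^ 2 = ‖inner ℂ (p - y) u‖ := by rw [this]; simp
        _ ≤ ‖p - y‖ * ‖u‖ := norm_inner_le_norm _ _
        _ ≤ _ := by gcongr
    have hu : ‖u‖ ≤ ‖x‖ := by
      have h5 := Submodule.norm_sq_eq_add_norm_sq_starProjection x K
      rw [Submodule.starProjection_orthogonal_val] at h5
      have : ‖u‖ ^ 2 ≤ ‖x‖ ^ 2 := by nlinarith [sq_nonneg ‖K.starProjection x‖]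
      exact le_of_sq_le_sq this (norm_nonneg _)
    rcases (norm_nonneg p).eq_or_lt with h | h
    · rw [← h]; positivity
    · have : ‖p‖ ≤ η * ‖u‖ := by
        by_contra hc; push Not at hc
        nlinarith
      exact this.trans (by gcongr)
  refine ContinuousLinearMap.opNorm_le_bound _ (by positivity) fun x => ?_
  have e : (K.starProjection - M.starProjection) x
      = (K.starProjection x - M.starProjection (K.starProjection x))
        - M.starProjection (x - K.starProjection x) := by
    simp [map_sub]
  rw [e]
  calc _ ≤ _ := norm_sub_le _ _
    _ ≤ η * ‖x‖ + η * ‖x‖ := add_le_add (key K M hK x) (key2 x)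
    _ = _ := by ring

theorem sum_coeff_smul {S : Submodule ℂ E} {N : ℕ} (ψ : OrthonormalBasis (Fin N) ℂ S)
    {v : E} (hv : v ∈ S) : ∑ j, inner ℂ (ψ j : E) v • (ψ j : E) = v := by
  have h := congrArg (Subtype.val) (ψ.sum_repr' ⟨v, hv⟩)
  simpa using h

theorem sum_norm_coeff_sq {S : Submodule ℂ E} {N : ℕ} (ψ : OrthonormalBasis (Fin N) ℂ S)
    {v : E} (hv : v ∈ S) : ∑ j, ‖inner ℂ (ψ j : E) v‖ ^ 2 = ‖v‖ ^ 2 := by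
  have h := ψ.sum_sq_norm_inner_right ⟨v, hv⟩
  simpa using h

theorem rayleigh_eq_sum {S : Submodule ℂ E} {N : ℕ} (ψ : OrthonormalBasis (Fin N) ℂ S)
    {T : E →L[ℂ] E} {lam : Fin N → ℝ} (hT : ∀ j, T (ψ j : E) = (lam j : ℂ) • (ψ j : E))
    {v : E} (hv : v ∈ S) :
    (inner ℂ v (T v)).re = ∑ j, lam j * ‖inner ℂ (ψ j : E) v‖ ^ 2 := by
  have h : T v = ∑ j, inner ℂ (ψ j : E) v • (lam j : ℂ) • (ψ j : E) := by
    conv_lhs => rw [← sum_coeff_smul ψ hv]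
    simp [map_sum, hT]
  rw [h, inner_sum, Complex.re_sum]
  refine Finset.sum_congr rfl fun j _ => ?_
  rw [inner_smul_right, inner_smul_right, ← inner_conj_symm v (ψ j : E)]
  rw [mul_left_comm, Complex.mul_conj, Complex.normSq_eq_norm_sq, ← Complex.ofReal_mul,
    Complex.ofReal_re]

/-- A subspace of larger dimension than `K` meets the orthogonal complement of `K`. -/
theorem exists_mem_orthogonal_of_finrank_lt [FiniteDimensional ℂ E] (K M : Submodule ℂ E)
    (h : Module.finrank ℂ K < Module.finrank ℂ M) :
    ∃ v ∈ M, v ≠ 0 ∧ ∀ x ∈ K, inner ℂ x v = 0 := by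
  let f : M →ₗ[ℂ] K := (K.orthogonalProjectionOnto : E →ₗ[ℂ] K) ∘ₗ M.subtype
  have hker : LinearMap.ker f ≠ ⊥ := LinearMap.ker_ne_bot_of_finrank_lt h
  obtain ⟨v, hv, hv0⟩ := Submodule.exists_mem_ne_zero_of_ne_bot hker
  refine ⟨v, v.2, by simpa using hv0, fun x hx => ?_⟩
  have h1 : K.orthogonalProjectionOnto (v : E) = 0 := hv
  have h2 : (v : E) ∈ Kᗮ := by
    rwa [Submodule.orthogonalProjectionOnto_eq_zero_iff] at h1
  exact (Submodule.mem_orthogonal K _).1 h2 x hx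

/-- The span of an initial segment of an orthonormal basis has the expected dimension. -/
theorem finrank_span_initial {S : Submodule ℂ E} {N : ℕ} (ψ : OrthonormalBasis (Fin N) ℂ S)
    (k : ℕ) (hk : k ≤ N) :
    Module.finrank ℂ (Submodule.span ℂ {v : E | ∃ j : Fin N, j.val < k ∧ v = (ψ j : E)}) = k := by
  have hO : Orthonormal ℂ (fun j : Fin N => (ψ j : E)) := by
    have := ψ.orthonormal.comp_linearIsometry S.subtypeₗᵢ
    simpa [Function.comp_def] using this
  have h1 : {v : E | ∃ j : Fin N, j.val < k ∧ v = (ψ j : E)}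
      = Set.range (fun i : Fin k => (ψ (Fin.castLE hk i) : E)) := by
    ext v; constructor
    · rintro ⟨j, hj, rfl⟩; exact ⟨⟨j, hj⟩, rfl⟩
    · rintro ⟨i, rfl⟩; exact ⟨Fin.castLE hk i, by simp, rfl⟩
  have hli := (hO.comp _ (Fin.castLE_injective hk)).linearIndependent
  rw [h1, finrank_span_eq_card (b := fun i : Fin k => (ψ (Fin.castLE hk i) : E)) hli]
  simp

theorem inner_eq_zero_of_mem_span_initial {S : Submodule ℂ E} {N : ℕ}
    (ψ : OrthonormalBasis (Fin N) ℂ S) {k : ℕ} {v : E}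
    (hv : v ∈ Submodule.span ℂ {v : E | ∃ j : Fin N, j.val < k ∧ v = (ψ j : E)})
    {i : Fin N} (hi : k ≤ i.val) : inner ℂ (ψ i : E) v = 0 := by
  induction hv using Submodule.span_induction with
  | mem x hx =>
    obtain ⟨j, hj, rfl⟩ := hx
    have := ψ.orthonormal.2 (i := i) (j := j) (by rintro rfl; omega)
    simpa using this
  | zero => simp
  | add x y _ _ hx hy => rw [inner_add_right, hx, hy, add_zero]
  | smul c x _ hx => rw [inner_smul_right, hx, mul_zero]

theorem span_initial_le {S : Submodule ℂ E} {N : ℕ} (ψ : OrthonormalBasis (Fin N) ℂ S) (k : ℕ) :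
    Submodule.span ℂ {v : E | ∃ j : Fin N, j.val < k ∧ v = (ψ j : E)} ≤ S :=
  Submodule.span_le.2 (by rintro _ ⟨j, _, rfl⟩; exact (ψ j).2)

variable [FiniteDimensional ℂ E] (T : E →L[ℂ] E) (S K : Submodule ℂ E)

/-- The operator `T` on `S` is, up to an error governed by `ε`, equal to `a` on `K` and at least
`a + g` on the orthogonal complement of `K` in `S`. -/
structure NearlyInvariant (a g ε : ℝ) : Prop where
  le : K ≤ S
  symm : ∀ x y, inner ℂ (T x) y = inner ℂ x (T y)
  pos : 0 < g
  nonneg : 0 ≤ ε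
  form : ∀ x ∈ K, |(inner ℂ x (T x)).re - a * ‖x‖ ^ 2| ≤ ε ^ 2 * ‖x‖ ^ 2
  resid : ∀ x ∈ K, ‖T x - (a : ℂ) • x‖ ≤ ε * ‖x‖
  gap : ∀ v ∈ S, (∀ x ∈ K, inner ℂ x v = 0) → (a + g) * ‖v‖ ^ 2 ≤ (inner ℂ v (T v)).re

variable {T S K} {a g ε : ℝ}

/-- Block decomposition of the quadratic form with respect to `K` and its complement. -/
theorem NearlyInvariant.form_ge (h : NearlyInvariant T S K a g ε) {v : E} (hv : v ∈ S) :
    a * ‖v‖ ^ 2 - ε ^ 2 * ‖K.starProjection v‖ ^ 2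
      - 2 * ε * ‖K.starProjection v‖ * ‖v - K.starProjection v‖
      + g * ‖v - K.starProjection v‖ ^ 2 ≤ (inner ℂ v (T v)).re := by
  set x := K.starProjection v with hx
  set w := v - x with hw
  have hxK : x ∈ K := K.starProjection_apply_mem v
  have hvxw : v = x + w := by rw [hw]; abel
  have hwK : ∀ y ∈ K, inner ℂ y w = 0 := by
    intro y hy
    have := K.starProjection_inner_eq_zero v y hy
    rw [← inner_conj_symm, this]; simp
  have hwS : w ∈ S := S.sub_mem hv (h.le hxK)
  have hn : ‖v‖ ^ 2 = ‖x‖ ^ 2 + ‖w‖ ^ 2 := by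
    rw [hvxw, @norm_add_sq ℂ, hwK x hxK]; simp
  have h1 : inner ℂ w (T x) = inner ℂ w (T x - (a : ℂ) • x) := by
    rw [inner_sub_right, inner_smul_right, ← inner_conj_symm w x, hwK x hxK]; simp
  have h2 : (inner ℂ v (T v)).re
      = (inner ℂ x (T x)).re + 2 * (inner ℂ w (T x)).re + (inner ℂ w (T w)).re := by
    have h3 : inner ℂ x (T w) = (starRingEnd ℂ) (inner ℂ w (T x)) := by
      rw [inner_conj_symm, h.symm]
    rw [hvxw, map_add, inner_add_left, inner_add_right, inner_add_right, h3]
    simp only [Complex.add_re, Complex.conj_re]; ring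
  have h3 : -(ε * ‖x‖ * ‖w‖) ≤ (inner ℂ w (T x)).re := by
    rw [h1]
    have e1 := Complex.abs_re_le_norm (inner ℂ w (T x - (a : ℂ) • x))
    have e2 := norm_inner_le_norm (𝕜 := ℂ) w (T x - (a : ℂ) • x)
    have e3 := h.resid x hxK
    have e4 : ‖w‖ * ‖T x - (a : ℂ) • x‖ ≤ ‖w‖ * (ε * ‖x‖) := by gcongr
    have := (abs_le.1 (e1.trans (e2.trans e4))).1
    nlinarith
  have h4 := (abs_le.1 (h.form x hxK)).1
  have h5 := h.gap w hwS hwK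
  rw [h2, hn]
  nlinarith

theorem NearlyInvariant.form_ge_sub (h : NearlyInvariant T S K a g ε) {v : E} (hv : v ∈ S) :
    (a - ε ^ 2 * (1 + 2 / g)) * ‖v‖ ^ 2 + g / 2 * ‖v - K.starProjection v‖ ^ 2
      ≤ (inner ℂ v (T v)).re := by
  have h1 := h.form_ge hv
  have hg := h.pos
  have hp : ‖K.starProjection v‖ ≤ ‖v‖ := K.norm_starProjection_apply_le v
  set p := ‖K.starProjection v‖
  set w := ‖v - K.starProjection v‖
  have hp2 : p ^ 2 ≤ ‖v‖ ^ 2 := by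
    have : 0 ≤ p := norm_nonneg _
    gcongr
  have h2 : 2 * ε * p * w ≤ ε ^ 2 * (2 / g) * p ^ 2 + g / 2 * w ^ 2 := by
    have : 0 ≤ (g / 2) * (w - 2 * ε * p / g) ^ 2 := by positivity
    have e : (g / 2) * (w - 2 * ε * p / g) ^ 2
        = g / 2 * w ^ 2 - 2 * ε * p * w + ε ^ 2 * (2 / g) * p ^ 2 := by
      field_simp; ring
    linarith
  have h3 : ε ^ 2 * (1 + 2 / g) * p ^ 2 ≤ ε ^ 2 * (1 + 2 / g) * ‖v‖ ^ 2 := by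
    gcongr
  nlinarith

variable {N : ℕ} {ψ : OrthonormalBasis (Fin N) ℂ S} {lam : Fin N → ℝ}

/-- Completing the square in the block decomposition bounds the whole spectrum from below. -/
theorem NearlyInvariant.le_eigenvalue (h : NearlyInvariant T S K a g ε)
    (heig : ∀ j, T (ψ j : E) = (lam j : ℂ) • (ψ j : E)) (j : Fin N) :
    a - ε ^ 2 * (1 + 2 / g) ≤ lam j := by
  have h1 := h.form_ge_sub (ψ j).2
  have hn : ‖(ψ j : E)‖ = 1 := ψ.orthonormal.1 j
  rw [heig, inner_smul_right, inner_self_eq_norm_sq_to_K, hn] at h1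
  have hg := h.pos
  have : 0 ≤ g / 2 * ‖(ψ j : E) - K.starProjection (ψ j : E)‖ ^ 2 := by positivity
  simp at h1
  linarith

/-- Min-max bound: the trial vector lies in `K` and is orthogonal to the first `j` eigenvectors. -/
theorem NearlyInvariant.eigenvalue_le (h : NearlyInvariant T S K a g ε) (hmono : Monotone lam)
    (heig : ∀ j, T (ψ j : E) = (lam j : ℂ) • (ψ j : E)) {j : Fin N}
    (hj : j.val < Module.finrank ℂ K) : lam j ≤ a + ε ^ 2 := by
  obtain ⟨v, hvK, hv0, hv⟩ := exists_mem_orthogonal_of_finrank_lt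
    (Submodule.span ℂ {v : E | ∃ i : Fin N, i.val < j.val ∧ v = (ψ i : E)}) K
    (by rwa [finrank_span_initial ψ j.val j.2.le])
  have hvS := h.le hvK
  have h1 := (abs_le.1 (h.form v hvK)).2
  rw [rayleigh_eq_sum ψ heig hvS] at h1
  have h2 : lam j * ‖v‖ ^ 2 ≤ ∑ i, lam i * ‖inner ℂ (ψ i : E) v‖ ^ 2 := by
    rw [← sum_norm_coeff_sq ψ hvS, Finset.mul_sum]
    refine Finset.sum_le_sum fun i _ => ?_
    by_cases hij : i.val < j.val
    · rw [hv _ (Submodule.subset_span ⟨i, hij, rfl⟩)]; simp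
    · have : lam j ≤ lam i := hmono (by rw [Fin.le_def]; omega)
      gcongr
  have h3 : 0 < ‖v‖ ^ 2 := by have := norm_pos_iff.2 hv0; positivity
  nlinarith

/-- Max-min bound: the trial vector is a combination of the first `j + 1` eigenvectors that is
orthogonal to `K`. -/
theorem NearlyInvariant.add_gap_le_eigenvalue (h : NearlyInvariant T S K a g ε)
    (hmono : Monotone lam)
    (heig : ∀ j, T (ψ j : E) = (lam j : ℂ) • (ψ j : E)) {j : Fin N}
    (hj : Module.finrank ℂ K ≤ j.val) : a + g ≤ lam j := by
  obtain ⟨v, hvM, hv0, hv⟩ := exists_mem_orthogonal_of_finrank_lt K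
    (Submodule.span ℂ {v : E | ∃ i : Fin N, i.val < j.val + 1 ∧ v = (ψ i : E)})
    (by rw [finrank_span_initial ψ (j.val + 1) j.2]; omega)
  have hvS := span_initial_le ψ _ hvM
  have h1 := h.gap v hvS hv
  rw [rayleigh_eq_sum ψ heig hvS] at h1
  have h2 : ∑ i, lam i * ‖inner ℂ (ψ i : E) v‖ ^ 2 ≤ lam j * ‖v‖ ^ 2 := by
    rw [← sum_norm_coeff_sq ψ hvS, Finset.mul_sum]
    refine Finset.sum_le_sum fun i _ => ?_
    by_cases hij : j.val + 1 ≤ i.val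
    · rw [inner_eq_zero_of_mem_span_initial ψ hvM hij]; simp
    · have : lam i ≤ lam j := hmono (by rw [Fin.le_def]; omega)
      gcongr
  have h3 : 0 < ‖v‖ ^ 2 := by have := norm_pos_iff.2 hv0; positivity
  nlinarith

/-- Vectors of `K` are close to the span of the first `finrank K` eigenvectors. -/
theorem NearlyInvariant.exists_near_low (h : NearlyInvariant T S K a g ε) (hmono : Monotone lam)
    (heig : ∀ j, T (ψ j : E) = (lam j : ℂ) • (ψ j : E)) {x : E} (hx : x ∈ K) :
    ∃ y ∈ Submodule.span ℂ {v : E | ∃ i : Fin N, i.val < Module.finrank ℂ K ∧ v = (ψ i : E)},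
      ‖x - y‖ ^ 2 ≤ ε ^ 2 * ((2 + 2 / g) / g) * ‖x‖ ^ 2 := by
  set d := Module.finrank ℂ K
  have hg := h.pos
  have hxS := h.le hx
  set y := ∑ i : Fin N with i.val < d, inner ℂ (ψ i : E) x • (ψ i : E) with hy
  have hyM : y ∈ Submodule.span ℂ {v : E | ∃ i : Fin N, i.val < d ∧ v = (ψ i : E)} := by
    refine Submodule.sum_mem _ fun i hi => Submodule.smul_mem _ _ (Submodule.subset_span ?_)
    exact ⟨i, (Finset.mem_filter.1 hi).2, rfl⟩
  refine ⟨y, hyM, ?_⟩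
  have hyS := span_initial_le ψ _ hyM
  have hc : ∀ i, inner ℂ (ψ i : E) (x - y) = if i.val < d then 0 else inner ℂ (ψ i : E) x := by
    intro i
    rw [inner_sub_right]
    split_ifs with hi
    · rw [hy, inner_sum, Finset.sum_eq_single i]
      · have : inner ℂ (ψ i : E) (ψ i : E) = (1 : ℂ) := by
          have h1 : ‖(ψ i : E)‖ = 1 := ψ.orthonormal.1 i
          rw [inner_self_eq_norm_sq_to_K, h1]; simp
        rw [inner_smul_right, this]; ring
      · intro j _ hj
        have := ψ.orthonormal.2 (Ne.symm hj)
        rw [inner_smul_right]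
        have e : inner ℂ (ψ i : E) (ψ j : E) = (0 : ℂ) := by simpa using this
        rw [e, mul_zero]
      · intro hn; exact absurd (by simpa using hi) hn
    · rw [inner_eq_zero_of_mem_span_initial ψ hyM (not_lt.1 hi), sub_zero]
  have h1 := (abs_le.1 (h.form x hx)).2
  rw [rayleigh_eq_sum ψ heig hxS] at h1
  have h2 : (a - ε ^ 2 * (1 + 2 / g)) * ‖x‖ ^ 2 + g * ‖x - y‖ ^ 2
      ≤ ∑ i, lam i * ‖inner ℂ (ψ i : E) x‖ ^ 2 := by
    rw [← sum_norm_coeff_sq ψ hxS, ← sum_norm_coeff_sq ψ (S.sub_mem hxS hyS), Finset.mul_sum,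
      Finset.mul_sum, ← Finset.sum_add_distrib]
    refine Finset.sum_le_sum fun i _ => ?_
    rw [hc i]
    split_ifs with hi
    · have := h.le_eigenvalue heig i
      simp only [norm_zero]
      nlinarith [sq_nonneg ‖inner ℂ (ψ i : E) x‖]
    · have := h.add_gap_le_eigenvalue hmono heig (not_lt.1 hi)
      have e : 0 ≤ ε ^ 2 * (1 + 2 / g) := by positivity
      nlinarith [sq_nonneg ‖inner ℂ (ψ i : E) x‖]
  have h3 : g * ‖x - y‖ ^ 2 ≤ ε ^ 2 * (2 + 2 / g) * ‖x‖ ^ 2 := by nlinarith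
  calc ‖x - y‖ ^ 2 = (g * ‖x - y‖ ^ 2) / g := by field_simp
    _ ≤ (ε ^ 2 * (2 + 2 / g) * ‖x‖ ^ 2) / g := by gcongr
    _ = _ := by ring

/-- The span of the first `finrank K` eigenvectors is close to `K`. -/
theorem NearlyInvariant.low_near (h : NearlyInvariant T S K a g ε) (hmono : Monotone lam)
    (heig : ∀ j, T (ψ j : E) = (lam j : ℂ) • (ψ j : E)) {x : E}
    (hx : x ∈ Submodule.span ℂ
      {v : E | ∃ i : Fin N, i.val < Module.finrank ℂ K ∧ v = (ψ i : E)}) :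
    ∃ y ∈ K, ‖x - y‖ ^ 2 ≤ ε ^ 2 * (2 * (2 + 2 / g) / g) * ‖x‖ ^ 2 := by
  have hg := h.pos
  have hxS := span_initial_le ψ _ hx
  refine ⟨K.starProjection x, K.starProjection_apply_mem x, ?_⟩
  have h1 := h.form_ge_sub hxS
  have h2 : (inner ℂ x (T x)).re ≤ (a + ε ^ 2) * ‖x‖ ^ 2 := by
    rw [rayleigh_eq_sum ψ heig hxS, ← sum_norm_coeff_sq ψ hxS, Finset.mul_sum]
    refine Finset.sum_le_sum fun i _ => ?_
    by_cases hi : i.val < Module.finrank ℂ K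
    · have := h.eigenvalue_le hmono heig hi
      gcongr
    · rw [inner_eq_zero_of_mem_span_initial ψ hx (not_lt.1 hi)]; simp
  have h3 : g / 2 * ‖x - K.starProjection x‖ ^ 2 ≤ ε ^ 2 * (2 + 2 / g) * ‖x‖ ^ 2 := by nlinarith
  calc ‖x - K.starProjection x‖ ^ 2 = (g / 2 * ‖x - K.starProjection x‖ ^ 2) * (2 / g) := by
        field_simp
    _ ≤ (ε ^ 2 * (2 + 2 / g) * ‖x‖ ^ 2) * (2 / g) := by gcongr
    _ = _ := by ring

/-- If `‖T x‖² ≥ γ ⟨x, T x⟩` for a positive operator `T`, then `T ≥ γ` off its kernel. -/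
theorem gap_of_sq_ge {F : E →ₗ[ℂ] E} (hsymm : ∀ x y, inner ℂ (F x) y = inner ℂ x (F y))
    {γ : ℝ} (hγ : 0 < γ) (hpos : ∀ x, 0 ≤ (inner ℂ x (F x)).re)
    (hsq : ∀ x, γ * (inner ℂ x (F x)).re ≤ ‖F x‖ ^ 2) {v : E}
    (hv : ∀ x, F x = 0 → inner ℂ x v = 0) : γ * ‖v‖ ^ 2 ≤ (inner ℂ v (F v)).re := by
  have hF : F.IsSymmetric := hsymm
  have hvr : v ∈ LinearMap.range F := by
    have h1 : v ∈ (LinearMap.ker F)ᗮ := (Submodule.mem_orthogonal _ _).2 fun x hx => hv x hx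
    rw [← hF.orthogonal_range, Submodule.orthogonal_orthogonal] at h1
    exact h1
  obtain ⟨u, rfl⟩ := hvr
  -- the Cauchy-Schwarz inequality for the positive form of `F`, applied to `u` and `F u`
  have hcs : ∀ t : ℝ, 0 ≤ (inner ℂ u (F u)).re * (t * t) + (2 * ‖F u‖ ^ 2) * t
      + (inner ℂ (F u) (F (F u))).re := by
    intro t
    have h := hpos ((t : ℂ) • u + F u)
    have e1 : inner ℂ u (F (F u)) = (‖F u‖ : ℂ) ^ 2 := by
      rw [← hsymm, inner_self_eq_norm_sq_to_K]; rfl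
    have e2 : inner ℂ (F u) (F u) = (‖F u‖ : ℂ) ^ 2 := by
      rw [inner_self_eq_norm_sq_to_K]; rfl
    simp only [map_add, map_smul, inner_add_left, inner_add_right, inner_smul_left,
      inner_smul_right, Complex.conj_ofReal, e1, e2] at h
    have e3 : ((‖F u‖ : ℂ) ^ 2) = ((‖F u‖ ^ 2 : ℝ) : ℂ) := by push_cast; rfl
    rw [e3] at h
    simp only [Complex.add_re, Complex.re_ofReal_mul, Complex.ofReal_re] at h
    linarith
  have hd := discrim_le_zero hcs
  rw [discrim] at hd
  have h1 := hsq u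
  have h2 := hpos u
  have h3 := hpos (F u)
  set A := (inner ℂ u (F u)).re
  set B := (inner ℂ (F u) (F (F u))).re
  set z := ‖F u‖ ^ 2
  have hz : 0 ≤ z := by positivity
  have h4 : z * z ≤ A * B := by nlinarith
  rcases hz.eq_or_lt with h0 | h0
  · rw [← h0]; simpa using h3
  · have h5 : γ * (z * z) ≤ z * B := by
      calc γ * (z * z) ≤ γ * (A * B) := by gcongr
        _ = γ * A * B := by ring
        _ ≤ z * B := by gcongr
    nlinarith

omit [FiniteDimensional ℂ E] in
/-- A sum of operators which are almost pairwise positively correlated: only neighbours interact,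
and by at most `δ / 2` in the sense of quadratic forms. -/
theorem norm_sum_sq_ge (s : Finset ℤ) (f : ℤ → E) {δ : ℝ} (hδ : 0 ≤ δ)
    (hfar : ∀ i ∈ s, ∀ j ∈ s, i + 1 < j → 0 ≤ (inner ℂ (f i) (f j)).re)
    (hnear : ∀ i ∈ s, i + 1 ∈ s →
      -(δ / 4 * (‖f i‖ ^ 2 + ‖f (i + 1)‖ ^ 2)) ≤ (inner ℂ (f i) (f (i + 1))).re) :
    (1 - δ) * ∑ i ∈ s, ‖f i‖ ^ 2 ≤ ‖∑ i ∈ s, f i‖ ^ 2 := by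
  have hsym : ∀ i j, (inner ℂ (f i) (f j)).re = (inner ℂ (f j) (f i)).re := fun i j => by
    rw [← inner_conj_symm (f i), Complex.conj_re]
  have hent : ∀ i ∈ s, ∀ j ∈ s,
      (if j = i then ‖f i‖ ^ 2 else 0)
        - ((if j = i + 1 then δ / 4 * (‖f i‖ ^ 2 + ‖f j‖ ^ 2) else 0)
          + (if i = j + 1 then δ / 4 * (‖f i‖ ^ 2 + ‖f j‖ ^ 2) else 0))
        ≤ (inner ℂ (f i) (f j)).re := by
    intro i hi j hj
    rcases lt_trichotomy i j with h | h | h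
    · rw [if_neg (by omega), if_neg (c := i = j + 1) (by omega)]
      split_ifs with h1
      · subst h1; have := hnear i hi hj; linarith
      · have := hfar i hi j hj (by omega); linarith
    · subst h
      rw [if_pos rfl, if_neg (by omega), inner_self_eq_norm_sq_to_K]
      simp [← Complex.ofReal_pow]
    · rw [if_neg (by omega), if_neg (by omega), hsym]
      split_ifs with h1
      · subst h1; have := hnear j hj hi; linarith
      · have := hfar j hj i hi (by omega); linarith
  have hexp : ‖∑ i ∈ s, f i‖ ^ 2 = ∑ i ∈ s, ∑ j ∈ s, (inner ℂ (f i) (f j)).re := by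
    have : ‖∑ i ∈ s, f i‖ ^ 2 = (inner ℂ (∑ i ∈ s, f i) (∑ i ∈ s, f i)).re := by
      rw [inner_self_eq_norm_sq_to_K]; simp [← Complex.ofReal_pow]
    rw [this, sum_inner, Complex.re_sum]
    refine Finset.sum_congr rfl fun i _ => ?_
    rw [inner_sum, Complex.re_sum]
  rw [hexp]
  refine le_trans ?_ (Finset.sum_le_sum fun i hi => Finset.sum_le_sum fun j hj => hent i hi j hj)
  simp only [Finset.sum_sub_distrib, Finset.sum_add_distrib]
  have hb : ∀ x : ℤ → ℝ, (∀ i, 0 ≤ x i) → ∀ g : ℤ → ℤ, Function.Injective g →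
      ∑ i ∈ s, (if g i ∈ s then x (g i) else 0) ≤ ∑ i ∈ s, x i := by
    intro x hx g hg
    rw [← Finset.sum_filter, ← Finset.sum_image (f := x) (g := g) (fun a _ b _ h => hg h)]
    refine Finset.sum_le_sum_of_subset_of_nonneg ?_ (fun i _ _ => hx i)
    intro i hi
    obtain ⟨j, hj, rfl⟩ := Finset.mem_image.1 hi
    exact (Finset.mem_filter.1 hj).2
  have hnn : ∀ i, 0 ≤ ‖f i‖ ^ 2 := fun i => by positivity
  have e0 : ∑ i ∈ s, ∑ j ∈ s, (if j = i then ‖f i‖ ^ 2 else 0) = ∑ i ∈ s, ‖f i‖ ^ 2 := by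
    refine Finset.sum_congr rfl fun i hi => ?_
    rw [Finset.sum_ite_eq' s i]; simp [hi]
  have e1 : ∑ i ∈ s, ∑ j ∈ s, (if j = i + 1 then δ / 4 * (‖f i‖ ^ 2 + ‖f j‖ ^ 2) else 0)
      ≤ δ / 2 * ∑ i ∈ s, ‖f i‖ ^ 2 := by
    have : ∀ i ∈ s, ∑ j ∈ s, (if j = i + 1 then δ / 4 * (‖f i‖ ^ 2 + ‖f j‖ ^ 2) else 0)
        ≤ δ / 4 * ‖f i‖ ^ 2 + δ / 4 * (if i + 1 ∈ s then ‖f (i + 1)‖ ^ 2 else 0) := by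
      intro i _
      rw [Finset.sum_ite_eq' s (i + 1)]
      have := hnn i
      split_ifs
      · linarith
      · simp; positivity
    refine (Finset.sum_le_sum this).trans ?_
    rw [Finset.sum_add_distrib, ← Finset.mul_sum, ← Finset.mul_sum]
    have := hb (fun i => ‖f i‖ ^ 2) hnn (· + 1) (add_left_injective 1)
    have : δ / 4 * ∑ i ∈ s, (if i + 1 ∈ s then ‖f (i + 1)‖ ^ 2 else 0)
      ≤ δ / 4 * ∑ i ∈ s, ‖f i‖ ^ 2 := by gcongr
    linarith
  have e2 : ∑ i ∈ s, ∑ j ∈ s, (if i = j + 1 then δ / 4 * (‖f i‖ ^ 2 + ‖f j‖ ^ 2) else 0)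
      ≤ δ / 2 * ∑ i ∈ s, ‖f i‖ ^ 2 := by
    rw [Finset.sum_comm]
    refine le_trans (le_of_eq ?_) e1
    refine Finset.sum_congr rfl fun i _ => Finset.sum_congr rfl fun j _ => ?_
    split_ifs
    · ring
    · rfl
  rw [e0]
  linarith

/-- Schur's test for a nonnegative symmetric kernel. -/
theorem schur_test {ι : Type*} (s : Finset ι) {k : ι → ι → ℝ} (hk : ∀ x y, 0 ≤ k x y)
    (hsymm : ∀ x y, k x y = k y x) (c : ι → ℝ) {M : ℝ} (hM : ∀ x ∈ s, ∑ y ∈ s, k x y ≤ M) :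
    ∑ x ∈ s, ∑ y ∈ s, c x * c y * k x y ≤ M * ∑ x ∈ s, c x ^ 2 := by
  have h2 : ∑ x ∈ s, ∑ y ∈ s, c x * c y * k x y
      ≤ ∑ x ∈ s, ∑ y ∈ s, (c x ^ 2 / 2 * k x y + c y ^ 2 / 2 * k x y) := by
    refine Finset.sum_le_sum fun x _ => Finset.sum_le_sum fun y _ => ?_
    rw [← add_mul]
    have := hk x y
    gcongr
    nlinarith [sq_nonneg (c x - c y)]
  refine h2.trans ?_
  simp only [Finset.sum_add_distrib]
  have h3 : ∑ x ∈ s, ∑ y ∈ s, c x ^ 2 / 2 * k x y ≤ M / 2 * ∑ x ∈ s, c x ^ 2 := by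
    rw [Finset.mul_sum]
    refine Finset.sum_le_sum fun x hx => ?_
    rw [← Finset.mul_sum]
    have := hM x hx
    calc _ ≤ c x ^ 2 / 2 * M := by gcongr
      _ = _ := by ring
  have h4 : ∑ x ∈ s, ∑ y ∈ s, c y ^ 2 / 2 * k x y = ∑ x ∈ s, ∑ y ∈ s, c x ^ 2 / 2 * k x y := by
    rw [Finset.sum_comm]
    exact Finset.sum_congr rfl fun x _ => Finset.sum_congr rfl fun y _ => by rw [hsymm]
  linarith

omit [FiniteDimensional ℂ E] in
/-- Schur's test for the sesquilinear form of two families of vectors. -/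
theorem norm_inner_sum_smul_le {ι : Type*} (s : Finset ι) (v w : ι → E) (c : ι → ℂ)
    {k : ι → ι → ℝ} (hk : ∀ x y, 0 ≤ k x y) (hsymm : ∀ x y, k x y = k y x) {M : ℝ}
    (hM : ∀ x ∈ s, ∑ y ∈ s, k x y ≤ M) (hvw : ∀ x ∈ s, ∀ y ∈ s, ‖inner ℂ (v x) (w y)‖ ≤ k x y) :
    ‖inner ℂ (∑ x ∈ s, c x • v x) (∑ x ∈ s, c x • w x)‖ ≤ M * ∑ x ∈ s, ‖c x‖ ^ 2 := by
  refine le_trans ?_ (schur_test s hk hsymm (fun x => ‖c x‖) hM)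
  rw [sum_inner]
  refine (norm_sum_le _ _).trans (Finset.sum_le_sum fun x hx => ?_)
  rw [inner_sum]
  refine (norm_sum_le _ _).trans (Finset.sum_le_sum fun y hy => ?_)
  rw [inner_smul_left, inner_smul_right, norm_mul, norm_mul, RCLike.norm_conj, ← mul_assoc]
  have := hvw x hx y hy
  gcongr

omit [FiniteDimensional ℂ E] in
theorem norm_sum_smul_sq_le {ι : Type*} (s : Finset ι) (w : ι → E) (c : ι → ℂ) {M : ℝ}
    (hM : ∀ x ∈ s, ∑ y ∈ s, ‖inner ℂ (w x) (w y)‖ ≤ M) :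
    ‖∑ x ∈ s, c x • w x‖ ^ 2 ≤ M * ∑ x ∈ s, ‖c x‖ ^ 2 := by
  have h := norm_inner_sum_smul_le s w w c (fun x y => norm_nonneg (inner ℂ (w x) (w y)))
    (fun x y => by rw [← inner_conj_symm, RCLike.norm_conj]) hM (fun _ _ _ _ => le_rfl)
  rw [inner_self_eq_norm_sq_to_K] at h
  simpa using h

omit [FiniteDimensional ℂ E] in
/-- Bessel's inequality for an almost orthogonal family. -/
theorem sum_norm_inner_sq_le {ι : Type*} (s : Finset ι) (w : ι → E) (v : E) {M : ℝ}
    (hM0 : 0 ≤ M) (hM : ∀ x ∈ s, ∑ y ∈ s, ‖inner ℂ (w x) (w y)‖ ≤ M) :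
    ∑ x ∈ s, ‖inner ℂ (w x) v‖ ^ 2 ≤ M * ‖v‖ ^ 2 := by
  set c : ι → ℂ := fun x => inner ℂ (w x) v
  set Z := ∑ x ∈ s, ‖c x‖ ^ 2 with hZ
  have hZ0 : 0 ≤ Z := Finset.sum_nonneg fun _ _ => by positivity
  have h1 := norm_sum_smul_sq_le s w c hM
  have h2 : (Z : ℂ) = inner ℂ (∑ x ∈ s, c x • w x) v := by
    rw [sum_inner, hZ]
    push_cast
    refine Finset.sum_congr rfl fun x _ => ?_
    rw [inner_smul_left]
    simp only [c]
    rw [mul_comm, Complex.mul_conj, Complex.normSq_eq_norm_sq]; push_cast; rfl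
  have h3 : Z ≤ ‖∑ x ∈ s, c x • w x‖ * ‖v‖ := by
    have := norm_inner_le_norm (𝕜 := ℂ) (∑ x ∈ s, c x • w x) v
    rw [← h2, Complex.norm_real, Real.norm_of_nonneg hZ0] at this
    exact this
  have h4 : Z ^ 2 ≤ M * Z * ‖v‖ ^ 2 := by
    calc Z ^ 2 ≤ (‖∑ x ∈ s, c x • w x‖ * ‖v‖) ^ 2 := by gcongr
      _ = ‖∑ x ∈ s, c x • w x‖ ^ 2 * ‖v‖ ^ 2 := by ring
      _ ≤ _ := by gcongr
  rcases hZ0.eq_or_lt with h | h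
  · rw [← h]; positivity
  · nlinarith

end Abstract

/-! ### Sites, exchanges of neighbours and diagonal operators -/

section Lattice

variable {L : ℕ} [NeZero L]

theorem one_le_cast (L : ℕ) [NeZero L] : (1 : ℤ) ≤ L := by
  have := NeZero.pos L
  omega

/-- The site with coordinate `i`; coordinates outside `[1, L]` are sent to the nearest end. -/
noncomputable def st (L : ℕ) [NeZero L] (i : ℤ) : Sites 1 L :=
  ⟨max 1 (min i L), le_max_left _ _, max_le (one_le_cast L) (min_le_right _ _)⟩

theorem st_val {i : ℤ} (h1 : 1 ≤ i) (h2 : i ≤ L) : (st L i).1 = i := by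
  simp [st, h1, h2]

theorem st_coe (y : Sites 1 L) : st L y.1 = y :=
  Subtype.ext (st_val y.2.1 y.2.2)

theorem st_ne {i j : ℤ} (hi : 1 ≤ i) (hi' : i ≤ L) (hj : 1 ≤ j) (hj' : j ≤ L) (h : i ≠ j) :
    st L i ≠ st L j := by
  intro he
  have := congrArg Subtype.val he
  rw [st_val hi hi', st_val hj hj'] at this
  exact h this

/-- Exchange of the spins at `i` and `i + 1`. -/
noncomputable def sw (i : ℤ) (σ : Config 1 L) : Config 1 L :=
  σ ∘ Equiv.swap (st L i) (st L (i + 1))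

@[simp] theorem sw_left (i : ℤ) (σ : Config 1 L) : sw i σ (st L i) = σ (st L (i + 1)) := by
  simp [sw]

@[simp] theorem sw_right (i : ℤ) (σ : Config 1 L) : sw i σ (st L (i + 1)) = σ (st L i) := by
  simp [sw]

theorem sw_of_ne {i : ℤ} (σ : Config 1 L) {y : Sites 1 L} (h1 : y ≠ st L i)
    (h2 : y ≠ st L (i + 1)) : sw i σ y = σ y := by
  simp [sw, Equiv.swap_apply_of_ne_of_ne h1 h2]

/-- The exchange of neighbours does not affect the spin at a third site. -/
theorem sw_st_of_ne {i j : ℤ} (hi : 1 ≤ i) (hi' : i < L) (hj : 1 ≤ j) (hj' : j ≤ L) (h1 : j ≠ i)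
    (h2 : j ≠ i + 1) (σ : Config 1 L) : sw i σ (st L j) = σ (st L j) :=
  sw_of_ne σ (st_ne hj hj' hi hi'.le h1) (st_ne hj hj' (by omega) (by omega) h2)

@[simp] theorem sw_sw (i : ℤ) (σ : Config 1 L) : sw i (sw i σ) = σ := by
  ext y; simp [sw]

theorem sw_eq_self {i : ℤ} {σ : Config 1 L} (h : σ (st L i) = σ (st L (i + 1))) :
    sw i σ = σ := by
  funext y
  by_cases h1 : y = st L i
  · subst h1; rw [sw_left, h]
  · by_cases h2 : y = st L (i + 1)
    · subst h2; rw [sw_right, h]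
    · exact sw_of_ne σ h1 h2

theorem sw_comm {i j : ℤ} (hi : 1 ≤ i) (hij : i + 1 < j) (hj : j < L) (σ : Config 1 L) :
    sw i (sw j σ) = sw j (sw i σ) := by
  have hne : ∀ a b : ℤ, 1 ≤ a → a ≤ L → 1 ≤ b → b ≤ L → a ≠ b → st L a ≠ st L b :=
    fun a b h1 h2 h3 h4 h => st_ne h1 h2 h3 h4 h
  funext y
  have hd : Equiv.Perm.Disjoint (Equiv.swap (st L i) (st L (i + 1)))
      (Equiv.swap (st L j) (st L (j + 1))) := by
    intro z
    by_cases h1 : z = st L i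
    · right; subst h1
      exact Equiv.swap_apply_of_ne_of_ne (hne _ _ (by omega) (by omega) (by omega) (by omega)
        (by omega)) (hne _ _ (by omega) (by omega) (by omega) (by omega) (by omega))
    · by_cases h2 : z = st L (i + 1)
      · right; subst h2
        exact Equiv.swap_apply_of_ne_of_ne (hne _ _ (by omega) (by omega) (by omega) (by omega)
          (by omega)) (hne _ _ (by omega) (by omega) (by omega) (by omega) (by omega))
      · left; exact Equiv.swap_apply_of_ne_of_ne h1 h2
  have := congrArg (fun p : Equiv.Perm (Sites 1 L) => p y) hd.commute.eq
  simp only [Equiv.Perm.mul_apply] at this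
  simp only [sw, Function.comp_apply]
  rw [this]

/-- The exchange of neighbours as a permutation of the configurations. -/
noncomputable def swEquiv (i : ℤ) : Config 1 L ≃ Config 1 L :=
  ⟨sw i, sw i, sw_sw i, sw_sw i⟩

theorem sum_sw {M : Type*} [AddCommMonoid M] (i : ℤ) (f : Config 1 L → M) :
    ∑ σ, f (sw i σ) = ∑ σ, f σ :=
  Equiv.sum_comp (swEquiv i) f

/-- Multiplication by a function of the configuration. -/
noncomputable def diag (f : Config 1 L → ℝ) : Space 1 L →ₗ[ℂ] Space 1 L where
  toFun φ := WithLp.toLp 2 fun σ => (f σ : ℂ) * φ σ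
  map_add' φ χ := by ext σ; simp [mul_add]
  map_smul' c φ := by ext σ; simp; ring

omit [NeZero L] in
@[simp] theorem diag_apply (f : Config 1 L → ℝ) (φ : Space 1 L) (σ : Config 1 L) :
    diag f φ σ = (f σ : ℂ) * φ σ := rfl

omit [NeZero L] in
theorem inner_eq_sum (φ χ : Space 1 L) :
    inner ℂ φ χ = ∑ σ, (starRingEnd ℂ) (φ σ) * χ σ := by
  rw [PiLp.inner_apply]
  refine Finset.sum_congr rfl fun σ _ => ?_
  rw [RCLike.inner_apply, mul_comm]

omit [NeZero L] in
theorem norm_sq_eq_sum (φ : Space 1 L) : ‖φ‖ ^ 2 = ∑ σ, ‖φ σ‖ ^ 2 := by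
  rw [EuclideanSpace.norm_sq_eq]

theorem conj_mul_self (z : ℂ) : (starRingEnd ℂ) z * z = ((‖z‖ ^ 2 : ℝ) : ℂ) := by
  rw [mul_comm, Complex.mul_conj, Complex.normSq_eq_norm_sq]

/-- `1` for a down spin, `0` for an up spin. -/
noncomputable def dn (σ : Config 1 L) (i : ℤ) : ℝ := ((σ (st L i)).val : ℝ)

theorem dn_of_one {σ : Config 1 L} {i : ℤ} (h : σ (st L i) = 1) : dn σ i = 1 := by simp [dn, h]
theorem dn_of_zero {σ : Config 1 L} {i : ℤ} (h : σ (st L i) = 0) : dn σ i = 0 := by simp [dn, h]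
theorem dn_nonneg (σ : Config 1 L) (i : ℤ) : 0 ≤ dn σ i := by simp [dn]
theorem dn_le_one (σ : Config 1 L) (i : ℤ) : dn σ i ≤ 1 := by
  unfold dn
  have := (σ (st L i)).2
  exact_mod_cast Nat.lt_succ_iff.1 this

end Lattice

/-! ### Kink interactions -/

section Kink

variable {L : ℕ} [NeZero L]

/-- The amplitude by which `φ` violates, at `σ`, the balance
`u (σ i) * φ σ = u (σ (i + 1)) * φ (sw i σ)` of a state without interaction energy on the bond
`(i, i + 1)`. -/
noncomputable def defect (u : Fin 2 → ℝ) (i : ℤ) (φ : Space 1 L) (σ : Config 1 L) : ℂ :=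
  (u (σ (st L i)) : ℂ) * φ σ - (u (σ (st L (i + 1))) : ℂ) * φ (sw i σ)

/-- The interaction on the bond `(i, i + 1)` which annihilates the states whose amplitudes on `↑↓`
and `↓↑` are in the ratio `u 1 : u 0`, and all states with parallel spins; a projection of rank one
on the bond when `u` is normalized. -/
noncomputable def kinkOp (u : Fin 2 → ℝ) (i : ℤ) : Space 1 L →ₗ[ℂ] Space 1 L where
  toFun φ := WithLp.toLp 2 fun σ => (u (σ (st L i)) : ℂ) * defect u i φ σ
  map_add' φ χ := by ext σ; simp [defect]; ring
  map_smul' c φ := by ext σ; simp [defect]; ring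

@[simp] theorem kinkOp_apply (u : Fin 2 → ℝ) (i : ℤ) (φ : Space 1 L) (σ : Config 1 L) :
    kinkOp u i φ σ = (u (σ (st L i)) : ℂ) * defect u i φ σ := rfl

theorem defect_sw (u : Fin 2 → ℝ) (i : ℤ) (φ : Space 1 L) (σ : Config 1 L) :
    defect u i φ (sw i σ) = -defect u i φ σ := by
  simp [defect]

theorem defect_of_eq (u : Fin 2 → ℝ) {i : ℤ} (φ : Space 1 L) {σ : Config 1 L}
    (h : σ (st L i) = σ (st L (i + 1))) : defect u i φ σ = 0 := by
  simp [defect, sw_eq_self h, h]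

theorem fin2_sq_add {u : Fin 2 → ℝ} (hu : u 0 ^ 2 + u 1 ^ 2 = 1) {s t : Fin 2} (h : s ≠ t) :
    u s ^ 2 + u t ^ 2 = 1 := by
  fin_cases s <;> fin_cases t <;> simp_all
  linarith

theorem fin2_mul {u : Fin 2 → ℝ} {s t : Fin 2} (h : s ≠ t) :
    u s * u t = u 0 * u 1 := by
  fin_cases s <;> fin_cases t <;> simp_all [mul_comm]

theorem inner_kinkOp_comm (u : Fin 2 → ℝ) (i : ℤ) (φ χ : Space 1 L) :
    inner ℂ (kinkOp u i φ) χ = inner ℂ φ (kinkOp u i χ) := by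
  simp only [inner_eq_sum, kinkOp_apply, defect, map_mul, map_sub, Complex.conj_ofReal, mul_sub,
    sub_mul, Finset.sum_sub_distrib]
  congr 1
  · refine Finset.sum_congr rfl fun σ _ => by ring
  · rw [← sum_sw i]
    refine Finset.sum_congr rfl fun σ _ => ?_
    simp; ring

theorem inner_kinkOp_self (u : Fin 2 → ℝ) (i : ℤ) (φ : Space 1 L) :
    inner ℂ φ (kinkOp u i φ) = ((1 / 2 * ∑ σ, ‖defect u i φ σ‖ ^ 2 : ℝ) : ℂ) := by
  have h1 : inner ℂ φ (kinkOp u i φ)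
      = ∑ σ, (starRingEnd ℂ) ((u (σ (st L i)) : ℂ) * φ σ) * defect u i φ σ := by
    rw [inner_eq_sum]
    refine Finset.sum_congr rfl fun σ _ => by simp; ring
  have h2 : inner ℂ φ (kinkOp u i φ)
      = -∑ σ, (starRingEnd ℂ) ((u (σ (st L (i + 1))) : ℂ) * φ (sw i σ)) * defect u i φ σ := by
    rw [h1, ← sum_sw i, ← Finset.sum_neg_distrib]
    refine Finset.sum_congr rfl fun σ _ => ?_
    rw [defect_sw]; simp
  have h3 : 2 * inner ℂ φ (kinkOp u i φ) = ∑ σ, ((‖defect u i φ σ‖ ^ 2 : ℝ) : ℂ) := by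
    rw [two_mul]
    nth_rw 1 [h1]
    rw [h2, ← sub_eq_add_neg, ← Finset.sum_sub_distrib]
    refine Finset.sum_congr rfl fun σ _ => ?_
    rw [← sub_mul, ← map_sub, ← conj_mul_self]; rfl
  push_cast at h3 ⊢
  rw [← h3]; ring

theorem norm_kinkOp_sq {u : Fin 2 → ℝ} (hu : u 0 ^ 2 + u 1 ^ 2 = 1) (i : ℤ) (φ : Space 1 L) :
    ‖kinkOp u i φ‖ ^ 2 = 1 / 2 * ∑ σ, ‖defect u i φ σ‖ ^ 2 := by
  have h1 : ‖kinkOp u i φ‖ ^ 2 = ∑ σ, u (σ (st L i)) ^ 2 * ‖defect u i φ σ‖ ^ 2 := by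
    rw [norm_sq_eq_sum]
    refine Finset.sum_congr rfl fun σ _ => ?_
    rw [kinkOp_apply, norm_mul, mul_pow, Complex.norm_real, Real.norm_eq_abs, sq_abs]
  have h2 : ‖kinkOp u i φ‖ ^ 2 = ∑ σ, u (σ (st L (i + 1))) ^ 2 * ‖defect u i φ σ‖ ^ 2 := by
    rw [h1, ← sum_sw i]
    refine Finset.sum_congr rfl fun σ _ => ?_
    rw [defect_sw, norm_neg, sw_left]
  have h3 : 2 * ‖kinkOp u i φ‖ ^ 2 = ∑ σ, ‖defect u i φ σ‖ ^ 2 := by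
    rw [two_mul]
    nth_rw 1 [h1]
    rw [h2, ← Finset.sum_add_distrib]
    refine Finset.sum_congr rfl fun σ _ => ?_
    by_cases h : σ (st L i) = σ (st L (i + 1))
    · rw [defect_of_eq u φ h]; simp
    · rw [← add_mul, fin2_sq_add hu h, one_mul]
  linarith

theorem kinkOp_idem {u : Fin 2 → ℝ} (hu : u 0 ^ 2 + u 1 ^ 2 = 1) (i : ℤ) (φ : Space 1 L) :
    kinkOp u i (kinkOp u i φ) = kinkOp u i φ := by
  ext σ
  rw [kinkOp_apply, kinkOp_apply]
  congr 1
  rw [defect, kinkOp_apply, kinkOp_apply, sw_left, defect_sw]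
  by_cases h : σ (st L i) = σ (st L (i + 1))
  · rw [defect_of_eq u φ h]; simp
  · have := fin2_sq_add hu h
    have h2 : ((u (σ (st L i)) : ℂ)) ^ 2 + (u (σ (st L (i + 1))) : ℂ) ^ 2 = 1 := by
      exact_mod_cast this
    linear_combination (defect u i φ σ) * h2

theorem kinkOp_comm (u w : Fin 2 → ℝ) {i j : ℤ} (hi : 1 ≤ i) (hij : i + 1 < j) (hj : j < L)
    (φ : Space 1 L) : kinkOp u i (kinkOp w j φ) = kinkOp w j (kinkOp u i φ) := by
  ext σ
  simp only [kinkOp_apply, defect]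
  rw [sw_st_of_ne hi (by omega) (by omega) (by omega) (by omega) (by omega),
    sw_st_of_ne (j := j + 1) hi (by omega) (by omega) (by omega) (by omega) (by omega),
    sw_st_of_ne (i := j) (j := i) (by omega) (by omega) (by omega) (by omega) (by omega) (by omega),
    sw_st_of_ne (i := j) (j := i + 1) (by omega) (by omega) (by omega) (by omega) (by omega)
      (by omega), sw_comm hi hij hj]
  ring

/-- Distant interactions are commuting projections, so their product is nonnegative. -/
theorem inner_kinkOp_far {u w : Fin 2 → ℝ} (hu : u 0 ^ 2 + u 1 ^ 2 = 1) {i j : ℤ} (hi : 1 ≤ i)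
    (hij : i + 1 < j) (hj : j < L) (φ : Space 1 L) :
    0 ≤ (inner ℂ (kinkOp u i φ) (kinkOp w j φ)).re := by
  have h : inner ℂ (kinkOp u i φ) (kinkOp w j φ)
      = inner ℂ (kinkOp u i φ) (kinkOp w j (kinkOp u i φ)) := by
    rw [← kinkOp_comm u w hi hij hj, ← inner_kinkOp_comm u i (kinkOp u i φ), kinkOp_idem hu]
  rw [h, inner_kinkOp_self, Complex.ofReal_re]
  exact mul_nonneg (by norm_num) (Finset.sum_nonneg fun _ _ => by positivity)

/-- Temperley–Lieb bound for the product of neighbouring interactions. -/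
theorem norm_inner_kinkOp_succ {u : Fin 2 → ℝ} (hu : u 0 ^ 2 + u 1 ^ 2 = 1)
    (h0 : 0 ≤ u 0 * u 1) {i : ℤ} (hi : 1 ≤ i)
    (hj : i + 1 < L) (φ : Space 1 L) :
    ‖inner ℂ (kinkOp u i φ) (kinkOp u (i + 1) φ)‖
      ≤ u 0 * u 1 / 2 * (‖kinkOp u i φ‖ ^ 2 + ‖kinkOp u (i + 1) φ‖ ^ 2) := by
  classical
  let alt : Config 1 L → Prop := fun σ =>
    σ (st L i) ≠ σ (st L (i + 1)) ∧ σ (st L (i + 1)) ≠ σ (st L (i + 1 + 1))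
  have key : ∀ σ, ‖(starRingEnd ℂ) (kinkOp u i φ σ) * kinkOp u (i + 1) φ σ‖
      ≤ u 0 * u 1 / 2 * ((if alt σ then ‖defect u i φ σ‖ ^ 2 else 0)
        + (if alt σ then ‖defect u (i + 1) φ σ‖ ^ 2 else 0)) := by
    intro σ
    by_cases h : alt σ
    · rw [if_pos h, if_pos h, norm_mul, RCLike.norm_conj, kinkOp_apply, kinkOp_apply, norm_mul,
        norm_mul, mul_mul_mul_comm, ← norm_mul, ← Complex.ofReal_mul, fin2_mul h.1,
        Complex.norm_real, Real.norm_of_nonneg h0]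
      nlinarith [mul_nonneg h0 (sq_nonneg (‖defect u i φ σ‖ - ‖defect u (i + 1) φ σ‖))]
    · rw [if_neg h, if_neg h]
      have h2 : σ (st L i) = σ (st L (i + 1)) ∨ σ (st L (i + 1)) = σ (st L (i + 1 + 1)) := by
        by_contra hc; push Not at hc; exact h hc
      rcases h2 with h2 | h2
      · rw [kinkOp_apply, defect_of_eq u φ h2]; simp
      · rw [kinkOp_apply u (i + 1), defect_of_eq u φ h2]; simp
  have fin2 : ∀ s t r : Fin 2, s ≠ t → ¬ ((s ≠ t ∧ t ≠ r) ∧ (t ≠ s ∧ s ≠ r)) := by decide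
  have fin2' : ∀ s t r : Fin 2, t ≠ r → ¬ ((s ≠ t ∧ t ≠ r) ∧ (s ≠ r ∧ r ≠ t)) := by decide
  -- each pair of configurations related by the exchange has at most one alternating member
  have s1 : ∑ σ, (if alt σ then ‖defect u i φ σ‖ ^ 2 else 0) ≤ ‖kinkOp u i φ‖ ^ 2 := by
    have e : ∑ σ, (if alt σ then ‖defect u i φ σ‖ ^ 2 else 0)
        = ∑ σ, (if alt (sw i σ) then ‖defect u i φ σ‖ ^ 2 else 0) := by
      rw [← sum_sw i]
      refine Finset.sum_congr rfl fun σ _ => by rw [defect_sw, norm_neg]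
    rw [norm_kinkOp_sq hu]
    have : ∑ σ, (if alt σ then ‖defect u i φ σ‖ ^ 2 else 0)
        + ∑ σ, (if alt (sw i σ) then ‖defect u i φ σ‖ ^ 2 else 0)
        ≤ ∑ σ, ‖defect u i φ σ‖ ^ 2 := by
      rw [← Finset.sum_add_distrib]
      refine Finset.sum_le_sum fun σ _ => ?_
      by_cases h : σ (st L i) = σ (st L (i + 1))
      · rw [defect_of_eq u φ h]; simp
      · have h3 := fin2 _ _ (σ (st L (i + 1 + 1))) h
        have h4 : alt (sw i σ) ↔ (σ (st L (i + 1)) ≠ σ (st L i) ∧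
            σ (st L i) ≠ σ (st L (i + 1 + 1))) := by
          simp only [alt, sw_left, sw_right]
          rw [sw_st_of_ne hi (by omega) (by omega) (by omega) (by omega) (by omega)]
        by_cases h5 : alt σ
        · rw [if_pos h5, if_neg (fun h6 => h3 ⟨h5, h4.1 h6⟩), add_zero]
        · rw [if_neg h5, zero_add]; split_ifs <;> [exact le_rfl; positivity]
    linarith
  have s2 : ∑ σ, (if alt σ then ‖defect u (i + 1) φ σ‖ ^ 2 else 0)
      ≤ ‖kinkOp u (i + 1) φ‖ ^ 2 := by
    have e : ∑ σ, (if alt σ then ‖defect u (i + 1) φ σ‖ ^ 2 else 0)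
        = ∑ σ, (if alt (sw (i + 1) σ) then ‖defect u (i + 1) φ σ‖ ^ 2 else 0) := by
      rw [← sum_sw (i + 1)]
      refine Finset.sum_congr rfl fun σ _ => by rw [defect_sw, norm_neg]
    rw [norm_kinkOp_sq hu]
    have : ∑ σ, (if alt σ then ‖defect u (i + 1) φ σ‖ ^ 2 else 0)
        + ∑ σ, (if alt (sw (i + 1) σ) then ‖defect u (i + 1) φ σ‖ ^ 2 else 0)
        ≤ ∑ σ, ‖defect u (i + 1) φ σ‖ ^ 2 := by
      rw [← Finset.sum_add_distrib]
      refine Finset.sum_le_sum fun σ _ => ?_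
      by_cases h : σ (st L (i + 1)) = σ (st L (i + 1 + 1))
      · rw [defect_of_eq u φ h]; simp
      · have h3 := fin2' (σ (st L i)) _ _ h
        have h4 : alt (sw (i + 1) σ) ↔ (σ (st L i) ≠ σ (st L (i + 1 + 1)) ∧
            σ (st L (i + 1 + 1)) ≠ σ (st L (i + 1))) := by
          simp only [alt, sw_left, sw_right]
          rw [sw_st_of_ne (i := i + 1) (by omega) (by omega) hi (by omega) (by omega) (by omega)]
        by_cases h5 : alt σ
        · rw [if_pos h5, if_neg (fun h6 => h3 ⟨h5, h4.1 h6⟩), add_zero]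
        · rw [if_neg h5, zero_add]; split_ifs <;> [exact le_rfl; positivity]
    linarith
  rw [inner_eq_sum]
  refine (norm_sum_le _ _).trans ((Finset.sum_le_sum fun σ _ => key σ).trans ?_)
  rw [← Finset.mul_sum, Finset.sum_add_distrib]
  gcongr

end Kink

/-! ### The Hamiltonian in terms of kink interactions -/

section Hamiltonian

open Classical in
theorem siteOp_mulVec {a b : ℤ} (M : Matrix (Fin 2) (Fin 2) ℂ) (x : Sites a b)
    (f : Config a b → ℂ) (σ : Config a b) :
    (siteOp M x).mulVec f σ = ∑ t, M (σ x) t * f (Function.update σ x t) := by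
  rw [Matrix.mulVec, dotProduct]
  have hsub : ∀ τ ∉ Finset.univ.image (fun t => Function.update σ x t),
      siteOp M x σ τ * f τ = 0 := by
    intro τ hτ
    rw [siteOp, if_neg, zero_mul]
    intro h
    apply hτ
    refine Finset.mem_image.2 ⟨τ x, Finset.mem_univ _, ?_⟩
    funext y
    by_cases hy : y = x
    · subst hy; simp
    · simp [hy, h y hy]
  rw [← Finset.sum_subset (Finset.subset_univ _) (fun τ _ h => hsub τ h), Finset.sum_image]
  · refine Finset.sum_congr rfl fun t _ => ?_
    rw [siteOp, if_pos]
    · simp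
    · intro y hy; simp [hy]
  · intro s _ t _ h
    have := congrFun h x
    simpa using this

/-- The amplitude of the XXZ interaction on two distinct sites. -/
theorem bond_mulVec {a b : ℤ} (Δ : ℝ) {x y : Sites a b} (hxy : x ≠ y) (f : Config a b → ℂ)
    (σ : Config a b) :
    (bond Δ x y).mulVec f σ = if σ x = σ y then 0 else
      (1 / 2 : ℂ) * f σ - (Δ : ℂ)⁻¹ / 2 * f (σ ∘ Equiv.swap x y) := by
  classical
  have hcoef : ∀ M N : Matrix (Fin 2) (Fin 2) ℂ, (siteOp M x * siteOp N y).mulVec f σ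
      = ∑ t, ∑ s, M (σ x) t * N (σ y) s
        * f (Function.update (Function.update σ x t) y s) := by
    intro M N
    rw [← Matrix.mulVec_mulVec, siteOp_mulVec]
    refine Finset.sum_congr rfl fun t _ => ?_
    rw [siteOp_mulVec, Finset.mul_sum]
    refine Finset.sum_congr rfl fun s _ => ?_
    rw [Function.update_of_ne hxy.symm]; ring
  have hself : ∀ s t, σ x = s → σ y = t →
      Function.update (Function.update σ x s) y t = σ := by
    rintro _ _ rfl rfl; simp
  have hswap : ∀ s t, σ x = s → σ y = t →
      Function.update (Function.update σ x t) y s = σ ∘ Equiv.swap x y := by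
    rintro _ _ rfl rfl
    funext z
    by_cases hz : z = y
    · subst hz; simp
    · by_cases hz' : z = x
      · subst hz'; simp [hz]
      · simp [hz, hz', Equiv.swap_apply_of_ne_of_ne]
  simp only [bond, Matrix.sub_mulVec, Matrix.smul_mulVec, Matrix.add_mulVec, Matrix.one_mulVec,
    Pi.sub_apply, Pi.add_apply, Pi.smul_apply, hcoef, Fin.sum_univ_two, smul_eq_mul]
  have h2 : ∀ s : Fin 2, s = 0 ∨ s = 1 := by decide
  have hI := Complex.I_mul_I
  rcases h2 (σ x) with hx | hx <;> rcases h2 (σ y) with hy | hy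
  · rw [hself 0 0 hx hy]
    simp only [hx, hy, spin1, spin2, spin3, if_pos, Matrix.of_apply, Matrix.cons_val', Matrix.cons_val_zero,
      Matrix.cons_val_one, Matrix.cons_val_fin_one]
    linear_combination (-(Δ : ℂ)⁻¹ * f (Function.update (Function.update σ x 1) y 1) / 4) * hI
  · rw [hself 0 1 hx hy, hswap 0 1 hx hy]
    simp only [hx, hy, spin1, spin2, spin3, Matrix.of_apply, Matrix.cons_val', Matrix.cons_val_zero,
      Matrix.cons_val_one, Matrix.cons_val_fin_one]
    rw [if_neg (by decide)]
    linear_combination ((Δ : ℂ)⁻¹ * f (σ ∘ Equiv.swap x y) / 4) * hI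
  · rw [hself 1 0 hx hy, hswap 1 0 hx hy]
    simp only [hx, hy, spin1, spin2, spin3, Matrix.of_apply, Matrix.cons_val', Matrix.cons_val_zero,
      Matrix.cons_val_one, Matrix.cons_val_fin_one]
    rw [if_neg (by decide)]
    linear_combination ((Δ : ℂ)⁻¹ * f (σ ∘ Equiv.swap x y) / 4) * hI
  · rw [hself 1 1 hx hy]
    simp only [hx, hy, spin1, spin2, spin3, if_pos, Matrix.of_apply, Matrix.cons_val', Matrix.cons_val_zero,
      Matrix.cons_val_one, Matrix.cons_val_fin_one]
    linear_combination (-(Δ : ℂ)⁻¹ * f (Function.update (Function.update σ x 0) y 0) / 4) * hI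

variable {L : ℕ} [NeZero L]

omit [NeZero L] in
theorem siteOp_spin3_mulVec (x : Sites 1 L) (f : Config 1 L → ℂ) (σ : Config 1 L) :
    (siteOp spin3 x).mulVec f σ = (1 / 2 - ((σ x).val : ℂ)) * f σ := by
  classical
  rw [siteOp_mulVec, Fin.sum_univ_two]
  have h2 : ∀ s : Fin 2, s = 0 ∨ s = 1 := by decide
  have hself : ∀ s, σ x = s → Function.update σ x s = σ := by rintro _ rfl; simp
  rcases h2 (σ x) with hx | hx
  · rw [hself 0 hx]; simp [hx, spin3]
  · rw [hself 1 hx]; simp [hx, spin3]; left; norm_num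

/-- Sums over pairs of neighbouring sites as sums over an interval of integers. -/
theorem sum_neighbours {M : Type*} [AddCommMonoid M] (F : Sites 1 L → Sites 1 L → M) :
    ∑ p : Sites 1 L × Sites 1 L with p.2.1 = p.1.1 + 1, F p.1 p.2
      = ∑ i ∈ Finset.Ico (1 : ℤ) L, F (st L i) (st L (i + 1)) := by
  refine Finset.sum_nbij' (fun p => p.1.1) (fun i => (st L i, st L (i + 1))) ?_ ?_ ?_ ?_ ?_
  · rintro ⟨x, y⟩ h
    have h : y.1 = x.1 + 1 := by simpa using h
    have := x.2.1; have := y.2.2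
    simp only [Finset.mem_Ico]; omega
  · intro i hi
    rw [Finset.mem_Ico] at hi
    simp only [Finset.mem_filter, Finset.mem_univ, true_and]
    rw [st_val (by omega) (by omega), st_val hi.1 (by omega)]
  · rintro ⟨x, y⟩ h
    have h : y.1 = x.1 + 1 := by simpa using h
    simp only [st_coe, ← h]
  · intro i hi
    rw [Finset.mem_Ico] at hi
    simp only [st_val hi.1 hi.2.le]
  · rintro ⟨x, y⟩ h
    have h : y.1 = x.1 + 1 := by simpa using h
    simp only [st_coe, ← h]

theorem sum_site_eq {M : Type*} [AddCommMonoid M] (F : Sites 1 L → M) {i : ℤ} (h1 : 1 ≤ i)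
    (h2 : i ≤ L) : ∑ x : Sites 1 L with x.1 = i, F x = F (st L i) := by
  have : (Finset.univ.filter fun x : Sites 1 L => x.1 = i) = {st L i} := by
    ext x
    simp only [Finset.mem_filter, Finset.mem_univ, true_and, Finset.mem_singleton]
    constructor
    · rintro rfl; exact (st_coe x).symm
    · rintro rfl; exact st_val h1 h2
  rw [this, Finset.sum_singleton]

/-- The amplitude of the XXZ interaction on the bond `(i, i + 1)`. -/
noncomputable def bondAmp (δ : ℝ) (i : ℤ) (φ : Space 1 L) (σ : Config 1 L) : ℂ :=
  if σ (st L i) = σ (st L (i + 1)) then 0 else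
    (1 / 2 : ℂ) * φ σ - (δ : ℂ) / 2 * φ (sw i σ)

theorem droplet_apply (Δ : ℝ) (φ : Space 1 L) (σ : Config 1 L) :
    droplet Δ L φ σ = ∑ i ∈ Finset.Ico (1 : ℤ) L, bondAmp Δ⁻¹ i φ σ
      + (fieldA Δ : ℂ) * ((dn σ 1 : ℂ) + (dn σ L : ℂ) - 1) * φ σ := by
  have h0 : droplet Δ L φ σ = (hamMatrix Δ 1 1 1 L).mulVec φ.ofLp σ := by
    rw [droplet, Matrix.ofLp_toEuclideanCLM]
  rw [h0, hamMatrix, sum_neighbours, sum_site_eq _ le_rfl (one_le_cast L),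
    sum_site_eq _ (one_le_cast L) le_rfl]
  simp only [Matrix.sub_mulVec, Matrix.smul_mulVec, Matrix.add_mulVec, Pi.sub_apply,
    Pi.add_apply, Pi.smul_apply, Matrix.sum_mulVec, Finset.sum_apply, siteOp_spin3_mulVec,
    smul_eq_mul]
  rw [sub_eq_add_neg]
  congr 1
  · refine Finset.sum_congr rfl fun i hi => ?_
    rw [Finset.mem_Ico] at hi
    rw [bond_mulVec Δ (st_ne hi.1 hi.2.le (by omega) (by omega) (by omega))]
    simp only [bondAmp, Complex.ofReal_inv]
    rfl
  · simp only [dn]; push_cast; ring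

/-- The smaller weight `q / √(1 + q²)` of the normalized pair in the ratio `q : 1`. -/
noncomputable def wa (q : ℝ) : ℝ := q / Real.sqrt (1 + q ^ 2)

/-- The larger weight `1 / √(1 + q²)` of the normalized pair in the ratio `q : 1`. -/
noncomputable def wb (q : ℝ) : ℝ := 1 / Real.sqrt (1 + q ^ 2)

/-- Weights of the interaction of the `+-` kink. -/
noncomputable def uL (q : ℝ) : Fin 2 → ℝ := ![wa q, wb q]

/-- Weights of the interaction of the `-+` kink. -/
noncomputable def uR (q : ℝ) : Fin 2 → ℝ := ![wb q, wa q]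

theorem wb_pos (q : ℝ) : 0 < wb q := by unfold wb; positivity
theorem wa_eq (q : ℝ) : wa q = q * wb q := by unfold wa wb; ring
theorem wb_sq (q : ℝ) : wb q ^ 2 * (1 + q ^ 2) = 1 := by
  unfold wb
  rw [div_pow, Real.sq_sqrt (by positivity)]; field_simp
theorem wa_sq_add_wb_sq (q : ℝ) : wa q ^ 2 + wb q ^ 2 = 1 := by
  have := wb_sq q
  rw [wa_eq]; nlinarith
theorem uL_norm (q : ℝ) : uL q 0 ^ 2 + uL q 1 ^ 2 = 1 := by simpa [uL] using wa_sq_add_wb_sq q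
theorem uR_norm (q : ℝ) : uR q 0 ^ 2 + uR q 1 ^ 2 = 1 := by
  have := wa_sq_add_wb_sq q
  simp [uR]; linarith

theorem inv_eq_of_anisotropy {Δ q : ℝ} (hq0 : 0 < q) (hΔq : Δ = (q + q⁻¹) / 2) :
    Δ⁻¹ = 2 * (wa q * wb q) := by
  have h1 := wb_sq q
  have h2 : wb q ^ 2 = (1 + q ^ 2)⁻¹ := by field_simp; linarith
  have h3 : 2 * (wa q * wb q) = 2 * q * wb q ^ 2 := by rw [wa_eq]; ring
  rw [h3, h2, hΔq]; field_simp; ring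

theorem fieldA_eq {Δ q : ℝ} (hq0 : 0 < q) (hq1 : q < 1) (hΔq : Δ = (q + q⁻¹) / 2) :
    fieldA Δ = (wb q ^ 2 - wa q ^ 2) / 2 := by
  have h2 : 1 - (Δ ^ 2)⁻¹ = (wb q ^ 2 - wa q ^ 2) ^ 2 := by
    rw [← inv_pow, inv_eq_of_anisotropy hq0 hΔq]
    have := wa_sq_add_wb_sq q
    linear_combination (-(wa q ^ 2 + wb q ^ 2) - 1) * this
  rw [fieldA, h2, Real.sqrt_sq]
  · ring
  · have := wb_pos q
    rw [wa_eq]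
    have : q ^ 2 ≤ 1 := by nlinarith
    nlinarith [sq_nonneg (wb q)]

/-- The energy gap `γ = 1 - Δ⁻¹` in terms of the weights. -/
noncomputable def gam (q : ℝ) : ℝ := 1 - 2 * (wa q * wb q)

/-- The boundary field `A(Δ)` in terms of the weights. -/
noncomputable def fA (q : ℝ) : ℝ := (wb q ^ 2 - wa q ^ 2) / 2

theorem wa_pos {q : ℝ} (hq0 : 0 < q) : 0 < wa q := by unfold wa; positivity

theorem gam_pos {q : ℝ} (hq1 : q < 1) : 0 < gam q := by
  have h1 := wa_sq_add_wb_sq q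
  have h2 := wb_pos q
  have h3 : gam q = (wb q - wa q) ^ 2 := by
    unfold gam; linarith [sub_sq (wb q) (wa q)]
  have h4 : 0 < wb q - wa q := by rw [wa_eq]; nlinarith
  rw [h3]; positivity

theorem gam_le_one {q : ℝ} (hq0 : 0 < q) : gam q ≤ 1 := by
  have := wa_pos hq0; have := wb_pos q
  unfold gam; nlinarith

theorem fA_nonneg {q : ℝ} (hq0 : 0 < q) (hq1 : q < 1) : 0 ≤ fA q := by
  have h1 := wb_pos q
  have h2 := wa_pos hq0
  have h4 : wa q < wb q := by rw [wa_eq]; nlinarith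
  unfold fA; nlinarith

theorem fA_le_half (q : ℝ) : fA q ≤ 1 / 2 := by
  have := wa_sq_add_wb_sq q
  unfold fA; nlinarith [sq_nonneg (wa q)]

/-- The `+-` kink interaction is the XXZ interaction plus a field that telescopes along the chain. -/
theorem defect_uL (q : ℝ) (i : ℤ) (φ : Space 1 L) (σ : Config 1 L) :
    kinkOp (uL q) i φ σ = bondAmp (2 * (wa q * wb q)) i φ σ
      + (fA q : ℂ) * ((dn σ i : ℂ) - (dn σ (i + 1) : ℂ)) * φ σ := by
  have h2 : ∀ s : Fin 2, s = 0 ∨ s = 1 := by decide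
  have hs : ((wa q : ℂ)) ^ 2 + (wb q : ℂ) ^ 2 = 1 := by exact_mod_cast wa_sq_add_wb_sq q
  rw [kinkOp_apply]
  by_cases h : σ (st L i) = σ (st L (i + 1))
  · rw [defect_of_eq _ _ h, bondAmp, if_pos h, dn, dn, h]; simp
  · rw [bondAmp, if_neg h, defect]
    rcases h2 (σ (st L i)) with h1 | h1 <;> rcases h2 (σ (st L (i + 1))) with h3 | h3
    · exact absurd (h1.trans h3.symm) h
    · rw [dn_of_zero h1, dn_of_one h3, h1, h3]
      simp only [uL, fA, Matrix.cons_val_zero, Matrix.cons_val_one, Matrix.cons_val_fin_one]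
      push_cast
      linear_combination (φ σ / 2) * hs
    · rw [dn_of_one h1, dn_of_zero h3, h1, h3]
      simp only [uL, fA, Matrix.cons_val_zero, Matrix.cons_val_one, Matrix.cons_val_fin_one]
      push_cast
      linear_combination (φ σ / 2) * hs
    · exact absurd (h1.trans h3.symm) h

/-- The `-+` kink interaction is the XXZ interaction minus a field that telescopes along the chain. -/
theorem defect_uR (q : ℝ) (i : ℤ) (φ : Space 1 L) (σ : Config 1 L) :
    kinkOp (uR q) i φ σ = bondAmp (2 * (wa q * wb q)) i φ σ
      - (fA q : ℂ) * ((dn σ i : ℂ) - (dn σ (i + 1) : ℂ)) * φ σ := by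
  have h2 : ∀ s : Fin 2, s = 0 ∨ s = 1 := by decide
  have hs : ((wa q : ℂ)) ^ 2 + (wb q : ℂ) ^ 2 = 1 := by exact_mod_cast wa_sq_add_wb_sq q
  rw [kinkOp_apply]
  by_cases h : σ (st L i) = σ (st L (i + 1))
  · rw [defect_of_eq _ _ h, bondAmp, if_pos h, dn, dn, h]; simp
  · rw [bondAmp, if_neg h, defect]
    rcases h2 (σ (st L i)) with h1 | h1 <;> rcases h2 (σ (st L (i + 1))) with h3 | h3
    · exact absurd (h1.trans h3.symm) h
    · rw [dn_of_zero h1, dn_of_one h3, h1, h3]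
      simp only [uR, fA, Matrix.cons_val_zero, Matrix.cons_val_one, Matrix.cons_val_fin_one]
      push_cast
      linear_combination (φ σ / 2) * hs
    · rw [dn_of_one h1, dn_of_zero h3, h1, h3]
      simp only [uR, fA, Matrix.cons_val_zero, Matrix.cons_val_one, Matrix.cons_val_fin_one]
      push_cast
      linear_combination (φ σ / 2) * hs
    · exact absurd (h1.trans h3.symm) h

/-- The interaction on the bond `(i, i + 1)` as an operator. -/
noncomputable def bondOp (q : ℝ) (i : ℤ) : Space 1 L →ₗ[ℂ] Space 1 L :=
  (1 / 2 : ℂ) • (kinkOp (uL q) i + kinkOp (uR q) i)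

theorem bondOp_apply (q : ℝ) (i : ℤ) (φ : Space 1 L) (σ : Config 1 L) :
    bondOp q i φ σ = bondAmp (2 * (wa q * wb q)) i φ σ := by
  have : bondOp q i φ σ = (1 / 2 : ℂ) * (kinkOp (uL q) i φ σ + kinkOp (uR q) i φ σ) := rfl
  rw [this, defect_uL, defect_uR]; ring

/-- The two kink Hamiltonians to the left and to the right of the cut between `x` and `x + 1`. -/
noncomputable def cutOp (q : ℝ) (x : ℤ) : Space 1 L →ₗ[ℂ] Space 1 L :=
  ∑ i ∈ (Finset.Ico (1 : ℤ) L).erase x, kinkOp (if i < x then uL q else uR q) i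

/-- The coupling across the cut between `x` and `x + 1`, which vanishes when both neighbouring
spins are down. -/
noncomputable def seamOp (q : ℝ) (x : ℤ) : Space 1 L →ₗ[ℂ] Space 1 L :=
  bondOp q x + diag fun σ => fA q * (dn σ x + dn σ (x + 1) - 2)

theorem seamOp_apply (q : ℝ) (x : ℤ) (φ : Space 1 L) (σ : Config 1 L) :
    seamOp q x φ σ = bondAmp (2 * (wa q * wb q)) x φ σ
      + ((fA q * (dn σ x + dn σ (x + 1) - 2) : ℝ) : ℂ) * φ σ := by
  rw [← bondOp_apply]; simp [seamOp]

theorem sum_Ico_int_sub (f : ℤ → ℂ) {a b : ℤ} (h : a ≤ b) :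
    ∑ i ∈ Finset.Ico a b, (f i - f (i + 1)) = f a - f b := by
  induction b, h using Int.leInduction with
  | base => simp
  | succ k hk ih =>
    have : Finset.Ico a (k + 1) = insert k (Finset.Ico a k) := by
      ext i; simp only [Finset.mem_Ico, Finset.mem_insert]; omega
    rw [this, Finset.sum_insert (by simp), ih]; ring

/-- Decomposition of the Hamiltonian at a cut: the boundary fields are moved inwards along the chain,
where they turn the interactions into kink interactions, until they meet at the cut. -/
theorem droplet_eq_cut {Δ q : ℝ} (hq0 : 0 < q) (hq1 : q < 1) (hΔq : Δ = (q + q⁻¹) / 2) {x : ℤ}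
    (hx : 1 ≤ x) (hx' : x < L) (φ : Space 1 L) :
    droplet Δ L φ = (fA q : ℂ) • φ + cutOp q x φ + seamOp q x φ := by
  ext σ
  have e0 : ((fA q : ℂ) • φ + cutOp q x φ + seamOp q x φ) σ
      = (fA q : ℂ) * φ σ + (∑ i ∈ (Finset.Ico (1 : ℤ) L).erase x,
        kinkOp (if i < x then uL q else uR q) i φ σ) + (bondAmp (2 * (wa q * wb q)) x φ σ
        + ((fA q * (dn σ x + dn σ (x + 1) - 2) : ℝ) : ℂ) * φ σ) := by
    rw [← bondOp_apply]
    simp [cutOp, seamOp]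
  rw [e0, droplet_apply, inv_eq_of_anisotropy hq0 hΔq, fieldA_eq hq0 hq1 hΔq, ← fA]
  have hmem : x ∈ Finset.Ico (1 : ℤ) L := Finset.mem_Ico.2 ⟨hx, hx'⟩
  have e1 : ∑ i ∈ (Finset.Ico (1 : ℤ) L).erase x, kinkOp (if i < x then uL q else uR q) i φ σ
      = ∑ i ∈ (Finset.Ico (1 : ℤ) L).erase x, bondAmp (2 * (wa q * wb q)) i φ σ
        + (fA q : ℂ) * φ σ * (∑ i ∈ (Finset.Ico (1 : ℤ) L).erase x,
          (if i < x then ((dn σ i : ℂ) - (dn σ (i + 1) : ℂ))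
            else -((dn σ i : ℂ) - (dn σ (i + 1) : ℂ)))) := by
    rw [Finset.mul_sum, ← Finset.sum_add_distrib]
    refine Finset.sum_congr rfl fun i _ => ?_
    split_ifs
    · rw [defect_uL]; ring
    · rw [defect_uR]; ring
  have e2 : (Finset.Ico (1 : ℤ) L).erase x = Finset.Ico 1 x ∪ Finset.Ico (x + 1) L := by
    ext i; simp only [Finset.mem_erase, Finset.mem_Ico, Finset.mem_union]; omega
  have e3 : ∑ i ∈ (Finset.Ico (1 : ℤ) L).erase x,
          (if i < x then ((dn σ i : ℂ) - (dn σ (i + 1) : ℂ))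
            else -((dn σ i : ℂ) - (dn σ (i + 1) : ℂ)))
      = (dn σ 1 : ℂ) - dn σ x - (dn σ (x + 1) - dn σ L) := by
    rw [e2, Finset.sum_union]
    · rw [sub_eq_add_neg]
      congr 1
      · rw [← sum_Ico_int_sub (fun i => (dn σ i : ℂ)) hx]
        refine Finset.sum_congr rfl fun i hi => ?_
        rw [if_pos (Finset.mem_Ico.1 hi).2]
      · rw [← sum_Ico_int_sub (fun i => (dn σ i : ℂ)) (by omega : x + 1 ≤ L),
          ← Finset.sum_neg_distrib]
        refine Finset.sum_congr rfl fun i hi => ?_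
        rw [if_neg (by have := (Finset.mem_Ico.1 hi).1; omega)]
    · rw [Finset.disjoint_left]; intro i; simp only [Finset.mem_Ico]; omega
  rw [e1, e3, ← Finset.add_sum_erase _ _ hmem]
  push_cast
  ring

end Hamiltonian

/-! ### Counting down spins -/

section Count

variable {L : ℕ}

/-- Number of down spins at sites `≤ x`. -/
noncomputable def cnt (x : ℤ) (σ : Config 1 L) : ℕ :=
  (Finset.univ.filter fun y : Sites 1 L => y.1 ≤ x ∧ σ y = 1).card

theorem cnt_mono {x y : ℤ} (h : x ≤ y) (σ : Config 1 L) : cnt x σ ≤ cnt y σ := by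
  refine Finset.card_le_card fun z hz => ?_
  simp only [Finset.mem_filter, Finset.mem_univ, true_and] at hz ⊢
  exact ⟨hz.1.trans h, hz.2⟩

theorem cnt_of_nonpos {x : ℤ} (h : x ≤ 0) (σ : Config 1 L) : cnt x σ = 0 := by
  rw [cnt, Finset.card_eq_zero, Finset.filter_eq_empty_iff]
  intro y _ hy
  have := y.2.1
  omega

theorem fin2_cases (s : Fin 2) : s = 0 ∨ s = 1 := by
  revert s; decide

theorem fin2_ne_one {s : Fin 2} (h : s ≠ 1) : s = 0 := (fin2_cases s).resolve_right h

variable [NeZero L]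

theorem cnt_succ {x : ℤ} (h1 : 0 ≤ x) (h2 : x < L) (σ : Config 1 L) :
    cnt (x + 1) σ = cnt x σ + (σ (st L (x + 1))).val := by
  have hv : (st L (x + 1)).1 = x + 1 := st_val (by omega) (by omega)
  rcases fin2_cases (σ (st L (x + 1))) with h | h
  · rw [h]
    simp only [cnt, Fin.val_zero, add_zero]
    congr 1
    ext y
    simp only [Finset.mem_filter, Finset.mem_univ, true_and]
    constructor
    · rintro ⟨h3, h4⟩
      refine ⟨?_, h4⟩
      by_contra h5
      have : y.1 = x + 1 := by omega
      rw [← st_coe y, this, h] at h4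
      exact absurd h4 (by decide)
    · rintro ⟨h3, h4⟩; exact ⟨by omega, h4⟩
  · rw [h]
    have : (Finset.univ.filter fun y : Sites 1 L => y.1 ≤ x + 1 ∧ σ y = 1)
        = insert (st L (x + 1)) (Finset.univ.filter fun y : Sites 1 L => y.1 ≤ x ∧ σ y = 1) := by
      ext y
      simp only [Finset.mem_filter, Finset.mem_univ, true_and, Finset.mem_insert]
      constructor
      · rintro ⟨h3, h4⟩
        by_cases h5 : y.1 = x + 1
        · left; rw [← st_coe y, h5]
        · right; exact ⟨by omega, h4⟩
      · rintro (rfl | ⟨h3, h4⟩)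
        · exact ⟨hv.le, h⟩
        · exact ⟨by omega, h4⟩
    rw [cnt, this, Finset.card_insert_of_notMem]
    · rfl
    · simp only [Finset.mem_filter, not_and]; intro _ h5; omega

theorem cnt_lt {x y : ℤ} (h : x < y) (h1 : 1 ≤ y) (h2 : y ≤ L) {σ : Config 1 L}
    (hσ : σ (st L y) = 1) : cnt x σ < cnt y σ := by
  have h3 := cnt_succ (L := L) (x := y - 1) (by omega) (by omega) σ
  rw [sub_add_cancel, hσ] at h3
  have h4 := cnt_mono (show x ≤ y - 1 by omega) σ
  have : ((1 : Fin 2) : ℕ) = 1 := rfl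
  omega

theorem cnt_le_add {x y : ℤ} (h : x ≤ y) (h1 : 0 ≤ x) (h2 : y ≤ L) (σ : Config 1 L) :
    (cnt y σ : ℤ) ≤ cnt x σ + (y - x) := by
  induction y, h using Int.leInduction with
  | base => omega
  | succ k hk ih =>
    have h3 := cnt_succ (L := L) (x := k) (by omega) (by omega) σ
    have h4 := (σ (st L (k + 1))).2
    have := ih (by omega)
    push_cast [h3]
    omega

theorem cnt_eq_add_of_down {x y : ℤ} (h : x ≤ y) (h1 : 0 ≤ x) (h2 : y ≤ L) {σ : Config 1 L}
    (hσ : ∀ z, x < z → z ≤ y → σ (st L z) = 1) : (cnt y σ : ℤ) = cnt x σ + (y - x) := by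
  induction y, h using Int.leInduction with
  | base => omega
  | succ k hk ih =>
    have h3 := cnt_succ (L := L) (x := k) (by omega) (by omega) σ
    rw [hσ (k + 1) (by omega) le_rfl] at h3
    have := ih (by omega) (fun z hz hz' => hσ z hz (by omega))
    have e : ((1 : Fin 2) : ℕ) = 1 := rfl
    omega

theorem cnt_sw {i x : ℤ} (hi : 1 ≤ i) (hi' : i < L) (h : i ≠ x) (σ : Config 1 L) :
    cnt x (sw i σ) = cnt x σ := by
  refine Finset.card_equiv (Equiv.swap (st L i) (st L (i + 1))) fun y => ?_
  simp only [Finset.mem_filter, Finset.mem_univ, true_and]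
  refine and_congr ?_ Iff.rfl
  have h1 : (st L i).1 = i := st_val hi hi'.le
  have h2 : (st L (i + 1)).1 = i + 1 := st_val (by omega) (by omega)
  by_cases hy : y = st L i
  · subst hy; rw [Equiv.swap_apply_left, h1, h2]; omega
  · by_cases hy' : y = st L (i + 1)
    · subst hy'; rw [Equiv.swap_apply_right, h1, h2]; omega
    · rw [Equiv.swap_apply_of_ne_of_ne hy hy']

/-- The states whose amplitude vanishes off `P`. -/
def SuppOn (P : Config 1 L → Prop) (φ : Space 1 L) : Prop := ∀ σ, φ σ ≠ 0 → P σ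

omit [NeZero L] in
theorem ket_apply {a b : ℤ} (D : Finset (Sites a b)) (σ : Config a b) :
    ket D σ = if D = Finset.univ.filter (fun y => σ y = 1) then 1 else 0 := by
  classical
  rw [ket, PiLp.single_apply]
  refine if_congr ?_ rfl rfl
  constructor
  · intro h; subst h; ext y; by_cases hy : y ∈ D <;> simp [hy]
  · intro h; subst h; funext y
    rcases fin2_cases (σ y) with hy | hy <;> simp [hy]

omit [NeZero L] in
theorem cnt_top (σ : Config 1 L) :
    cnt L σ = (Finset.univ.filter fun y : Sites 1 L => σ y = 1).card := by
  rw [cnt]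
  congr 1
  ext y
  have := y.2.2
  simp [this]

omit [NeZero L] in
theorem mem_sector_iff {n : ℕ} {φ : Space 1 L} :
    φ ∈ sector L n ↔ ∀ σ, φ σ ≠ 0 → cnt L σ = n := by
  classical
  constructor
  · intro h
    induction h using Submodule.span_induction with
    | mem x hx =>
      obtain ⟨D, hD, rfl⟩ := hx
      intro σ hσ
      rw [ket_apply] at hσ
      have : D = Finset.univ.filter (fun y => σ y = 1) := by
        by_contra hc; exact hσ (if_neg hc)
      rw [cnt_top, ← this, hD]
    | zero => intro σ hσ; exact absurd rfl hσ
    | add x y _ _ hx hy =>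
      intro σ hσ
      by_cases h0 : x σ = 0
      · refine hy σ fun h1 => hσ ?_
        rw [PiLp.add_apply, h0, h1, add_zero]
      · exact hx σ h0
    | smul c x _ hx =>
      intro σ hσ
      exact hx σ fun h1 => hσ (by rw [PiLp.smul_apply, h1, smul_zero])
  · intro h
    have : φ = ∑ σ, φ σ • ket (Finset.univ.filter fun y => σ y = 1) := by
      ext τ
      rw [WithLp.ofLp_sum, Finset.sum_apply, Finset.sum_eq_single τ]
      · simp [ket_apply]
      · intro σ _ hne
        rw [PiLp.smul_apply, ket_apply, if_neg, smul_zero]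
        intro he
        apply hne
        funext y
        have := congrArg (y ∈ ·) he
        simp only [Finset.mem_filter, Finset.mem_univ, true_and, eq_iff_iff] at this
        rcases fin2_cases (σ y) with h1 | h1 <;> rcases fin2_cases (τ y) with h2 | h2 <;>
          simp_all
      · intro hn; exact absurd (Finset.mem_univ _) hn
    rw [this]
    refine Submodule.sum_mem _ fun σ _ => ?_
    by_cases h0 : φ σ = 0
    · rw [h0, zero_smul]; exact Submodule.zero_mem _
    · refine Submodule.smul_mem _ _ (Submodule.subset_span ⟨_, ?_, rfl⟩)
      rw [← cnt_top, h σ h0]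

end Count

/-! ### The energy form -/

section Energy

variable {L : ℕ} [NeZero L]

/-- The quadratic form of the Hamiltonian, shifted to vanish on the fully polarized state. -/
noncomputable def energy (q : ℝ) (φ : Space 1 L) : ℝ :=
  ∑ i ∈ Finset.Ico (1 : ℤ) L, ∑ σ : Config 1 L,
      (if σ (st L i) = σ (st L (i + 1)) then 0 else
        (1 / 2 * ‖φ σ‖ ^ 2 - wa q * wb q * ((starRingEnd ℂ) (φ σ) * φ (sw i σ)).re))
    + fA q * ∑ σ, (dn σ 1 + dn σ L) * ‖φ σ‖ ^ 2

theorem energy_eq {Δ q : ℝ} (hq0 : 0 < q) (hq1 : q < 1) (hΔq : Δ = (q + q⁻¹) / 2)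
    (φ : Space 1 L) :
    energy q φ = (inner ℂ φ (droplet Δ L φ)).re + fA q * ‖φ‖ ^ 2 := by
  have h : inner ℂ φ (droplet Δ L φ) = ∑ i ∈ Finset.Ico (1 : ℤ) L, ∑ σ : Config 1 L,
        (starRingEnd ℂ) (φ σ) * bondAmp Δ⁻¹ i φ σ
      + ∑ σ : Config 1 L, ((fA q * (dn σ 1 + dn σ L - 1) * ‖φ σ‖ ^ 2 : ℝ) : ℂ) := by
    rw [inner_eq_sum, Finset.sum_comm, ← Finset.sum_add_distrib]
    refine Finset.sum_congr rfl fun σ _ => ?_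
    rw [droplet_apply, fieldA_eq hq0 hq1 hΔq, ← fA, mul_add, Finset.mul_sum]
    congr 1
    push_cast
    have := conj_mul_self (φ σ)
    push_cast at this
    rw [← this]; ring
  rw [h, Complex.add_re, Complex.re_sum, Complex.re_sum, energy, add_assoc]
  congr 1
  · refine Finset.sum_congr rfl fun i _ => ?_
    rw [Complex.re_sum]
    refine Finset.sum_congr rfl fun σ _ => ?_
    rw [bondAmp, inv_eq_of_anisotropy hq0 hΔq]
    split_ifs
    · simp
    · have e : (starRingEnd ℂ) (φ σ) * (1 / 2 * φ σ
          - ((2 * (wa q * wb q) : ℝ) : ℂ) / 2 * φ (sw i σ))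
          = ((1 / 2 : ℝ) : ℂ) * ((starRingEnd ℂ) (φ σ) * φ σ)
            - ((wa q * wb q : ℝ) : ℂ) * ((starRingEnd ℂ) (φ σ) * φ (sw i σ)) := by
        push_cast; ring
      rw [e, conj_mul_self, Complex.sub_re, Complex.re_ofReal_mul, Complex.re_ofReal_mul,
        Complex.ofReal_re]
  · simp only [Complex.ofReal_re]
    rw [norm_sq_eq_sum, Finset.mul_sum, Finset.mul_sum, ← Finset.sum_add_distrib]
    refine Finset.sum_congr rfl fun σ _ => by ring

/-- Number of domain walls. -/
noncomputable def walls (σ : Config 1 L) : ℕ :=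
  ((Finset.Ico (1 : ℤ) L).filter fun i => σ (st L i) ≠ σ (st L (i + 1))).card

theorem sum_walls (F : Config 1 L → ℝ) :
    ∑ σ, (walls σ : ℝ) * F σ = ∑ i ∈ Finset.Ico (1 : ℤ) L, ∑ σ : Config 1 L,
      if σ (st L i) = σ (st L (i + 1)) then 0 else F σ := by
  rw [Finset.sum_comm]
  refine Finset.sum_congr rfl fun σ _ => ?_
  rw [walls, Finset.card_filter]
  push_cast
  rw [Finset.sum_mul]
  refine Finset.sum_congr rfl fun i _ => ?_
  by_cases h : σ (st L i) = σ (st L (i + 1)) <;> simp [h]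

theorem sum_sw_ne (i : ℤ) (F : Config 1 L → ℝ) :
    ∑ σ : Config 1 L, (if σ (st L i) = σ (st L (i + 1)) then 0 else F (sw i σ))
      = ∑ σ : Config 1 L, if σ (st L i) = σ (st L (i + 1)) then 0 else F σ := by
  rw [← sum_sw i]
  refine Finset.sum_congr rfl fun σ _ => ?_
  rw [sw_left, sw_right, sw_sw]
  exact if_congr eq_comm rfl rfl

theorem abs_re_conj_mul_le (z w : ℂ) :
    |((starRingEnd ℂ) z * w).re| ≤ 1 / 2 * ‖z‖ ^ 2 + 1 / 2 * ‖w‖ ^ 2 := by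
  refine (Complex.abs_re_le_norm _).trans ?_
  rw [norm_mul, RCLike.norm_conj]
  nlinarith [sq_nonneg (‖z‖ - ‖w‖)]

theorem sum_hop_le (i : ℤ) (φ : Space 1 L) :
    ∑ σ : Config 1 L, (if σ (st L i) = σ (st L (i + 1)) then 0 else
        |((starRingEnd ℂ) (φ σ) * φ (sw i σ)).re|)
      ≤ ∑ σ : Config 1 L, if σ (st L i) = σ (st L (i + 1)) then 0 else ‖φ σ‖ ^ 2 := by
  have h1 := sum_sw_ne i fun σ => ‖φ σ‖ ^ 2
  have h2 : ∑ σ : Config 1 L, (if σ (st L i) = σ (st L (i + 1)) then 0 else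
        |((starRingEnd ℂ) (φ σ) * φ (sw i σ)).re|)
      ≤ ∑ σ : Config 1 L, (1 / 2 * (if σ (st L i) = σ (st L (i + 1)) then 0 else ‖φ σ‖ ^ 2)
        + 1 / 2 * (if σ (st L i) = σ (st L (i + 1)) then 0 else ‖φ (sw i σ)‖ ^ 2)) := by
    refine Finset.sum_le_sum fun σ _ => ?_
    split_ifs
    · simp
    · exact abs_re_conj_mul_le _ _
  rw [Finset.sum_add_distrib, ← Finset.mul_sum, ← Finset.mul_sum, h1] at h2
  linarith

/-- Each domain wall costs at least `γ / 2`, since hopping is dominated by the Ising part. -/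
theorem energy_ge_walls {q : ℝ} (hq0 : 0 < q) (hq1 : q < 1) (φ : Space 1 L) :
    gam q / 2 * ∑ σ, (walls σ : ℝ) * ‖φ σ‖ ^ 2 ≤ energy q φ := by
  have hab : 0 ≤ wa q * wb q := (mul_pos (wa_pos hq0) (wb_pos q)).le
  have hb : 0 ≤ fA q * ∑ σ : Config 1 L, (dn σ 1 + dn σ L) * ‖φ σ‖ ^ 2 :=
    mul_nonneg (fA_nonneg hq0 hq1) (Finset.sum_nonneg fun σ _ =>
      mul_nonneg (add_nonneg (dn_nonneg _ _) (dn_nonneg _ _)) (by positivity))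
  rw [sum_walls, Finset.mul_sum, energy]
  refine le_add_of_le_of_nonneg (Finset.sum_le_sum fun i _ => ?_) hb
  have h1 := sum_hop_le i φ
  have h2 : ∑ σ : Config 1 L, (1 / 2 * (if σ (st L i) = σ (st L (i + 1)) then 0 else ‖φ σ‖ ^ 2)
      - wa q * wb q * (if σ (st L i) = σ (st L (i + 1)) then 0 else
        |((starRingEnd ℂ) (φ σ) * φ (sw i σ)).re|))
      ≤ ∑ σ : Config 1 L, (if σ (st L i) = σ (st L (i + 1)) then 0 else
        (1 / 2 * ‖φ σ‖ ^ 2 - wa q * wb q * ((starRingEnd ℂ) (φ σ) * φ (sw i σ)).re)) := by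
    refine Finset.sum_le_sum fun σ _ => ?_
    split_ifs
    · simp
    · have := mul_le_mul_of_nonneg_left (le_abs_self ((starRingEnd ℂ) (φ σ) * φ (sw i σ)).re) hab
      linarith
  refine le_trans ?_ h2
  rw [Finset.sum_sub_distrib, ← Finset.mul_sum, ← Finset.mul_sum]
  have := mul_le_mul_of_nonneg_left h1 hab
  unfold gam
  linarith

theorem energy_le_walls {q : ℝ} (hq0 : 0 < q) (hq1 : q < 1) (φ : Space 1 L) :
    energy q φ ≤ ∑ σ, ((walls σ : ℝ) + 1) * ‖φ σ‖ ^ 2 := by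
  have hab : 0 ≤ wa q * wb q := (mul_pos (wa_pos hq0) (wb_pos q)).le
  have hab2 : wa q * wb q ≤ 1 / 2 := by have := gam_pos hq1; unfold gam at this; linarith
  have hb : fA q * ∑ σ : Config 1 L, (dn σ 1 + dn σ L) * ‖φ σ‖ ^ 2 ≤ ∑ σ, ‖φ σ‖ ^ 2 := by
    rw [Finset.mul_sum]
    refine Finset.sum_le_sum fun σ _ => ?_
    have h1 := fA_nonneg hq0 hq1
    have h2 := fA_le_half q
    have h3 := dn_le_one σ 1
    have h4 := dn_le_one σ L
    have h5 : fA q * (dn σ 1 + dn σ L) ≤ 1 := by nlinarith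
    have h6 : 0 ≤ ‖φ σ‖ ^ 2 := by positivity
    nlinarith
  simp only [add_mul, one_mul, Finset.sum_add_distrib]
  rw [sum_walls, energy]
  refine add_le_add (Finset.sum_le_sum fun i _ => ?_) hb
  have h1 := sum_hop_le i φ
  have h2 : ∑ σ : Config 1 L, (if σ (st L i) = σ (st L (i + 1)) then 0 else
        (1 / 2 * ‖φ σ‖ ^ 2 - wa q * wb q * ((starRingEnd ℂ) (φ σ) * φ (sw i σ)).re))
      ≤ ∑ σ : Config 1 L, (1 / 2 * (if σ (st L i) = σ (st L (i + 1)) then 0 else ‖φ σ‖ ^ 2)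
      + wa q * wb q * (if σ (st L i) = σ (st L (i + 1)) then 0 else
        |((starRingEnd ℂ) (φ σ) * φ (sw i σ)).re|)) := by
    refine Finset.sum_le_sum fun σ _ => ?_
    split_ifs
    · simp
    · have := mul_le_mul_of_nonneg_left
        (neg_abs_le ((starRingEnd ℂ) (φ σ) * φ (sw i σ)).re) hab
      linarith
  refine h2.trans ?_
  rw [Finset.sum_add_distrib, ← Finset.mul_sum, ← Finset.mul_sum]
  have := mul_le_mul_of_nonneg_left h1 hab
  have h0 : 0 ≤ ∑ σ : Config 1 L, if σ (st L i) = σ (st L (i + 1)) then 0 else ‖φ σ‖ ^ 2 :=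
    Finset.sum_nonneg fun σ _ => by split_ifs <;> positivity
  nlinarith

/-- Each wall is adjacent to a down spin, and each down spin is adjacent to at most two walls. -/
theorem walls_le (σ : Config 1 L) : walls σ ≤ 2 * cnt L σ := by
  classical
  have hsub : ((Finset.Ico (1 : ℤ) L).filter fun i => σ (st L i) ≠ σ (st L (i + 1)))
      ⊆ (Finset.univ.filter fun y : Sites 1 L => σ y = 1).image (fun y => y.1)
        ∪ (Finset.univ.filter fun y : Sites 1 L => σ y = 1).image (fun y => y.1 - 1) := by
    intro i hi
    rw [Finset.mem_filter, Finset.mem_Ico] at hi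
    rw [Finset.mem_union, Finset.mem_image, Finset.mem_image]
    rcases fin2_cases (σ (st L i)) with h | h
    · right
      refine ⟨st L (i + 1), ?_, by rw [st_val (by omega) (by omega)]; ring⟩
      rcases fin2_cases (σ (st L (i + 1))) with h' | h'
      · exact absurd (h.trans h'.symm) hi.2
      · simpa using h'
    · left
      exact ⟨st L i, by simpa using h, st_val hi.1.1 hi.1.2.le⟩
  rw [walls, cnt_top]
  refine (Finset.card_le_card hsub).trans ((Finset.card_union_le _ _).trans ?_)
  have := Finset.card_image_le (s := Finset.univ.filter fun y : Sites 1 L => σ y = 1)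
    (f := fun y => y.1)
  have := Finset.card_image_le (s := Finset.univ.filter fun y : Sites 1 L => σ y = 1)
    (f := fun y => y.1 - 1)
  omega

/-- Localization formula: splitting a state by a quadratic partition of unity raises the energy by
an amount controlled by the variation of the partition along the exchanges of neighbours. -/
theorem sum_energy_le {ι : Type*} (s : Finset ι) {q : ℝ} (hq0 : 0 < q) (φ : Space 1 L)
    (χ : ι → Config 1 L → ℝ) {ε : ℝ} (hε0 : 0 ≤ ε) (hsq : ∀ σ, φ σ ≠ 0 → ∑ j ∈ s, χ j σ ^ 2 = 1)
    (hhop : ∀ i ∈ Finset.Ico (1 : ℤ) L, ∀ σ : Config 1 L, σ (st L i) ≠ σ (st L (i + 1)) →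
      φ σ ≠ 0 → φ (sw i σ) ≠ 0 → |1 - ∑ j ∈ s, χ j σ * χ j (sw i σ)| ≤ ε) :
    ∑ j ∈ s, energy q (diag (χ j) φ)
      ≤ energy q φ + wa q * wb q * ε * ∑ σ, (walls σ : ℝ) * ‖φ σ‖ ^ 2 := by
  have hab : 0 ≤ wa q * wb q := (mul_pos (wa_pos hq0) (wb_pos q)).le
  have hnorm : ∀ j σ, ‖diag (χ j) φ σ‖ ^ 2 = χ j σ ^ 2 * ‖φ σ‖ ^ 2 := by
    intro j σ
    rw [diag_apply, norm_mul, mul_pow, Complex.norm_real, Real.norm_eq_abs, sq_abs]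
  have hsum : ∀ σ, ∑ j ∈ s, χ j σ ^ 2 * ‖φ σ‖ ^ 2 = ‖φ σ‖ ^ 2 := by
    intro σ
    by_cases h : φ σ = 0
    · simp [h]
    · rw [← Finset.sum_mul, hsq σ h, one_mul]
  simp only [energy, Finset.sum_add_distrib, ← Finset.mul_sum, hnorm]
  have e1 : ∑ j ∈ s, ∑ σ, (dn σ 1 + dn σ L) * (χ j σ ^ 2 * ‖φ σ‖ ^ 2)
      = ∑ σ, (dn σ 1 + dn σ L) * ‖φ σ‖ ^ 2 := by
    rw [Finset.sum_comm]
    refine Finset.sum_congr rfl fun σ _ => ?_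
    rw [← Finset.mul_sum, hsum]
  rw [e1, add_right_comm]
  refine add_le_add ?_ le_rfl
  rw [Finset.sum_comm, sum_walls, Finset.mul_sum, ← Finset.sum_add_distrib]
  refine Finset.sum_le_sum fun i hi => ?_
  rw [Finset.sum_comm]
  have hε : ∀ σ : Config 1 L, ∑ j ∈ s, (if σ (st L i) = σ (st L (i + 1)) then 0 else
        (1 / 2 * (χ j σ ^ 2 * ‖φ σ‖ ^ 2) - wa q * wb q *
          ((starRingEnd ℂ) (diag (χ j) φ σ) * diag (χ j) φ (sw i σ)).re))
      ≤ (if σ (st L i) = σ (st L (i + 1)) then 0 else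
        (1 / 2 * ‖φ σ‖ ^ 2 - wa q * wb q * ((starRingEnd ℂ) (φ σ) * φ (sw i σ)).re))
        + wa q * wb q * ε * (if σ (st L i) = σ (st L (i + 1)) then 0 else
          (1 / 2 * ‖φ σ‖ ^ 2 + 1 / 2 * ‖φ (sw i σ)‖ ^ 2)) := by
    intro σ
    by_cases h : σ (st L i) = σ (st L (i + 1))
    · simp [h]
    · simp only [if_neg h]
      rw [Finset.sum_sub_distrib, ← Finset.mul_sum, hsum, ← Finset.mul_sum]
      have e2 : ∑ j ∈ s, ((starRingEnd ℂ) (diag (χ j) φ σ) * diag (χ j) φ (sw i σ)).re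
          = (∑ j ∈ s, χ j σ * χ j (sw i σ)) * ((starRingEnd ℂ) (φ σ) * φ (sw i σ)).re := by
        rw [Finset.sum_mul]
        refine Finset.sum_congr rfl fun j _ => ?_
        rw [diag_apply, diag_apply, map_mul, Complex.conj_ofReal]
        have : (χ j σ : ℂ) * (starRingEnd ℂ) (φ σ) * ((χ j (sw i σ) : ℂ) * φ (sw i σ))
            = ((χ j σ * χ j (sw i σ) : ℝ) : ℂ) * ((starRingEnd ℂ) (φ σ) * φ (sw i σ)) := by
          push_cast; ring
        rw [this, Complex.re_ofReal_mul]
      rw [e2]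
      set X := ∑ j ∈ s, χ j σ * χ j (sw i σ)
      set Y := ((starRingEnd ℂ) (φ σ) * φ (sw i σ)).re with hY
      have h3 : (1 - X) * Y ≤ ε * (1 / 2 * ‖φ σ‖ ^ 2 + 1 / 2 * ‖φ (sw i σ)‖ ^ 2) := by
        by_cases h4 : φ σ = 0 ∨ φ (sw i σ) = 0
        · have hY0 : Y = 0 := by
            rcases h4 with h4 | h4 <;> rw [hY, h4] <;> simp
          rw [hY0, mul_zero]; positivity
        · push Not at h4
          have h5 := hhop i hi σ h h4.1 h4.2
          calc (1 - X) * Y ≤ |(1 - X) * Y| := le_abs_self _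
            _ = |1 - X| * |Y| := abs_mul _ _
            _ ≤ ε * _ := mul_le_mul h5 (abs_re_conj_mul_le _ _) (abs_nonneg _)
              ((abs_nonneg _).trans h5)
      have := mul_le_mul_of_nonneg_left h3 hab
      linarith
  refine (Finset.sum_le_sum fun σ _ => hε σ).trans ?_
  rw [Finset.sum_add_distrib, ← Finset.mul_sum]
  have h6 : ∑ σ : Config 1 L, (if σ (st L i) = σ (st L (i + 1)) then 0 else
          (1 / 2 * ‖φ σ‖ ^ 2 + 1 / 2 * ‖φ (sw i σ)‖ ^ 2))
      = ∑ σ : Config 1 L, if σ (st L i) = σ (st L (i + 1)) then 0 else ‖φ σ‖ ^ 2 := by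
    have h1 := sum_sw_ne i fun σ => ‖φ σ‖ ^ 2
    have : ∑ σ : Config 1 L, (if σ (st L i) = σ (st L (i + 1)) then 0 else
          (1 / 2 * ‖φ σ‖ ^ 2 + 1 / 2 * ‖φ (sw i σ)‖ ^ 2))
        = ∑ σ : Config 1 L, (1 / 2 * (if σ (st L i) = σ (st L (i + 1)) then 0 else ‖φ σ‖ ^ 2)
        + 1 / 2 * (if σ (st L i) = σ (st L (i + 1)) then 0 else ‖φ (sw i σ)‖ ^ 2)) := by
      refine Finset.sum_congr rfl fun σ _ => ?_
      split_ifs <;> simp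
    rw [this, Finset.sum_add_distrib, ← Finset.mul_sum, ← Finset.mul_sum, h1]
    ring
  rw [h6]

end Energy

/-! ### The spectral gap of a cut chain -/

section Gap

variable {L : ℕ} [NeZero L]

theorem inner_cutOp_comm (q : ℝ) (x : ℤ) (φ χ : Space 1 L) :
    inner ℂ (cutOp q x φ) χ = inner ℂ φ (cutOp q x χ) := by
  simp only [cutOp, LinearMap.sum_apply, sum_inner, inner_sum, inner_kinkOp_comm]

theorem uLR_norm (q : ℝ) (i x : ℤ) :
    (if i < x then uL q else uR q) 0 ^ 2 + (if i < x then uL q else uR q) 1 ^ 2 = 1 := by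
  split_ifs
  · exact uL_norm q
  · exact uR_norm q

theorem inner_cutOp_self (q : ℝ) (x : ℤ) (φ : Space 1 L) :
    (inner ℂ φ (cutOp q x φ)).re
      = ∑ i ∈ (Finset.Ico (1 : ℤ) L).erase x,
        ‖kinkOp (if i < x then uL q else uR q) i φ‖ ^ 2 := by
  simp only [cutOp, LinearMap.sum_apply, inner_sum, Complex.re_sum]
  refine Finset.sum_congr rfl fun i _ => ?_
  rw [inner_kinkOp_self, norm_kinkOp_sq (uLR_norm q i x), Complex.ofReal_re]

theorem cutOp_form_nonneg (q : ℝ) (x : ℤ) (φ : Space 1 L) :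
    0 ≤ (inner ℂ φ (cutOp q x φ)).re := by
  rw [inner_cutOp_self]
  exact Finset.sum_nonneg fun _ _ => by positivity

/-- Distant interactions commute and neighbouring ones satisfy the Temperley-Lieb relation; hence
the square of the Hamiltonian dominates `γ` times the Hamiltonian. -/
theorem cutOp_sq_ge {q : ℝ} (hq0 : 0 < q) (x : ℤ) (φ : Space 1 L) :
    gam q * (inner ℂ φ (cutOp q x φ)).re ≤ ‖cutOp q x φ‖ ^ 2 := by
  have hab : 0 ≤ wa q * wb q := (mul_pos (wa_pos hq0) (wb_pos q)).le
  rw [inner_cutOp_self, gam]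
  have e : cutOp q x φ = ∑ i ∈ (Finset.Ico (1 : ℤ) L).erase x,
      kinkOp (if i < x then uL q else uR q) i φ := by simp [cutOp]
  rw [e]
  refine norm_sum_sq_ge _ _ (by positivity) ?_ ?_
  · intro i hi j hj hij
    rw [Finset.mem_erase, Finset.mem_Ico] at hi hj
    exact inner_kinkOp_far (uLR_norm q i x) hi.2.1 hij hj.2.2 φ
  · intro i hi hj
    rw [Finset.mem_erase, Finset.mem_Ico] at hi hj
    have hu : (if i + 1 < x then uL q else uR q) = (if i < x then uL q else uR q) := by
      by_cases h : i < x
      · rw [if_pos h, if_pos (by omega)]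
      · rw [if_neg h, if_neg (by omega)]
    have hm : (if i < x then uL q else uR q) 0 * (if i < x then uL q else uR q) 1
        = wa q * wb q := by
      split_ifs <;> simp [uL, uR, mul_comm]
    have h := norm_inner_kinkOp_succ (uLR_norm q i x) (by rw [hm]; exact hab) hi.2.1 hj.2.2 φ
    rw [hm] at h
    rw [hu]
    have h2 := (abs_le.1 ((Complex.abs_re_le_norm _).trans h)).1
    linarith

theorem defect_eq_zero_of_cutOp {q : ℝ} {x : ℤ} {φ : Space 1 L} (h : cutOp q x φ = 0) {i : ℤ}
    (hi : i ∈ (Finset.Ico (1 : ℤ) L).erase x) (σ : Config 1 L) :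
    defect (if i < x then uL q else uR q) i φ σ = 0 := by
  have h1 := inner_cutOp_self q x φ
  rw [h, inner_zero_right, Complex.zero_re] at h1
  have h2 := (Finset.sum_eq_zero_iff_of_nonneg (fun i _ => by positivity)).1 h1.symm i hi
  rw [norm_kinkOp_sq (uLR_norm q i x)] at h2
  have h3 : ∑ σ, ‖defect (if i < x then uL q else uR q) i φ σ‖ ^ 2 = 0 := by linarith
  have h4 := (Finset.sum_eq_zero_iff_of_nonneg (fun i _ => by positivity)).1 h3 σ
    (Finset.mem_univ _)
  simpa using h4

/-- Depth of the site `y` below the cut between `x` and `x + 1`, counted from `1` on both sides. -/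
def depth (x y : ℤ) : ℕ := if y ≤ x then (x + 1 - y).toNat else (y - x).toNat

/-- Total depth of the down spins. -/
noncomputable def totalDepth (x : ℤ) (σ : Config 1 L) : ℕ := ∑ y, (σ y).val * depth x y.1

theorem totalDepth_sw {i x : ℤ} (hi : 1 ≤ i) (hi' : i < L) {σ : Config 1 L}
    (h0 : σ (st L i) = 0) (h1 : σ (st L (i + 1)) = 1) :
    totalDepth x (sw i σ) + depth x (i + 1) = totalDepth x σ + depth x i := by
  have v1 : (st L i).1 = i := st_val hi hi'.le
  have v2 : (st L (i + 1)).1 = i + 1 := st_val (by omega) (by omega)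
  have hne : st L i ≠ st L (i + 1) := st_ne hi hi'.le (by omega) (by omega) (by omega)
  have key : ∀ τ : Config 1 L, totalDepth x τ = (τ (st L i)).val * depth x i
      + (τ (st L (i + 1))).val * depth x (i + 1)
      + ∑ y ∈ (Finset.univ.erase (st L i)).erase (st L (i + 1)), (τ y).val * depth x y.1 := by
    intro τ
    rw [totalDepth, ← Finset.add_sum_erase _ _ (Finset.mem_univ (st L i)),
      ← Finset.add_sum_erase _ _ (Finset.mem_erase.2 ⟨hne.symm, Finset.mem_univ _⟩), v1, v2]
    ring
  rw [key, key σ, sw_left, sw_right, h0, h1]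
  have : ∑ y ∈ (Finset.univ.erase (st L i)).erase (st L (i + 1)), (sw i σ y).val * depth x y.1
      = ∑ y ∈ (Finset.univ.erase (st L i)).erase (st L (i + 1)), (σ y).val * depth x y.1 := by
    refine Finset.sum_congr rfl fun y hy => ?_
    rw [Finset.mem_erase, Finset.mem_erase] at hy
    rw [sw_of_ne σ hy.2.1 hy.1]
  rw [this]
  simp; ring

/-- The product of a `+-` kink state with `k` down spins on `[1, x]` and a `-+` kink state with
`n - k` down spins on `[x + 1, L]`. -/
noncomputable def kinkPair (q : ℝ) (x : ℤ) (k n : ℕ) : Space 1 L :=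
  open Classical in
  WithLp.toLp 2 fun σ =>
    if cnt x σ = k ∧ cnt L σ = n then ((q ^ totalDepth x σ : ℝ) : ℂ) else 0

omit [NeZero L] in
theorem kinkPair_apply (q : ℝ) (x : ℤ) (k n : ℕ) (σ : Config 1 L)
    [Decidable (cnt x σ = k ∧ cnt L σ = n)] :
    kinkPair q x k n σ
      = if cnt x σ = k ∧ cnt L σ = n then ((q ^ totalDepth x σ : ℝ) : ℂ) else 0 := by
  simp only [kinkPair]
  congr

/-- The recursion characterizing kink states: the weight `q ^ totalDepth` balances every
interaction away from the cut. -/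
theorem weight_balance {q : ℝ} {x i : ℤ} (hi : i ∈ (Finset.Ico (1 : ℤ) L).erase x)
    (σ : Config 1 L) :
    (if i < x then uL q else uR q) (σ (st L i)) * q ^ totalDepth x σ
      = (if i < x then uL q else uR q) (σ (st L (i + 1))) * q ^ totalDepth x (sw i σ) := by
  rw [Finset.mem_erase, Finset.mem_Ico] at hi
  by_cases h : σ (st L i) = σ (st L (i + 1))
  · rw [sw_eq_self h, h]
  · rcases fin2_cases (σ (st L i)) with h0 | h0 <;>
      rcases fin2_cases (σ (st L (i + 1))) with h1 | h1
    · exact absurd (h0.trans h1.symm) h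
    · have h2 := totalDepth_sw (x := x) hi.2.1 hi.2.2 h0 h1
      rw [h0, h1]
      split_ifs with hx
      · rw [depth, depth, if_pos (by omega), if_pos (by omega)] at h2
        have : totalDepth x (sw i σ) = totalDepth x σ + 1 := by omega
        rw [this, pow_succ]; simp only [uL, Matrix.cons_val_zero, Matrix.cons_val_one,
          Matrix.cons_val_fin_one, wa_eq]; ring
      · rw [depth, depth, if_neg (by omega), if_neg (by omega)] at h2
        have : totalDepth x σ = totalDepth x (sw i σ) + 1 := by omega
        rw [this, pow_succ]; simp only [uR, Matrix.cons_val_zero, Matrix.cons_val_one,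
          Matrix.cons_val_fin_one, wa_eq]; ring
    · have h2 := totalDepth_sw (x := x) (σ := sw i σ) hi.2.1 hi.2.2 (by simpa using h1)
        (by simpa using h0)
      rw [sw_sw] at h2
      rw [h0, h1]
      split_ifs with hx
      · rw [depth, depth, if_pos (by omega), if_pos (by omega)] at h2
        have : totalDepth x σ = totalDepth x (sw i σ) + 1 := by omega
        rw [this, pow_succ]; simp only [uL, Matrix.cons_val_zero, Matrix.cons_val_one,
          Matrix.cons_val_fin_one, wa_eq]; ring
      · rw [depth, depth, if_neg (by omega), if_neg (by omega)] at h2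
        have : totalDepth x (sw i σ) = totalDepth x σ + 1 := by omega
        rw [this, pow_succ]; simp only [uR, Matrix.cons_val_zero, Matrix.cons_val_one,
          Matrix.cons_val_fin_one, wa_eq]; ring
    · exact absurd (h0.trans h1.symm) h

theorem cutOp_kinkPair (q : ℝ) (x : ℤ) (k n : ℕ) :
    cutOp q x (kinkPair (L := L) q x k n) = 0 := by
  classical
  rw [cutOp, LinearMap.sum_apply]
  refine Finset.sum_eq_zero fun i hi => ?_
  ext σ
  rw [kinkOp_apply, defect, kinkPair_apply, kinkPair_apply]
  have hi' := hi
  rw [Finset.mem_erase, Finset.mem_Ico] at hi'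
  rw [cnt_sw hi'.2.1 hi'.2.2 hi'.1, cnt_sw hi'.2.1 hi'.2.2 hi'.2.2.ne]
  have h := weight_balance (q := q) hi σ
  set u := (if i < x then uL q else uR q)
  by_cases h2 : cnt x σ = k ∧ cnt L σ = n
  · rw [if_pos h2, if_pos h2, ← Complex.ofReal_mul, ← Complex.ofReal_mul, h]; simp
  · rw [if_neg h2, if_neg h2]; simp

/-- If two predicates have equally many elements of a class, a disagreement in the class comes with
the opposite one. -/
theorem exists_opposite {α : Type*} [Fintype α] (p : α → Prop) (σ τ : α → Fin 2)
    [DecidablePred p]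
    (h : (Finset.univ.filter fun y => p y ∧ σ y = 1).card
      = (Finset.univ.filter fun y => p y ∧ τ y = 1).card) {y₀ : α} (hy : p y₀)
    (hne : σ y₀ ≠ τ y₀) :
    ∃ y z, p y ∧ p z ∧ σ y = 1 ∧ τ y = 0 ∧ σ z = 0 ∧ τ z = 1 := by
  classical
  set A := Finset.univ.filter fun y => p y ∧ σ y = 1 with hA
  set B := Finset.univ.filter fun y => p y ∧ τ y = 1 with hB
  have hAB : A ≠ B := by
    intro he
    have h1 : y₀ ∈ A ↔ y₀ ∈ B := by rw [he]
    simp only [hA, hB, Finset.mem_filter, Finset.mem_univ, true_and, hy] at h1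
    rcases fin2_cases (σ y₀) with h2 | h2 <;> rcases fin2_cases (τ y₀) with h3 | h3 <;>
      simp_all
  have h1 : ¬ A ⊆ B := fun hs => hAB (Finset.eq_of_subset_of_card_le hs h.ge)
  have h2 : ¬ B ⊆ A := fun hs => hAB (Finset.eq_of_subset_of_card_le hs h.le).symm
  obtain ⟨y, hyA, hyB⟩ := Finset.not_subset.1 h1
  obtain ⟨z, hzB, hzA⟩ := Finset.not_subset.1 h2
  simp only [hA, hB, Finset.mem_filter, Finset.mem_univ, true_and, not_and] at hyA hyB hzA hzB
  exact ⟨y, z, hyA.1, hzB.1, hyA.2, fin2_ne_one (hyB hyA.1), fin2_ne_one (hzA hzB.1), hzB.2⟩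

/-- Exchanges of neighbours on one side of the cut generate all exchanges on that side. -/
theorem swap_invariant {α : Type*} {x : ℤ} {g : Config 1 L → α}
    (hg : ∀ i ∈ (Finset.Ico (1 : ℤ) L).erase x, ∀ σ, g (sw i σ) = g σ) {a b : ℤ} (ha : 1 ≤ a)
    (hab : a ≤ b) (hb : b ≤ L) (hx : b ≤ x ∨ x < a) (σ : Config 1 L) :
    g (σ ∘ Equiv.swap (st L a) (st L b)) = g σ := by
  induction b, hab using Int.leInduction generalizing σ with
  | base => simp
  | succ b hab ih =>
    have hmem : b ∈ (Finset.Ico (1 : ℤ) L).erase x := by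
      rw [Finset.mem_erase, Finset.mem_Ico]; omega
    by_cases h : a = b
    · subst h; exact hg a hmem σ
    · have hne1 : st L a ≠ st L b := st_ne ha (by omega) (by omega) (by omega) h
      have hne2 : st L a ≠ st L (b + 1) := st_ne ha (by omega) (by omega) (by omega) (by omega)
      have e : Equiv.swap (st L b) (st L (b + 1)) * Equiv.swap (st L a) (st L b)
          * Equiv.swap (st L b) (st L (b + 1)) = Equiv.swap (st L (b + 1)) (st L a) :=
        Equiv.swap_mul_swap_mul_swap hne1 hne2
      have h1 : σ ∘ Equiv.swap (st L a) (st L (b + 1))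
          = sw b ((sw b σ) ∘ Equiv.swap (st L a) (st L b)) := by
        rw [Equiv.swap_comm, ← e]; rfl
      rw [h1, hg b hmem, ih (by omega) (by omega), hg b hmem]

/-- A function that is invariant under the exchanges away from the cut depends only on the numbers of
down spins on the two sides of the cut. -/
theorem eq_of_cnt_eq {α : Type*} {x : ℤ} {g : Config 1 L → α}
    (hg : ∀ i ∈ (Finset.Ico (1 : ℤ) L).erase x, ∀ σ, g (sw i σ) = g σ) (σ τ : Config 1 L)
    (h1 : cnt x σ = cnt x τ) (h2 : cnt L σ = cnt L τ) : g σ = g τ := by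
  classical
  -- induction on the number of sites at which the two configurations differ
  induction hm : (Finset.univ.filter fun y => σ y ≠ τ y).card using Nat.strong_induction_on
    generalizing σ with
  | _ m ih =>
  by_cases he : σ = τ
  · rw [he]
  · obtain ⟨y₀, hy₀⟩ := Function.ne_iff.1 he
    have hex : ∃ y z : Sites 1 L, (y.1 ≤ x ↔ z.1 ≤ x) ∧ σ y = 1 ∧ τ y = 0 ∧ σ z = 0 ∧ τ z = 1 := by
      by_cases hp : y₀.1 ≤ x
      · obtain ⟨y, z, h3, h4, h5⟩ := exists_opposite (fun y : Sites 1 L => y.1 ≤ x) σ τ h1 hp hy₀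
        exact ⟨y, z, by tauto, h5⟩
      · have hc : ∀ ρ : Config 1 L, cnt L ρ = cnt x ρ
            + (Finset.univ.filter fun y : Sites 1 L => ¬ y.1 ≤ x ∧ ρ y = 1).card := by
          intro ρ
          rw [cnt_top, ← Finset.card_filter_add_card_filter_not (fun y : Sites 1 L => y.1 ≤ x),
            Finset.filter_filter, Finset.filter_filter, cnt]
          simp only [and_comm]
        obtain ⟨y, z, h3, h4, h5⟩ := exists_opposite (fun y : Sites 1 L => ¬ y.1 ≤ x) σ τ
          (by have := hc σ; have := hc τ; omega) hp hy₀
        exact ⟨y, z, by tauto, h5⟩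
    obtain ⟨y, z, hyz, h3, h4, h5, h6⟩ := hex
    have hinv : ∀ ρ : Config 1 L, g (ρ ∘ Equiv.swap y z) = g ρ := by
      intro ρ
      rcases le_total y.1 z.1 with h | h
      · have := swap_invariant hg y.2.1 h z.2.2 (by omega) ρ
        rwa [st_coe, st_coe] at this
      · have := swap_invariant hg z.2.1 h y.2.2 (by omega) ρ
        rwa [st_coe, st_coe, Equiv.swap_comm] at this
    have hcnt : ∀ w : ℤ, (y.1 ≤ w ↔ z.1 ≤ w) → cnt w (σ ∘ Equiv.swap y z) = cnt w σ := by
      intro w hw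
      refine Finset.card_equiv (Equiv.swap y z) fun t => ?_
      simp only [Finset.mem_filter, Finset.mem_univ, true_and]
      refine and_congr ?_ Iff.rfl
      by_cases ht : t = y
      · subst ht; rw [Equiv.swap_apply_left, hw]
      · by_cases ht' : t = z
        · subst ht'; rw [Equiv.swap_apply_right, hw]
        · rw [Equiv.swap_apply_of_ne_of_ne ht ht']
    have hyz' : y ≠ z := by rintro rfl; rw [h3] at h5; exact absurd h5 (by decide)
    rw [← hinv σ]
    refine ih _ ?_ (σ ∘ Equiv.swap y z) (by rw [hcnt x hyz, h1])
      (by rw [hcnt L (by have := y.2.2; have := z.2.2; tauto), h2]) rfl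
    rw [← hm]
    refine Finset.card_lt_card ⟨?_, ?_⟩
    · intro t ht
      simp only [Finset.mem_filter, Finset.mem_univ, true_and, Function.comp_apply] at ht ⊢
      by_cases ht1 : t = y
      · subst ht1; rw [h3, h4]; decide
      · by_cases ht2 : t = z
        · subst ht2; rw [h5, h6]; decide
        · rwa [Equiv.swap_apply_of_ne_of_ne ht1 ht2] at ht
    · intro hs
      have : y ∈ Finset.univ.filter fun y => σ y ≠ τ y := by
        simp [h3, h4]
      have := hs this
      simp [h4, h5] at this

/-- Zero modes of a cut chain agree with a multiple of the kink pair on each sector. -/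
theorem exists_eq_kinkPair {q : ℝ} (hq0 : 0 < q) {x : ℤ} {φ : Space 1 L} (h : cutOp q x φ = 0)
    (k n : ℕ) : ∃ c : ℂ, ∀ σ : Config 1 L, cnt x σ = k → cnt L σ = n →
      φ σ = c * kinkPair q x k n σ := by
  classical
  have hinv : ∀ i ∈ (Finset.Ico (1 : ℤ) L).erase x, ∀ σ : Config 1 L,
      φ (sw i σ) / ((q ^ totalDepth x (sw i σ) : ℝ) : ℂ)
        = φ σ / ((q ^ totalDepth x σ : ℝ) : ℂ) := by
    intro i hi σ
    have h1 := defect_eq_zero_of_cutOp h hi σ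
    have h2 := weight_balance (q := q) hi σ
    rw [defect, sub_eq_zero] at h1
    set u := (if i < x then uL q else uR q)
    have hu : u (σ (st L i)) ≠ 0 := by
      have h3 : ∀ s, 0 < u s := by
        intro s
        have := wa_pos hq0; have := wb_pos q
        simp only [u]
        split_ifs <;> rcases fin2_cases s with rfl | rfl <;> simpa [uL, uR]
      exact (h3 _).ne'
    have h4 : ((q ^ totalDepth x σ : ℝ) : ℂ) ≠ 0 := by
      exact_mod_cast (pow_pos hq0 _).ne'
    have h5 : ((q ^ totalDepth x (sw i σ) : ℝ) : ℂ) ≠ 0 := by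
      exact_mod_cast (pow_pos hq0 _).ne'
    have hu' : (u (σ (st L i)) : ℂ) ≠ 0 := by exact_mod_cast hu
    have h2' : (u (σ (st L i)) : ℂ) * ((q ^ totalDepth x σ : ℝ) : ℂ)
        = (u (σ (st L (i + 1))) : ℂ) * ((q ^ totalDepth x (sw i σ) : ℝ) : ℂ) := by
      exact_mod_cast h2
    rw [div_eq_div_iff h5 h4]
    apply mul_left_cancel₀ hu'
    calc _ = φ (sw i σ) * ((u (σ (st L i)) : ℂ) * ((q ^ totalDepth x σ : ℝ) : ℂ)) := by ring
      _ = (u (σ (st L (i + 1))) : ℂ) * φ (sw i σ) * ((q ^ totalDepth x (sw i σ) : ℝ) : ℂ) := by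
        rw [h2']; ring
      _ = _ := by rw [← h1]; ring
  by_cases hne : ∃ τ : Config 1 L, cnt x τ = k ∧ cnt L τ = n
  · obtain ⟨τ, h1, h2⟩ := hne
    refine ⟨φ τ / ((q ^ totalDepth x τ : ℝ) : ℂ), fun σ h3 h4 => ?_⟩
    have h5 := eq_of_cnt_eq (g := fun σ => φ σ / ((q ^ totalDepth x σ : ℝ) : ℂ)) hinv σ τ
      (h3.trans h1.symm) (h4.trans h2.symm)
    simp only at h5
    rw [← h5, kinkPair_apply, if_pos ⟨h3, h4⟩]
    have h6 : ((q ^ totalDepth x σ : ℝ) : ℂ) ≠ 0 := by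
      exact_mod_cast (pow_pos hq0 _).ne'
    field_simp
  · exact ⟨0, fun σ h3 h4 => absurd ⟨σ, h3, h4⟩ hne⟩

/-- Spectral gap of a cut chain above its unique zero mode in each sector. -/
theorem cutOp_gap {q : ℝ} (hq0 : 0 < q) (hq1 : q < 1) {x : ℤ} {k n : ℕ} {φ : Space 1 L}
    (hφ : SuppOn (fun σ => cnt x σ = k ∧ cnt L σ = n) φ) :
    gam q * (‖kinkPair (L := L) q x k n‖ ^ 2 * ‖φ‖ ^ 2
        - ‖inner ℂ (kinkPair q x k n) φ‖ ^ 2)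
      ≤ ‖kinkPair (L := L) q x k n‖ ^ 2 * (inner ℂ φ (cutOp q x φ)).re := by
  classical
  set ξ : Space 1 L := kinkPair q x k n with hξ
  by_cases h0 : ξ = 0
  · rw [h0]; simp
  have hN : 0 < ‖ξ‖ ^ 2 := by have := norm_pos_iff.2 h0; positivity
  set N := ‖ξ‖ ^ 2 with hNdef
  have hξξ : inner ℂ ξ ξ = (N : ℂ) := by
    rw [inner_self_eq_norm_sq_to_K, hNdef]; push_cast; rfl
  set c : ℂ := inner ℂ ξ φ / (N : ℂ) with hc
  have hNc : (N : ℂ) ≠ 0 := by exact_mod_cast hN.ne'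
  set η := φ - c • ξ with hη
  have horth : inner ℂ ξ η = 0 := by
    rw [hη, inner_sub_right, inner_smul_right, hξξ, hc]; field_simp; simp
  have hηs : SuppOn (fun σ => cnt x σ = k ∧ cnt L σ = n) η := by
    intro σ hσ
    by_contra hn
    apply hσ
    have h1 : φ σ = 0 := by by_contra h; exact hn (hφ σ h)
    rw [hη, PiLp.sub_apply, PiLp.smul_apply, h1, hξ, kinkPair_apply, if_neg hn]; simp
  have hker : ∀ u, cutOp q x u = 0 → inner ℂ u η = 0 := by
    intro u hu
    obtain ⟨d, hd⟩ := exists_eq_kinkPair hq0 hu k n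
    have : inner ℂ u η = (starRingEnd ℂ) d * inner ℂ ξ η := by
      rw [inner_eq_sum, inner_eq_sum, Finset.mul_sum]
      refine Finset.sum_congr rfl fun σ _ => ?_
      by_cases h : η σ = 0
      · rw [h]; simp
      · have := hηs σ h
        rw [hd σ this.1 this.2, map_mul]; ring
    rw [this, horth, mul_zero]
  have hgap := gap_of_sq_ge (inner_cutOp_comm q x) (gam_pos hq1) (cutOp_form_nonneg q x)
    (cutOp_sq_ge hq0 x) hker
  have hz : cutOp q x ξ = 0 := cutOp_kinkPair q x k n
  have hform : inner ℂ η (cutOp q x η) = inner ℂ φ (cutOp q x φ) := by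
    have h1 : cutOp q x η = cutOp q x φ := by rw [hη, map_sub, map_smul, hz]; simp
    rw [h1, hη, inner_sub_left, inner_smul_left, ← inner_cutOp_comm q x ξ, hz]; simp
  have hnorm : N * ‖η‖ ^ 2 = N * ‖φ‖ ^ 2 - ‖inner ℂ ξ φ‖ ^ 2 := by
    have h1 : φ = η + c • ξ := by rw [hη]; abel
    have h2 : ‖φ‖ ^ 2 = ‖η‖ ^ 2 + ‖c‖ ^ 2 * N := by
      rw [h1, @norm_add_sq ℂ, inner_smul_right, ← inner_conj_symm, horth, norm_smul, mul_pow]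
      simp [hNdef]
    have h3 : ‖c‖ * N = ‖inner ℂ ξ φ‖ := by
      rw [hc, norm_div, Complex.norm_real, Real.norm_of_nonneg hN.le]; field_simp
    rw [h2, ← h3]; ring
  rw [hform] at hgap
  rw [← hnorm]
  nlinarith

end Gap

/-! ### Concentration of kink states -/

section Holes

variable {L : ℕ}

/-- The cyclic permutation `a → a + 1 → ⋯ → b → a` of the sites. -/
def cyc (a b : ℤ) (ha : 1 ≤ a) (hab : a ≤ b) (hb : b ≤ L) : Equiv.Perm (Sites 1 L) where
  toFun z := ⟨if z.1 = b then a else if a ≤ z.1 ∧ z.1 < b then z.1 + 1 else z.1, by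
    have h := z.2; rw [Set.mem_Icc] at h ⊢; split_ifs <;> omega⟩
  invFun z := ⟨if z.1 = a then b else if a < z.1 ∧ z.1 ≤ b then z.1 - 1 else z.1, by
    have h := z.2; rw [Set.mem_Icc] at h ⊢; split_ifs <;> omega⟩
  left_inv z := by
    apply Subtype.ext
    dsimp only
    split_ifs <;> omega
  right_inv z := by
    apply Subtype.ext
    dsimp only
    split_ifs <;> omega

theorem cyc_val {a b : ℤ} (ha : 1 ≤ a) (hab : a ≤ b) (hb : b ≤ L) (z : Sites 1 L) :
    (cyc a b ha hab hb z).1 = if z.1 = b then a else if a ≤ z.1 ∧ z.1 < b then z.1 + 1 else z.1 :=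
  rfl

theorem cyc_symm_val {a b : ℤ} (ha : 1 ≤ a) (hab : a ≤ b) (hb : b ≤ L) (z : Sites 1 L) :
    ((cyc a b ha hab hb).symm z).1
      = if z.1 = a then b else if a < z.1 ∧ z.1 ≤ b then z.1 - 1 else z.1 :=
  rfl

theorem cnt_comp_perm {x : ℤ} (π : Equiv.Perm (Sites 1 L))
    (h : ∀ z : Sites 1 L, z.1 ≤ x ↔ (π z).1 ≤ x) (σ : Config 1 L) :
    cnt x (σ ∘ π) = cnt x σ := by
  refine Finset.card_equiv π fun y => ?_
  simp only [Finset.mem_filter, Finset.mem_univ, true_and]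
  exact and_congr (h y) Iff.rfl

theorem totalDepth_comp_perm (x : ℤ) (π : Equiv.Perm (Sites 1 L)) (σ : Config 1 L) :
    totalDepth x (σ ∘ π) = ∑ w, (σ w).val * depth x (π.symm w).1 := by
  rw [totalDepth, ← Equiv.sum_comp π fun w => (σ w).val * depth x (π.symm w).1]
  simp

open Classical in
/-- Total weight of the configurations satisfying `P` in the squared kink state. -/
noncomputable def wsum (q : ℝ) (x : ℤ) (P : Config 1 L → Prop) : ℝ :=
  ∑ σ, if P σ then (q ^ totalDepth x σ) ^ 2 else 0

theorem wsum_nonneg (q : ℝ) (x : ℤ) (P : Config 1 L → Prop) : 0 ≤ wsum q x P :=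
  Finset.sum_nonneg fun σ _ => by split_ifs <;> positivity

theorem wsum_mono {q : ℝ} {x : ℤ} {P P' : Config 1 L → Prop} (h : ∀ σ, P σ → P' σ) :
    wsum q x P ≤ wsum q x P' := by
  refine Finset.sum_le_sum fun σ _ => ?_
  by_cases h1 : P σ
  · rw [if_pos h1, if_pos (h σ h1)]
  · rw [if_neg h1]; split_ifs <;> positivity

/-- A rearrangement that lowers the depth by at least `r` gains a factor `q ^ (2 r)`. -/
theorem wsum_le_of_perm {q : ℝ} (hq0 : 0 < q) (hq1 : q < 1) {x : ℤ} {P P' : Config 1 L → Prop}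
    (π : Equiv.Perm (Sites 1 L)) (r : ℕ)
    (h : ∀ σ, P σ → P' (σ ∘ π) ∧ totalDepth x (σ ∘ π) + r ≤ totalDepth x σ) :
    wsum q x P ≤ (q ^ r) ^ 2 * wsum q x P' := by
  have e : wsum q x P' = ∑ σ : Config 1 L, (open Classical in
      if P' (σ ∘ π) then (q ^ totalDepth x (σ ∘ π)) ^ 2 else 0) :=
    (Equiv.sum_comp (Equiv.arrowCongr π.symm (Equiv.refl (Fin 2))) _).symm
  rw [e, wsum, Finset.mul_sum]
  refine Finset.sum_le_sum fun σ _ => ?_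
  by_cases h1 : P σ
  · rw [if_pos h1, if_pos (h σ h1).1, ← mul_pow, ← pow_add]
    have := (h σ h1).2
    have h2 : q ^ totalDepth x σ ≤ q ^ (r + totalDepth x (σ ∘ π)) :=
      pow_le_pow_of_le_one hq0.le hq1.le (by omega)
    have h3 : 0 ≤ q ^ totalDepth x σ := by positivity
    gcongr
  · rw [if_neg h1]; split_ifs <;> positivity

/-- The configurations with `k` down spins up to `x` and `n` in total. -/
def InSec (x : ℤ) (k n : ℕ) (σ : Config 1 L) : Prop := cnt x σ = k ∧ cnt L σ = n

theorem kinkPair_of_inSec {q : ℝ} {x : ℤ} {k n : ℕ} {σ : Config 1 L} (h : InSec x k n σ) :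
    kinkPair q x k n σ = ((q ^ totalDepth x σ : ℝ) : ℂ) := by
  classical
  rw [kinkPair_apply, if_pos (show cnt x σ = k ∧ cnt L σ = n from h)]

theorem kinkPair_of_not_inSec {q : ℝ} {x : ℤ} {k n : ℕ} {σ : Config 1 L} (h : ¬ InSec x k n σ) :
    kinkPair q x k n σ = 0 := by
  classical
  rw [kinkPair_apply, if_neg (show ¬(cnt x σ = k ∧ cnt L σ = n) from h)]

theorem kinkPair_eq_zero {q : ℝ} {x : ℤ} {k n : ℕ} (h : ¬ ∃ σ : Config 1 L, InSec x k n σ) :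
    kinkPair (L := L) q x k n = 0 := by
  ext σ
  rw [kinkPair_of_not_inSec (fun hσ => h ⟨σ, hσ⟩)]; rfl

variable [NeZero L]

/-- An up spin at depth `j + 1` to the left of the cut is moved cyclically to the left end, which brings
at least `k - j` down spins closer to the cut. -/
theorem hole_left {q : ℝ} (hq0 : 0 < q) (hq1 : q < 1) {x : ℤ} (hxL : x ≤ L) (k n : ℕ) {j : ℕ}
    (hj : (j : ℤ) < x) :
    wsum (L := L) q x (fun σ => InSec x k n σ ∧ σ (st L (x - j)) = 0)
      ≤ (q ^ (k - j)) ^ 2 * wsum (L := L) q x (InSec x k n) := by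
  have hy1 : 1 ≤ x - j := by omega
  have hyL : x - j ≤ L := by omega
  set π := (cyc (L := L) 1 (x - j) le_rfl hy1 hyL).symm with hπ
  refine wsum_le_of_perm hq0 hq1 π (k - j) fun σ hσ => ?_
  obtain ⟨⟨h1, h2⟩, h3⟩ := hσ
  refine ⟨⟨?_, ?_⟩, ?_⟩
  · rw [cnt_comp_perm, h1]
    intro z
    have := z.2.1
    rw [hπ, cyc_symm_val]; split_ifs <;> omega
  · rw [cnt_comp_perm, h2]
    intro z
    have := z.2.1; have := z.2.2
    rw [hπ, cyc_symm_val]; split_ifs <;> omega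
  · have h4 : totalDepth x (σ ∘ π) + cnt (x - j - 1) σ ≤ totalDepth x σ := by
      rw [totalDepth_comp_perm, totalDepth, cnt, Finset.card_filter, ← Finset.sum_add_distrib]
      refine Finset.sum_le_sum fun w _ => ?_
      rw [hπ, Equiv.symm_symm, cyc_val]
      rcases fin2_cases (σ w) with h5 | h5
      · simp [h5]
      · have h6 : w.1 ≠ x - j := by
          intro h6
          rw [← h6, st_coe, h5] at h3
          exact absurd h3 (by decide)
        have := w.2.1
        rw [h5, if_neg h6]
        by_cases h7 : w.1 ≤ x - j - 1
        · rw [if_pos (by omega), if_pos ⟨h7, rfl⟩, depth, depth, if_pos (by omega),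
            if_pos (by omega)]
          simp; omega
        · rw [if_neg (by omega), if_neg (by tauto)]
          simp
    have h8 := cnt_le_add (L := L) (x := x - j) (y := x) (by omega) (by omega) hxL σ
    have h9 := cnt_succ (L := L) (x := x - j - 1) (by omega) (by omega) σ
    rw [sub_add_cancel, h3] at h9
    simp only [Fin.val_zero, add_zero] at h9
    omega

/-- Moving an up spin at `y > x` cyclically to the right end of the chain preserves the counts and
brings all down spins to the right of `y` closer to the cut by one. -/
theorem shift_right {x y : ℤ} (h0 : 0 ≤ x) (hy : x < y) (hyL : y ≤ L) {k n : ℕ}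
    {σ : Config 1 L} (hσ : InSec x k n σ) (h3 : σ (st L y) = 0) :
    InSec x k n (σ ∘ cyc (L := L) y L (by omega) hyL le_rfl) ∧
      totalDepth x (σ ∘ cyc (L := L) y L (by omega) hyL le_rfl) + (n - cnt y σ)
        ≤ totalDepth x σ := by
  obtain ⟨h1, h2⟩ := hσ
  set π := cyc (L := L) y L (by omega) hyL le_rfl with hπ
  refine ⟨⟨?_, ?_⟩, ?_⟩
  · rw [cnt_comp_perm, h1]
    intro z
    have := z.2.1; have := z.2.2
    rw [hπ, cyc_val]; split_ifs <;> omega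
  · rw [cnt_comp_perm, h2]
    intro z
    have := z.2.1; have := z.2.2
    rw [hπ, cyc_val]; split_ifs <;> omega
  · have hc : n = cnt y σ
        + (Finset.univ.filter fun z : Sites 1 L => ¬ z.1 ≤ y ∧ σ z = 1).card := by
      rw [← h2, cnt_top, ← Finset.card_filter_add_card_filter_not (fun z : Sites 1 L => z.1 ≤ y),
        Finset.filter_filter, Finset.filter_filter, cnt]
      simp only [and_comm]
    have hc' : n - cnt y σ
        = (Finset.univ.filter fun z : Sites 1 L => ¬ z.1 ≤ y ∧ σ z = 1).card := by omega
    rw [hc', totalDepth_comp_perm, totalDepth, Finset.card_filter, ← Finset.sum_add_distrib]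
    refine Finset.sum_le_sum fun w _ => ?_
    rw [hπ, cyc_symm_val]
    rcases fin2_cases (σ w) with h5 | h5
    · simp [h5]
    · have h6 : w.1 ≠ y := by
        intro h6
        rw [← h6, st_coe, h5] at h3
        exact absurd h3 (by decide)
      have := w.2.2
      rw [h5, if_neg h6]
      by_cases h7 : w.1 ≤ y
      · rw [if_neg (by omega), if_neg (by tauto)]
        simp
      · rw [if_pos (by omega), if_pos ⟨h7, rfl⟩, depth, depth, if_neg (by omega),
          if_neg (by omega)]
        simp; omega

/-- The mirror image of `hole_left` for an up spin to the right of the cut. -/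
theorem hole_right {q : ℝ} (hq0 : 0 < q) (hq1 : q < 1) {x : ℤ} (hx : 0 ≤ x) (k n : ℕ) {j : ℕ}
    (hj : x + 1 + j ≤ L) :
    wsum (L := L) q x (fun σ => InSec x k n σ ∧ σ (st L (x + 1 + j)) = 0)
      ≤ (q ^ (n - k - j)) ^ 2 * wsum (L := L) q x (InSec x k n) := by
  refine wsum_le_of_perm hq0 hq1 (cyc (L := L) (x + 1 + j) L (by omega) hj le_rfl) (n - k - j)
    fun σ hσ => ?_
  have h := shift_right hx (by omega : x < x + 1 + j) hj hσ.1 hσ.2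
  refine ⟨h.1, le_trans ?_ h.2⟩
  have h8 := cnt_le_add (L := L) (x := x) (y := x + j) (by omega) (by omega) (by omega) σ
  have h9 := cnt_succ (L := L) (x := x + j) (by omega) (by omega) σ
  rw [show x + (j : ℤ) + 1 = x + 1 + j by ring, hσ.2] at h9
  simp only [Fin.val_zero, add_zero] at h9
  have := hσ.1.1
  omega

/-- The weight of the event that the first `s` sites to the right of the cut are all up. -/
theorem holes_right {q : ℝ} (hq0 : 0 < q) (hq1 : q < 1) {x : ℤ} (hx : 0 ≤ x) (k n : ℕ) (s : ℕ)
    (hs : x + s ≤ L) :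
    wsum (L := L) q x (fun σ => InSec x k n σ ∧ ∀ z, x < z → z ≤ x + s → σ (st L z) = 0)
      ≤ (q ^ ((n - k) * s)) ^ 2 * wsum (L := L) q x (InSec x k n) := by
  induction s with
  | zero =>
    simp only [Nat.cast_zero, mul_zero, pow_zero, one_pow, one_mul]
    exact wsum_mono fun σ h => h.1
  | succ s ih =>
    have h1 : wsum (L := L) q x
        (fun σ => InSec x k n σ ∧ ∀ z, x < z → z ≤ x + (s + 1 : ℕ) → σ (st L z) = 0)
        ≤ (q ^ (n - k)) ^ 2 * wsum (L := L) q x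
          (fun σ => InSec x k n σ ∧ ∀ z, x < z → z ≤ x + s → σ (st L z) = 0) := by
      push_cast at hs ⊢
      refine wsum_le_of_perm hq0 hq1 (cyc (L := L) (x + 1) L (by omega) (by omega) le_rfl) (n - k)
        fun σ hσ => ?_
      have h0 : σ (st L (x + 1)) = 0 := hσ.2 (x + 1) (by omega) (by omega)
      have h := shift_right hx (by omega : x < x + 1) (by omega) hσ.1 h0
      refine ⟨⟨h.1, fun z hz hz' => ?_⟩, le_trans ?_ h.2⟩
      · have hzv : (st L z).1 = z := st_val (by omega) (by omega)
        have : cyc (L := L) (x + 1) L (by omega) (by omega) le_rfl (st L z) = st L (z + 1) := by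
          apply Subtype.ext
          rw [cyc_val, hzv, st_val (by omega) (by omega), if_neg (by omega), if_pos (by omega)]
        rw [Function.comp_apply, this]
        exact hσ.2 (z + 1) (by omega) (by omega)
      · have h9 := cnt_succ (L := L) (x := x) (by omega) (by omega) σ
        rw [h0] at h9
        simp only [Fin.val_zero, add_zero] at h9
        have := hσ.1.1
        omega
    have h2 := ih (by push_cast at hs; omega)
    have h3 : (q ^ (n - k)) ^ 2 * wsum (L := L) q x
          (fun σ => InSec x k n σ ∧ ∀ z, x < z → z ≤ x + s → σ (st L z) = 0)
        ≤ (q ^ (n - k)) ^ 2 * ((q ^ ((n - k) * s)) ^ 2 * wsum (L := L) q x (InSec x k n)) := by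
      gcongr
    refine h1.trans (h3.trans (le_of_eq ?_))
    rw [mul_add, mul_one, pow_add]; ring

theorem sum_reflected_geom_le {Q : ℝ} (h0 : 0 < Q) (h1 : Q < 1) (M t : ℕ) :
    ∑ j ∈ Finset.range (M - t), Q ^ (M - j) ≤ Q ^ (t + 1) / (1 - Q) := by
  rw [← Finset.sum_range_reflect]
  have e : ∀ j ∈ Finset.range (M - t), Q ^ (M - (M - t - 1 - j)) = Q ^ (t + 1) * Q ^ j := by
    intro j hj
    rw [Finset.mem_range] at hj
    rw [← pow_add]; congr 1; omega
  rw [Finset.sum_congr rfl e, ← Finset.mul_sum, div_eq_mul_inv]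
  gcongr
  rw [geom_sum_eq h1.ne, ← neg_div_neg_eq, neg_sub, neg_sub, inv_eq_one_div]
  have : 0 < 1 - Q := by linarith
  gcongr
  have : 0 ≤ Q ^ (M - t) := by positivity
  linarith

omit [NeZero L] in
theorem wsum_exists_le {ι : Type*} (s : Finset ι) {q : ℝ} {x : ℤ} (P : Config 1 L → Prop)
    (R : ι → Config 1 L → Prop) :
    wsum q x (fun σ => P σ ∧ ∃ j ∈ s, R j σ) ≤ ∑ j ∈ s, wsum q x (fun σ => P σ ∧ R j σ) := by
  classical
  simp only [wsum]
  rw [Finset.sum_comm]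
  refine Finset.sum_le_sum fun σ _ => ?_
  split_ifs with h
  · obtain ⟨hP, j, hj, hR⟩ := h
    refine le_trans (le_of_eq ?_) (Finset.single_le_sum (fun j _ => ?_) hj)
    · rw [if_pos ⟨hP, hR⟩]
    · split_ifs <;> positivity
  · exact Finset.sum_nonneg fun j _ => by split_ifs <;> positivity

/-- Kink states are concentrated on the compact droplet: an up spin at distance more than `t` from
its ends has weight of order `q ^ (2 t)`. -/
theorem hole_tail {q : ℝ} (hq0 : 0 < q) (hq1 : q < 1) {x : ℤ} {k n : ℕ} (hk : (k : ℤ) ≤ x)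
    (hn : (n : ℤ) - k ≤ L - x) (hkn : k ≤ n) (t : ℕ) :
    wsum (L := L) q x (fun σ => InSec x k n σ ∧
        ∃ z, x - ((k - t : ℕ) : ℤ) < z ∧ z ≤ x + ((n - k - t : ℕ) : ℤ) ∧ σ (st L z) = 0)
      ≤ 2 * (q ^ (t + 1)) ^ 2 / (1 - q ^ 2) * wsum (L := L) q x (InSec x k n) := by
  set W := wsum (L := L) q x (InSec x k n) with hW
  have hW0 : 0 ≤ W := wsum_nonneg _ _ _
  have hQ0 : 0 < q ^ 2 := by positivity
  have hQ1 : q ^ 2 < 1 := by nlinarith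
  have h1 := wsum_exists_le (q := q) (x := x) (Finset.range (k - t)) (InSec (L := L) x k n)
    (fun j σ => σ (st L (x - j)) = 0)
  have h2 := wsum_exists_le (q := q) (x := x) (Finset.range (n - k - t)) (InSec (L := L) x k n)
    (fun j σ => σ (st L (x + 1 + j)) = 0)
  have hg : ∀ M : ℕ, ∑ j ∈ Finset.range (M - t), (q ^ (M - j)) ^ 2 * W
      ≤ (q ^ (t + 1)) ^ 2 / (1 - q ^ 2) * W := by
    intro M
    rw [← Finset.sum_mul]
    gcongr
    have := sum_reflected_geom_le hQ0 hQ1 M t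
    simp only [← pow_mul, mul_comm _ 2] at this ⊢
    exact this
  have h3 : wsum (L := L) q x (fun σ => InSec x k n σ ∧
        ∃ j ∈ Finset.range (k - t), σ (st L (x - (j : ℕ))) = 0)
      ≤ (q ^ (t + 1)) ^ 2 / (1 - q ^ 2) * W := by
    refine h1.trans (le_trans (Finset.sum_le_sum fun j hj => ?_) (hg k))
    rw [Finset.mem_range] at hj
    exact hole_left hq0 hq1 (by omega) k n (by omega)
  have h4 : wsum (L := L) q x (fun σ => InSec x k n σ ∧
        ∃ j ∈ Finset.range (n - k - t), σ (st L (x + 1 + (j : ℕ))) = 0)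
      ≤ (q ^ (t + 1)) ^ 2 / (1 - q ^ 2) * W := by
    refine h2.trans (le_trans (Finset.sum_le_sum fun j hj => ?_) (hg (n - k)))
    rw [Finset.mem_range] at hj
    exact hole_right hq0 hq1 (by omega) k n (by omega)
  have h5 := wsum_exists_le (q := q) (x := x) (Finset.univ : Finset Bool) (InSec (L := L) x k n)
    (fun b σ => cond b (∃ j ∈ Finset.range (k - t), σ (st L (x - (j : ℕ))) = 0)
      (∃ j ∈ Finset.range (n - k - t), σ (st L (x + 1 + (j : ℕ))) = 0))
  rw [Fintype.sum_bool] at h5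
  refine le_trans (wsum_mono ?_) (h5.trans ((add_le_add h3 h4).trans (le_of_eq (by ring))))
  rintro σ ⟨hs, z, hz1, hz2, hz3⟩
  refine ⟨hs, ?_⟩
  by_cases hzx : z ≤ x
  · refine ⟨true, Finset.mem_univ _, (x - z).toNat, ?_, ?_⟩
    · rw [Finset.mem_range]; omega
    · rw [show x - ((x - z).toNat : ℤ) = z by omega]; exact hz3
  · refine ⟨false, Finset.mem_univ _, (z - x - 1).toNat, ?_, ?_⟩
    · rw [Finset.mem_range]; omega
    · rw [show x + 1 + ((z - x - 1).toNat : ℤ) = z by omega]; exact hz3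

end Holes

section KinkNorm

variable {L : ℕ}

theorem norm_kinkPair_apply_sq (q : ℝ) (hq0 : 0 < q) (x : ℤ) (k n : ℕ) (σ : Config 1 L) :
    ‖kinkPair q x k n σ‖ ^ 2
      = open Classical in if InSec x k n σ then (q ^ totalDepth x σ) ^ 2 else 0 := by
  classical
  by_cases h : InSec x k n σ
  · rw [if_pos h, kinkPair_of_inSec h, Complex.norm_real, Real.norm_of_nonneg (by positivity)]
  · rw [if_neg h, kinkPair_of_not_inSec h]; simp

theorem norm_kinkPair_sq (q : ℝ) (hq0 : 0 < q) (x : ℤ) (k n : ℕ) :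
    ‖kinkPair (L := L) q x k n‖ ^ 2 = wsum (L := L) q x (InSec x k n) := by
  rw [norm_sq_eq_sum, wsum]
  exact Finset.sum_congr rfl fun σ _ => norm_kinkPair_apply_sq q hq0 x k n σ

/-- Norm of a kink pair damped by a function bounded by the indicator of `P`. -/
theorem norm_diag_kinkPair_sq_le (q : ℝ) (hq0 : 0 < q) (x : ℤ) (k n : ℕ) {f : Config 1 L → ℝ}
    {P : Config 1 L → Prop} (hf : ∀ σ, |f σ| ≤ 1)
    (hP : ∀ σ, InSec x k n σ → f σ ≠ 0 → P σ) :
    ‖diag f (kinkPair q x k n)‖ ^ 2 ≤ wsum q x (fun σ => InSec x k n σ ∧ P σ) := by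
  classical
  rw [norm_sq_eq_sum, wsum]
  refine Finset.sum_le_sum fun σ _ => ?_
  rw [diag_apply, norm_mul, mul_pow, norm_kinkPair_apply_sq q hq0, Complex.norm_real,
    Real.norm_eq_abs]
  by_cases h : InSec x k n σ
  · by_cases h0 : f σ = 0
    · rw [h0]; simp; split_ifs <;> positivity
    · rw [if_pos h, if_pos ⟨h, hP σ h h0⟩]
      have : |f σ| ^ 2 ≤ 1 := pow_le_one₀ (abs_nonneg _) (hf σ)
      nlinarith [sq_nonneg (q ^ totalDepth x σ)]
  · rw [if_neg h]; split_ifs <;> (simp; try positivity)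

theorem inner_diag_comm (f : Config 1 L → ℝ) (φ χ : Space 1 L) :
    inner ℂ (diag f φ) χ = inner ℂ φ (diag f χ) := by
  rw [inner_eq_sum, inner_eq_sum]
  refine Finset.sum_congr rfl fun σ _ => ?_
  rw [diag_apply, diag_apply, map_mul, Complex.conj_ofReal]; ring

end KinkNorm

/-! ### Localization in the interior of a droplet -/

section Block

variable {L : ℕ} [NeZero L]

/-- There is a cut with `k` down spins to its left which is surrounded by `r` down spins on each
side. -/
def Block (k r : ℕ) (σ : Config 1 L) : Prop :=
  ∃ x : ℤ, (r : ℤ) ≤ x ∧ x + r ≤ L ∧ cnt x σ = k ∧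
    ∀ z, x - r < z → z ≤ x + r → σ (st L z) = 1

theorem Block.mono {k r s : ℕ} {σ : Config 1 L} (h : Block k r σ) (hs : s ≤ r) :
    Block k s σ := by
  obtain ⟨x, h1, h2, h3, h4⟩ := h
  exact ⟨x, by omega, by omega, h3, fun z hz hz' => h4 z (by omega) (by omega)⟩

/-- An exchange of neighbours shrinks a block by at most one site on each side. -/
theorem Block.hop {k r : ℕ} {σ : Config 1 L} (h : Block k (r + 1) σ) (hr : 1 ≤ r) {i : ℤ}
    (hi : i ∈ Finset.Ico (1 : ℤ) L) (hne : σ (st L i) ≠ σ (st L (i + 1))) :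
    Block k r (sw i σ) := by
  obtain ⟨x, h1, h2, h3, h4⟩ := h
  rw [Finset.mem_Ico] at hi
  push_cast at h1 h2 h4
  refine ⟨x, by omega, by omega, ?_, fun z hz hz' => ?_⟩
  · rw [cnt_sw hi.1 hi.2, h3]
    rintro rfl
    exact hne ((h4 i (by omega) (by omega)).trans (h4 (i + 1) (by omega) (by omega)).symm)
  · have hzi : z ≠ i := by
      rintro rfl
      exact hne ((h4 z (by omega) (by omega)).trans (h4 (z + 1) (by omega) (by omega)).symm)
    have hzi' : z ≠ i + 1 := by
      rintro rfl
      exact hne ((h4 i (by omega) (by omega)).trans (h4 (i + 1) (by omega) (by omega)).symm)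
    rw [sw_st_of_ne hi.1 hi.2 (by omega) (by omega) hzi hzi']
    exact h4 z (by omega) (by omega)

open Classical in
/-- The largest `r ≤ R` with `Block k r`, or `0`. -/
noncomputable def rad (R k : ℕ) (σ : Config 1 L) : ℕ :=
  Nat.findGreatest (fun r => Block k r σ) R

open Classical in
theorem rad_le (R k : ℕ) (σ : Config 1 L) : rad R k σ ≤ R := Nat.findGreatest_le R

open Classical in
theorem block_rad {R k : ℕ} {σ : Config 1 L} (h : rad R k σ ≠ 0) : Block k (rad R k σ) σ :=
  Nat.findGreatest_of_ne_zero (P := fun r => Block k r σ) rfl h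

open Classical in
theorem le_rad {R k r : ℕ} {σ : Config 1 L} (hr : r ≤ R) (h : Block k r σ) : r ≤ rad R k σ :=
  Nat.le_findGreatest hr h

theorem rad_hop_le {R k : ℕ} {σ : Config 1 L} {i : ℤ} (hi : i ∈ Finset.Ico (1 : ℤ) L)
    (hne : σ (st L i) ≠ σ (st L (i + 1))) : rad R k σ ≤ rad R k (sw i σ) + 1 := by
  by_cases h : rad R k σ ≤ 1
  · omega
  · have h1 := block_rad (R := R) (k := k) (σ := σ) (by omega)
    obtain ⟨r, hr⟩ : ∃ r, rad R k σ = r + 1 := ⟨rad R k σ - 1, by omega⟩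
    have h3 := rad_le R k σ
    rw [hr] at h1
    have h2 := le_rad (R := R) (by omega) (h1.hop (by omega) hi hne)
    omega

/-- The phase of the localization functions `sin` and `cos`, which increases from `0` to `π / 2`
with the size of the block around the cut. -/
noncomputable def angle (R k : ℕ) (σ : Config 1 L) : ℝ :=
  Real.pi / 2 * ((rad R k σ : ℝ) / R)

theorem angle_hop {R k : ℕ} (hR : 1 ≤ R) {σ : Config 1 L} {i : ℤ}
    (hi : i ∈ Finset.Ico (1 : ℤ) L) (hne : σ (st L i) ≠ σ (st L (i + 1))) :
    |angle R k σ - angle R k (sw i σ)| ≤ Real.pi / 2 / R := by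
  have hR0 : (0 : ℝ) < R := by exact_mod_cast hR
  have h1 := rad_hop_le (R := R) (k := k) hi hne
  have h2 := rad_hop_le (R := R) (k := k) (σ := sw i σ) hi (by simpa using hne.symm)
  rw [sw_sw] at h2
  have h1' : (rad R k σ : ℝ) ≤ rad R k (sw i σ) + 1 := by exact_mod_cast h1
  have h2' : (rad R k (sw i σ) : ℝ) ≤ rad R k σ + 1 := by exact_mod_cast h2
  have e : angle R k σ - angle R k (sw i σ)
      = Real.pi / 2 / R * ((rad R k σ : ℝ) - rad R k (sw i σ)) := by
    unfold angle; field_simp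
  have hp : 0 ≤ Real.pi / 2 / R := by have := Real.pi_pos; positivity
  rw [e, abs_mul, abs_of_nonneg hp]
  have : |(rad R k σ : ℝ) - rad R k (sw i σ)| ≤ 1 := abs_le.2 ⟨by linarith, by linarith⟩
  nlinarith

theorem rad_ne_zero_of_sin {R k : ℕ} {σ : Config 1 L} (h : Real.sin (angle R k σ) ≠ 0) :
    rad R k σ ≠ 0 := by
  intro h0
  apply h
  simp [angle, h0]

theorem rad_lt_of_cos {R k : ℕ} (hR : 1 ≤ R) {σ : Config 1 L}
    (h : Real.cos (angle R k σ) ≠ 0) : rad R k σ < R := by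
  refine lt_of_le_of_ne (rad_le R k σ) fun h0 => h ?_
  have hR0 : (R : ℝ) ≠ 0 := by exact_mod_cast (by omega : R ≠ 0)
  rw [angle, h0, div_self hR0, mul_one, Real.cos_pi_div_two]

/-- The localization error of one cut. -/
noncomputable def locErr (q : ℝ) (R : ℕ) : ℝ := wa q * wb q * ((Real.pi / 2 / R) ^ 2 / 2)

/-- Localization in the size of the block around the cut: `sin` and `cos` form a quadratic partition
of unity, whose phase changes by at most `π / (2 R)` under an exchange of neighbours. -/
theorem energy_split {q : ℝ} (hq0 : 0 < q) {R : ℕ} (hR : 1 ≤ R) (k : ℕ) (φ : Space 1 L) :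
    energy q (diag (fun σ => Real.sin (angle R k σ)) φ)
        + energy q (diag (fun σ => Real.cos (angle R k σ)) φ)
      ≤ energy q φ + locErr q R * ∑ σ, (walls σ : ℝ) * ‖φ σ‖ ^ 2 := by
  have h := sum_energy_le (Finset.univ : Finset Bool) hq0 φ
    (fun b σ => cond b (Real.sin (angle R k σ)) (Real.cos (angle R k σ)))
    (ε := (Real.pi / 2 / R) ^ 2 / 2) (by positivity) (fun σ _ => by simp)
    (fun i hi σ hne _ _ => by
      simp only [Fintype.sum_bool, cond_true, cond_false]
      have e : Real.sin (angle R k σ) * Real.sin (angle R k (sw i σ))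
          + Real.cos (angle R k σ) * Real.cos (angle R k (sw i σ))
          = Real.cos (angle R k σ - angle R k (sw i σ)) := by rw [Real.cos_sub]; ring
      rw [e, abs_of_nonneg (by linarith [Real.cos_le_one (angle R k σ - angle R k (sw i σ))])]
      have h1 := Real.one_sub_sq_div_two_le_cos (x := angle R k σ - angle R k (sw i σ))
      have h2 := angle_hop (k := k) hR hi hne
      have h3 : (angle R k σ - angle R k (sw i σ)) ^ 2 ≤ (Real.pi / 2 / R) ^ 2 := by
        rw [← sq_abs]; gcongr
      linarith)
  simpa [Fintype.sum_bool, locErr] using h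

omit [NeZero L] in
theorem norm_diag_sin_cos (θ : Config 1 L → ℝ) (φ : Space 1 L) :
    ‖diag (fun σ => Real.sin (θ σ)) φ‖ ^ 2 + ‖diag (fun σ => Real.cos (θ σ)) φ‖ ^ 2
      = ‖φ‖ ^ 2 := by
  simp only [norm_sq_eq_sum, ← Finset.sum_add_distrib]
  refine Finset.sum_congr rfl fun σ _ => ?_
  simp only [diag_apply, norm_mul, mul_pow, Complex.norm_real, Real.norm_eq_abs, sq_abs]
  rw [← add_mul, Real.sin_sq_add_cos_sq, one_mul]

/-- The down spin number `k` sits at `x` and its right neighbour is down as well. -/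
def CutAt (k : ℕ) (x : ℤ) (σ : Config 1 L) : Prop :=
  cnt x σ = k ∧ σ (st L x) = 1 ∧ σ (st L (x + 1)) = 1

theorem CutAt.unique {k : ℕ} {x y : ℤ} {σ : Config 1 L} (hy : 1 ≤ y)
    (hy' : y < L) (h : cnt x σ = k) (h2 : CutAt k y σ) : y = x := by
  rcases lt_trichotomy y x with hlt | he | hgt
  · have h3 := cnt_lt (x := y) (y := y + 1) (by omega) (by omega) (by omega) h2.2.2
    have h4 := cnt_mono (show y + 1 ≤ x by omega) σ
    have := h2.1
    omega
  · exact he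
  · have h3 := cnt_lt hgt hy hy'.le h2.2.1
    have := h2.1
    omega

theorem CutAt.hop {k : ℕ} {x i : ℤ} {σ : Config 1 L} (h : CutAt k x σ)
    (hi : i ∈ Finset.Ico (1 : ℤ) L) (hne : σ (st L i) ≠ σ (st L (i + 1))) :
    cnt x (sw i σ) = k := by
  rw [Finset.mem_Ico] at hi
  rw [cnt_sw hi.1 hi.2, h.1]
  rintro rfl
  exact hne (h.2.1.trans h.2.2.symm)

theorem Block.exists_cutAt {k : ℕ} {σ : Config 1 L} (h : Block k 1 σ) :
    ∃ x ∈ Finset.Ico (1 : ℤ) L, CutAt k x σ := by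
  obtain ⟨x, h1, h2, h3, h4⟩ := h
  push_cast at h1 h2 h4
  exact ⟨x, Finset.mem_Ico.2 ⟨h1, by omega⟩, h3, h4 x (by omega) (by omega),
    h4 (x + 1) (by omega) (by omega)⟩

open Classical in
/-- The indicator function of a property of configurations. -/
noncomputable def ind (P : Config 1 L → Prop) (σ : Config 1 L) : ℝ := if P σ then 1 else 0

/-- The normalized kink pair; zero when the sector is empty. -/
noncomputable def kinkHat (q : ℝ) (x : ℤ) (k n : ℕ) : Space 1 L :=
  ((‖kinkPair (L := L) q x k n‖⁻¹ : ℝ) : ℂ) • kinkPair q x k n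

omit [NeZero L] in
theorem norm_kinkHat_le (q : ℝ) (x : ℤ) (k n : ℕ) : ‖kinkHat (L := L) q x k n‖ ≤ 1 := by
  rw [kinkHat, norm_smul, Complex.norm_real, Real.norm_of_nonneg (by positivity)]
  exact inv_mul_le_one

omit [NeZero L] in
/-- Norm bound for a damped normalized kink pair, from a bound on the weight of an event. -/
theorem norm_diag_kinkHat_sq_le {q : ℝ} (hq0 : 0 < q) (x : ℤ) (k n : ℕ) {f : Config 1 L → ℝ}
    {P : Config 1 L → Prop} {κ : ℝ} (hκ : 0 ≤ κ) (hf : ∀ σ, |f σ| ≤ 1)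
    (hP : ∀ σ, InSec x k n σ → f σ ≠ 0 → P σ)
    (hw : wsum q x (fun σ => InSec x k n σ ∧ P σ) ≤ κ * wsum (L := L) q x (InSec x k n)) :
    ‖diag f (kinkHat q x k n)‖ ^ 2 ≤ κ := by
  have h1 := (norm_diag_kinkPair_sq_le q hq0 x k n hf hP).trans hw
  rw [← norm_kinkPair_sq q hq0] at h1
  rw [kinkHat, map_smul, norm_smul, mul_pow, Complex.norm_real, Real.norm_eq_abs, sq_abs, inv_pow]
  calc _ ≤ (‖kinkPair (L := L) q x k n‖ ^ 2)⁻¹ * (κ * ‖kinkPair (L := L) q x k n‖ ^ 2) := by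
        gcongr
    _ = κ * ((‖kinkPair (L := L) q x k n‖ ^ 2)⁻¹ * ‖kinkPair (L := L) q x k n‖ ^ 2) := by ring
    _ ≤ κ * 1 := by gcongr; exact inv_mul_le_one
    _ = κ := mul_one _

/-- Normalized form of the spectral gap of a cut chain. -/
theorem cutOp_gap_kinkHat {q : ℝ} (hq0 : 0 < q) (hq1 : q < 1) {x : ℤ} {k n : ℕ} {φ : Space 1 L}
    (hφ : SuppOn (InSec x k n) φ) :
    gam q * (‖φ‖ ^ 2 - ‖inner ℂ (kinkHat q x k n) φ‖ ^ 2) ≤ (inner ℂ φ (cutOp q x φ)).re := by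
  by_cases h0 : φ = 0
  · simp [h0]
  have hne : ∃ σ, φ σ ≠ 0 := by
    by_contra hc; push Not at hc
    exact h0 (by ext σ; simpa using hc σ)
  obtain ⟨σ, hσ⟩ := hne
  have hN : 0 < ‖kinkPair (L := L) q x k n‖ ^ 2 := by
    have h1 : kinkPair (L := L) q x k n σ ≠ 0 := by
      rw [kinkPair_of_inSec (hφ σ hσ)]
      exact Complex.ofReal_ne_zero.2 (pow_pos hq0 _).ne'
    have h2 : kinkPair (L := L) q x k n ≠ 0 := fun h => h1 (by rw [h]; rfl)
    have := norm_pos_iff.2 h2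
    positivity
  have h := cutOp_gap hq0 hq1 hφ
  have e : ‖inner ℂ (kinkHat q x k n) φ‖ ^ 2
      = (‖kinkPair (L := L) q x k n‖ ^ 2)⁻¹ * ‖inner ℂ (kinkPair q x k n) φ‖ ^ 2 := by
    rw [kinkHat, inner_smul_left, Complex.conj_ofReal, norm_mul, mul_pow, Complex.norm_real,
      Real.norm_eq_abs, sq_abs, inv_pow]
  rw [e]
  set N := ‖kinkPair (L := L) q x k n‖ ^ 2
  have h3 := mul_le_mul_of_nonneg_left h (inv_pos.2 hN).le
  rw [← mul_assoc N⁻¹ N, inv_mul_cancel₀ hN.ne', one_mul] at h3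
  refine le_trans (le_of_eq ?_) h3
  field_simp

/-- The coupling vanishes on states whose spins next to the cut are both down. -/
theorem energy_eq_cut {q : ℝ} (hq0 : 0 < q) (hq1 : q < 1) {x : ℤ} (hx : 1 ≤ x) (hx' : x < L)
    {φ : Space 1 L} (hφ : SuppOn (fun σ => σ (st L x) = 1 ∧ σ (st L (x + 1)) = 1) φ) :
    energy q φ = 2 * fA q * ‖φ‖ ^ 2 + (inner ℂ φ (cutOp q x φ)).re := by
  have hs : seamOp q x φ = 0 := by
    ext σ
    rw [seamOp_apply]
    by_cases h : σ (st L x) = σ (st L (x + 1))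
    · rw [bondAmp, if_pos h]
      by_cases h1 : φ σ = 0
      · rw [h1]; simp
      · rw [dn_of_one (hφ σ h1).1, dn_of_one (hφ σ h1).2]; norm_num
    · have h1 : φ σ = 0 := by
        by_contra hc; exact h ((hφ σ hc).1.trans (hφ σ hc).2.symm)
      have h2 : φ (sw x σ) = 0 := by
        by_contra hc
        have := hφ _ hc
        simp only [sw_left, sw_right] at this
        exact h (this.2.trans this.1.symm)
      rw [bondAmp, if_neg h, h1, h2]; simp
  rw [energy_eq hq0 hq1 rfl, droplet_eq_cut hq0 hq1 rfl hx hx', hs, add_zero, inner_add_right,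
    inner_smul_right, inner_self_eq_norm_sq_to_K, Complex.add_re]
  have : ((fA q : ℂ) * ((‖φ‖ : ℂ)) ^ 2).re = fA q * ‖φ‖ ^ 2 := by
    rw [← Complex.ofReal_pow, ← Complex.ofReal_mul, Complex.ofReal_re]
  erw [this]
  ring

/-- A state with a cut inside a cluster of down spins behind the `k`-th down spin decouples into two
kink chains, and inherits their gap. -/
theorem energy_block_ge {q : ℝ} (hq0 : 0 < q) (hq1 : q < 1) {k n : ℕ} {φ : Space 1 L}
    (hφ : SuppOn (fun σ => cnt L σ = n ∧ Block k 1 σ) φ) :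
    (2 * fA q + gam q) * ‖φ‖ ^ 2 - gam q * ∑ x ∈ Finset.Ico (1 : ℤ) L,
        ‖inner ℂ (kinkHat q x k n) (diag (ind (CutAt k x)) φ)‖ ^ 2 ≤ energy q φ ∧
      ∑ x ∈ Finset.Ico (1 : ℤ) L, ‖diag (ind (CutAt k x)) φ‖ ^ 2 = ‖φ‖ ^ 2 := by
  classical
  have hone : ∀ σ : Config 1 L, ∀ x ∈ Finset.Ico (1 : ℤ) L, cnt x σ = k →
      ∀ f : ℤ → ℝ, (∀ y ∈ Finset.Ico (1 : ℤ) L, ¬ CutAt k y σ → f y = 0) →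
      ∑ y ∈ Finset.Ico (1 : ℤ) L, f y = f x := by
    intro σ x hx h f hf
    refine Finset.sum_eq_single x (fun y hy hne => hf y hy fun hc => hne ?_)
      (fun hc => absurd hx hc)
    rw [Finset.mem_Ico] at hy
    exact CutAt.unique hy.1 hy.2 h hc
  have hsq : ∀ σ, φ σ ≠ 0 → ∑ x ∈ Finset.Ico (1 : ℤ) L, ind (CutAt k x) σ ^ 2 = 1 := by
    intro σ hσ
    obtain ⟨x, hx, hc⟩ := (hφ σ hσ).2.exists_cutAt
    rw [hone σ x hx hc.1 (fun x => ind (CutAt k x) σ ^ 2) (fun y _ h => by simp [ind, h])]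
    simp [ind, hc]
  have hnorm : ∑ x ∈ Finset.Ico (1 : ℤ) L, ‖diag (ind (CutAt k x)) φ‖ ^ 2 = ‖φ‖ ^ 2 := by
    simp only [norm_sq_eq_sum]
    rw [Finset.sum_comm]
    refine Finset.sum_congr rfl fun σ _ => ?_
    simp only [diag_apply, norm_mul, mul_pow, Complex.norm_real, Real.norm_eq_abs, sq_abs]
    by_cases h : φ σ = 0
    · simp [h]
    · rw [← Finset.sum_mul, hsq σ h, one_mul]
  refine ⟨?_, hnorm⟩
  have h := sum_energy_le (Finset.Ico (1 : ℤ) L) hq0 φ (fun x => ind (CutAt k x)) (ε := 0) le_rfl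
    hsq (fun i hi σ hne h1 h2 => by
      obtain ⟨x, hx, hc⟩ := (hφ σ h1).2.exists_cutAt
      obtain ⟨y, hy, hc'⟩ := (hφ _ h2).2.exists_cutAt
      have hcx := hc.hop hi hne
      have hyx : y = x := by
        rw [Finset.mem_Ico] at hy
        exact CutAt.unique hy.1 hy.2 hcx hc'
      subst hyx
      rw [hone σ y hx hc.1 (fun x => ind (CutAt k x) σ * ind (CutAt k x) (sw i σ))
        (fun z _ h => by simp [ind, h])]
      simp [ind, hc, hc'])
  rw [mul_zero, zero_mul, add_zero] at h
  refine le_trans ?_ h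
  rw [← hnorm, Finset.mul_sum, Finset.mul_sum, ← Finset.sum_sub_distrib]
  refine Finset.sum_le_sum fun x hx => ?_
  rw [Finset.mem_Ico] at hx
  have hsupp : ∀ σ, diag (ind (CutAt k x)) φ σ ≠ 0 → CutAt k x σ ∧ φ σ ≠ 0 := by
    intro σ hσ
    rw [diag_apply] at hσ
    refine ⟨?_, right_ne_zero_of_mul hσ⟩
    by_contra hc
    apply left_ne_zero_of_mul hσ
    simp [ind, hc]
  rw [energy_eq_cut hq0 hq1 hx.1 hx.2 (fun σ hσ => (hsupp σ hσ).1.2)]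
  have hg := cutOp_gap_kinkHat hq0 hq1 (x := x) (k := k) (n := n)
    (φ := diag (ind (CutAt k x)) φ)
    (fun σ hσ => ⟨(hsupp σ hσ).1.1, (hφ σ (hsupp σ hσ).2).1⟩)
  linarith

/-- A nearly compact droplet contains a large block around each of its inner cuts. -/
theorem block_of_full {x : ℤ} {k n m R : ℕ} {σ : Config 1 L} (hσ : InSec x k n σ)
    (hk : (k : ℤ) ≤ x) (hn : (n : ℤ) - k ≤ L - x) (hkn : k ≤ n)
    (hR : R ≤ m) (hm : 2 * m ≤ n)
    (hfull : ∀ z, x - ((k - (m - R) : ℕ) : ℤ) < z → z ≤ x + ((n - k - (m - R) : ℕ) : ℤ) →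
      σ (st L z) = 1) : Block m R σ := by
  refine ⟨x - k + m, by omega, by omega, ?_, fun z hz hz' => hfull z (by omega) (by omega)⟩
  have h1 := hσ.1
  rcases le_total ((x : ℤ) - k + m) x with h | h
  · have := cnt_eq_add_of_down h (by omega) (by omega) (σ := σ)
      (fun z hz hz' => hfull z (by omega) (by omega))
    omega
  · have := cnt_eq_add_of_down h (by omega) (by omega) (σ := σ)
      (fun z hz hz' => hfull z (by omega) (by omega))
    omega

theorem inSec_bounds {x : ℤ} {k n : ℕ} {σ : Config 1 L} (h : InSec x k n σ) (h0 : 0 ≤ x)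
    (hL : x ≤ L) : (k : ℤ) ≤ x ∧ (n : ℤ) - k ≤ L - x ∧ k ≤ n := by
  obtain ⟨h1, h2⟩ := h
  have h3 := cnt_le_add (L := L) (x := 0) (y := x) h0 le_rfl hL σ
  have h4 := cnt_le_add (L := L) (x := x) (y := L) hL h0 le_rfl σ
  have h5 := cnt_of_nonpos (x := 0) le_rfl σ
  have h6 := cnt_mono hL σ
  omega

/-- The weight of the tail event in `hole_tail`. -/
noncomputable def tailErr (q : ℝ) (t : ℕ) : ℝ := 2 * (q ^ (t + 1)) ^ 2 / (1 - q ^ 2)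

theorem tailErr_nonneg {q : ℝ} (hq0 : 0 < q) (hq1 : q < 1) (t : ℕ) : 0 ≤ tailErr q t := by
  have : q ^ 2 < 1 := by nlinarith
  have : 0 < 1 - q ^ 2 := by linarith
  unfold tailErr; positivity

/-- Kink pairs with any cut have small weight on configurations without a large block at `m`. -/
theorem norm_diag_kinkHat_rad {q : ℝ} (hq0 : 0 < q) (hq1 : q < 1) {x : ℤ} (h0 : 0 ≤ x)
    (hL : x ≤ L) {k n m R : ℕ} (hR : R ≤ m) (hm : 2 * m ≤ n) {f : Config 1 L → ℝ}
    (hf : ∀ σ, |f σ| ≤ 1) (hP : ∀ σ, InSec x k n σ → f σ ≠ 0 → rad R m σ < R) :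
    ‖diag f (kinkHat q x k n)‖ ^ 2 ≤ tailErr q (m - R) := by
  by_cases hne : ∃ σ : Config 1 L, InSec x k n σ
  · obtain ⟨σ₀, hσ₀⟩ := hne
    obtain ⟨hk, hn, hkn⟩ := inSec_bounds hσ₀ h0 hL
    refine norm_diag_kinkHat_sq_le hq0 x k n (tailErr_nonneg hq0 hq1 _) hf ?_
      (hole_tail hq0 hq1 hk hn hkn (m - R))
    intro σ hσ hfσ
    by_contra hc
    push Not at hc
    have hb := block_of_full hσ hk hn hkn hR hm fun z hz hz' => by
      rcases fin2_cases (σ (st L z)) with h | h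
      · exact absurd h (hc z hz hz')
      · exact h
    have h1 := le_rad le_rfl hb
    have h2 := hP σ hσ hfσ
    omega
  · rw [kinkHat, kinkPair_eq_zero hne]
    simpa using tailErr_nonneg hq0 hq1 _

end Block

/-! ### Counting domain walls -/

section Walls

variable {L : ℕ} [NeZero L]

theorem exists_site_of_cnt {k : ℕ} {σ : Config 1 L} (hk : 1 ≤ k) (hkL : k ≤ cnt L σ) :
    ∃ x : ℤ, 1 ≤ x ∧ x ≤ L ∧ cnt x σ = k ∧ σ (st L x) = 1 := by
  classical
  have hex : ∃ x : ℕ, k ≤ cnt (x : ℤ) σ := ⟨L, hkL⟩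
  set x := Nat.find hex with hx
  have h1 : k ≤ cnt (x : ℤ) σ := Nat.find_spec hex
  have h2 : x ≤ L := Nat.find_min' hex hkL
  have h3 : 1 ≤ x := by
    by_contra hc
    have : cnt (x : ℤ) σ = 0 := cnt_of_nonpos (by omega) σ
    omega
  have h4 : ¬ k ≤ cnt ((x - 1 : ℕ) : ℤ) σ := Nat.find_min hex (by omega)
  have h5 := cnt_succ (L := L) (x := ((x - 1 : ℕ) : ℤ)) (by omega) (by omega) σ
  rw [show ((x - 1 : ℕ) : ℤ) + 1 = x by omega] at h5
  rcases fin2_cases (σ (st L x)) with h6 | h6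
  · rw [h6] at h5; simp at h5; omega
  · rw [h6] at h5
    have e : ((1 : Fin 2) : ℕ) = 1 := rfl
    exact ⟨x, by omega, by omega, by omega, h6⟩

theorem exists_wall {a b : ℤ} (hab : a ≤ b) {σ : Config 1 L} (h : σ (st L a) ≠ σ (st L b)) :
    ∃ i, a ≤ i ∧ i < b ∧ σ (st L i) ≠ σ (st L (i + 1)) := by
  induction b, hab using Int.leInduction with
  | base => exact absurd rfl h
  | succ b hab ih =>
    by_cases h1 : σ (st L a) = σ (st L b)
    · exact ⟨b, hab, by omega, by rwa [← h1]⟩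
    · obtain ⟨i, h2, h3, h4⟩ := ih h1
      exact ⟨i, h2, by omega, h4⟩

/-- If none of `N` well separated cuts lies deep inside a cluster, there are `N` domain walls. -/
theorem le_walls {R N n : ℕ} (hR : 1 ≤ R) (hn : 2 * R * N ≤ n) {σ : Config 1 L}
    (hσ : cnt L σ = n) (hb : ∀ j < N, ¬ Block (2 * R * j + R) R σ) : N ≤ walls σ := by
  have hex : ∀ j, j < N → ∃ x w : ℤ, cnt x σ = 2 * R * j + R ∧ 1 ≤ x ∧ x ≤ L ∧ x - R < w ∧
      w < x + R ∧ w ∈ (Finset.Ico (1 : ℤ) L).filter fun i => σ (st L i) ≠ σ (st L (i + 1)) := by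
    intro j hj
    have hjN : 2 * R * j + 2 * R ≤ n := by
      have : 2 * R * (j + 1) ≤ 2 * R * N := Nat.mul_le_mul_left _ hj
      linarith
    obtain ⟨x, h1, h2, h3, h4⟩ := exists_site_of_cnt (k := 2 * R * j + R) (σ := σ) (by omega)
      (by omega)
    have h5 := cnt_le_add (L := L) (x := 0) (y := x) (by omega) le_rfl h2 σ
    have h6 := cnt_le_add (L := L) (x := x) (y := L) h2 (by omega) le_rfl σ
    have h7 := cnt_of_nonpos (x := 0) le_rfl σ
    have hx1 : (R : ℤ) ≤ x := by
      have : (R : ℤ) ≤ (2 * R * j + R : ℕ) := by exact_mod_cast Nat.le_add_left _ _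
      omega
    have hx2 : x + R ≤ L := by
      have : ((2 * R * j + 2 * R : ℕ) : ℤ) ≤ n := by exact_mod_cast hjN
      push_cast at this
      rw [h3, hσ] at h6
      push_cast at h6
      linarith
    have hz : ∃ z, x - R < z ∧ z ≤ x + R ∧ σ (st L z) ≠ 1 := by
      by_contra hc
      push Not at hc
      exact hb j hj ⟨x, hx1, hx2, h3, hc⟩
    obtain ⟨z, hz1, hz2, hz3⟩ := hz
    rcases le_total x z with h | h
    · obtain ⟨i, hi1, hi2, hi3⟩ := exists_wall h (σ := σ) (by rw [h4]; exact Ne.symm hz3)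
      exact ⟨x, i, h3, h1, h2, by omega, by omega, Finset.mem_filter.2
        ⟨Finset.mem_Ico.2 ⟨by omega, by omega⟩, hi3⟩⟩
    · obtain ⟨i, hi1, hi2, hi3⟩ := exists_wall h (σ := σ) (by rw [h4]; exact hz3)
      exact ⟨x, i, h3, h1, h2, by omega, by omega, Finset.mem_filter.2
        ⟨Finset.mem_Ico.2 ⟨by omega, by omega⟩, hi3⟩⟩
  choose! x w h1 h2 h3 h4 h5 h6 using hex
  have hlt : ∀ i j, i < j → j < N → w i < w j := by
    intro i j hij hj
    have hi : i < N := hij.trans hj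
    have e : 2 * R * i + 2 * R ≤ 2 * R * j := by
      have : 2 * R * (i + 1) ≤ 2 * R * j := Nat.mul_le_mul_left _ hij
      linarith
    have hx : x i ≤ x j := by
      by_contra hc
      have := cnt_mono (show x j ≤ x i by omega) σ
      rw [h1 i hi, h1 j hj] at this
      omega
    have h7 := cnt_le_add (L := L) hx (by have := h2 i hi; omega) (h3 j hj) σ
    rw [h1 i hi, h1 j hj] at h7
    have e' : ((2 * R * i + 2 * R : ℕ) : ℤ) ≤ (2 * R * j : ℕ) := by exact_mod_cast e
    push_cast at e' h7
    have := h5 i hi; have := h4 j hj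
    linarith
  have hcard : (Finset.range N).card ≤ walls σ := by
    refine Finset.card_le_card_of_injOn w (fun j hj => h6 j (Finset.mem_range.1 hj)) ?_
    intro i hi j hj he
    rw [Finset.coe_range, Set.mem_Iio] at hi hj
    rcases lt_trichotomy i j with h | h | h
    · have := hlt i j h hj; omega
    · exact h
    · have := hlt j i h hi; omega
  rwa [Finset.card_range] at hcard

end Walls

/-! ### The energy gap above the droplet states -/

section DropletGap

variable {L : ℕ} [NeZero L]

omit [NeZero L] in
theorem sum_walls_diag_le {f : Config 1 L → ℝ} (hf : ∀ σ, |f σ| ≤ 1) (W : Config 1 L → ℕ)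
    (φ : Space 1 L) : ∑ σ, (W σ : ℝ) * ‖diag f φ σ‖ ^ 2 ≤ ∑ σ, (W σ : ℝ) * ‖φ σ‖ ^ 2 := by
  refine Finset.sum_le_sum fun σ _ => ?_
  gcongr
  rw [diag_apply, norm_mul, Complex.norm_real, Real.norm_eq_abs]
  have := hf σ
  nlinarith [norm_nonneg (φ σ)]

omit [NeZero L] in
theorem SuppOn.diag {P Q : Config 1 L → Prop} {φ : Space 1 L} (h : SuppOn P φ)
    {f : Config 1 L → ℝ} (hf : ∀ σ, f σ ≠ 0 → P σ → Q σ) : SuppOn Q (diag f φ) := by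
  intro σ hσ
  rw [diag_apply] at hσ
  exact hf σ (fun h0 => left_ne_zero_of_mul hσ (by simp [h0])) (h σ (right_ne_zero_of_mul hσ))

theorem locErr_nonneg {q : ℝ} (hq0 : 0 < q) (R : ℕ) : 0 ≤ locErr q R := by
  have := wa_pos hq0; have := wb_pos q
  unfold locErr; positivity

theorem SuppOn.block_of_sin {P : Config 1 L → Prop} {φ : Space 1 L} (h : SuppOn P φ) (R k : ℕ) :
    SuppOn (fun σ => P σ ∧ Block k 1 σ) (XXZ.diag (fun σ => Real.sin (angle R k σ)) φ) :=
  h.diag fun σ h0 hP => by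
    have h1 := rad_ne_zero_of_sin h0
    exact ⟨hP, (block_rad h1).mono (by omega)⟩

/-- States without a large block at the cut `m` have energy above the gap. The induction removes the
remaining `N` cuts one at a time: the part with a block at a cut is gapped and almost orthogonal to
the kink pairs there, and the part without any block has at least `N` domain walls. -/
theorem energy_ge_of_rad_lt {q : ℝ} (hq0 : 0 < q) (hq1 : q < 1) {R N n m : ℕ} (hR : 1 ≤ R)
    (hn : 2 * R * N ≤ n) (hRm : R ≤ m) (hm : 2 * m ≤ n)
    (hN : 2 * fA q + gam q ≤ gam q / 2 * N) (j : ℕ) (hj : j ≤ N) {φ : Space 1 L}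
    (hφ : SuppOn (fun σ => cnt L σ = n ∧ rad R m σ < R ∧
      ∀ i, j ≤ i → i < N → rad R (2 * R * i + R) σ < R) φ) :
    (2 * fA q + gam q - gam q * tailErr q (m - R)) * ‖φ‖ ^ 2
      ≤ energy q φ + j * locErr q R * ∑ σ, (walls σ : ℝ) * ‖φ σ‖ ^ 2 := by
  have hg := gam_pos hq1
  have hκ := tailErr_nonneg hq0 hq1 (m - R)
  induction j generalizing φ with
  | zero =>
    have h1 := energy_ge_walls hq0 hq1 φ
    have h2 : (N : ℝ) * ‖φ‖ ^ 2 ≤ ∑ σ, (walls σ : ℝ) * ‖φ σ‖ ^ 2 := by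
      rw [norm_sq_eq_sum, Finset.mul_sum]
      refine Finset.sum_le_sum fun σ _ => ?_
      by_cases h0 : φ σ = 0
      · simp [h0]
      · obtain ⟨h3, _, h4⟩ := hφ σ h0
        have : N ≤ walls σ := le_walls hR hn h3 fun i hi hb => by
          have := le_rad le_rfl hb
          have := h4 i (Nat.zero_le _) hi
          omega
        have : (N : ℝ) ≤ walls σ := by exact_mod_cast this
        gcongr
    have h3 : 0 ≤ ‖φ‖ ^ 2 := by positivity
    have h4 := mul_le_mul_of_nonneg_right hN h3
    have h5 := mul_le_mul_of_nonneg_left h2 (half_pos hg).le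
    have h6 : 0 ≤ gam q * tailErr q (m - R) * ‖φ‖ ^ 2 := by positivity
    simp only [Nat.cast_zero, zero_mul, add_zero]
    nlinarith
  | succ j ih =>
    set k := 2 * R * j + R with hk
    set s := diag (fun σ => Real.sin (angle R k σ)) φ with hs
    set c := diag (fun σ => Real.cos (angle R k σ)) φ with hc
    have h1 := energy_split hq0 hR k φ
    have h2 := norm_diag_sin_cos (angle R k) φ
    have hss := hφ.block_of_sin R k
    have h3 := energy_block_ge hq0 hq1 (k := k) (n := n) (φ := s)
      (fun σ hσ => ⟨(hss σ hσ).1.1, (hss σ hσ).2⟩)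
    have h4 : ∑ x ∈ Finset.Ico (1 : ℤ) L,
        ‖inner ℂ (kinkHat q x k n) (diag (ind (CutAt k x)) s)‖ ^ 2
        ≤ tailErr q (m - R) * ‖s‖ ^ 2 := by
      rw [← h3.2, Finset.mul_sum]
      refine Finset.sum_le_sum fun x hx => ?_
      rw [Finset.mem_Ico] at hx
      have e : inner ℂ (kinkHat q x k n) (diag (ind (CutAt k x)) s)
          = inner ℂ (diag (ind fun σ => rad R m σ < R) (kinkHat q x k n))
            (diag (ind (CutAt k x)) s) := by
        rw [inner_diag_comm]
        congr 1
        ext σ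
        rw [diag_apply (ind fun σ => rad R m σ < R)]
        by_cases h0 : diag (ind (CutAt k x)) s σ = 0
        · rw [h0, mul_zero]
        · have : rad R m σ < R := by
            rw [diag_apply] at h0
            exact (hss σ (right_ne_zero_of_mul h0)).1.2.1
          simp [ind, this]
      rw [e]
      have h5 := norm_inner_le_norm (𝕜 := ℂ)
        (diag (ind fun σ => rad R m σ < R) (kinkHat q x k n)) (diag (ind (CutAt k x)) s)
      have h6 := norm_diag_kinkHat_rad (L := L) hq0 hq1 (x := x) (k := k) (n := n)
        (by omega) hx.2.le hRm hm
        (f := ind fun σ => rad R m σ < R) (fun σ => by unfold ind; split_ifs <;> simp)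
        (fun σ _ h0 => by by_contra hc; exact h0 (by simp [ind, hc]))
      calc _ ≤ (‖diag (ind fun σ => rad R m σ < R) (kinkHat q x k n)‖
            * ‖diag (ind (CutAt k x)) s‖) ^ 2 := by gcongr
        _ = ‖diag (ind fun σ => rad R m σ < R) (kinkHat q x k n)‖ ^ 2
            * ‖diag (ind (CutAt k x)) s‖ ^ 2 := by ring
        _ ≤ _ := by gcongr
    have h5 := ih (by omega) (φ := c) (hφ.diag fun σ h0 hP => ⟨hP.1, hP.2.1, fun i hi hiN => by
      rcases hi.eq_or_lt with h | h
      · rw [← h]; exact rad_lt_of_cos hR h0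
      · exact hP.2.2 i h hiN⟩)
    have h6 := sum_walls_diag_le (f := fun σ => Real.cos (angle R k σ))
      (fun σ => Real.abs_cos_le_one _) walls φ
    have h7 := locErr_nonneg hq0 R
    have h8 : (j : ℝ) * locErr q R * ∑ σ, (walls σ : ℝ) * ‖c σ‖ ^ 2
        ≤ j * locErr q R * ∑ σ, (walls σ : ℝ) * ‖φ σ‖ ^ 2 := by gcongr
    have h9 := mul_le_mul_of_nonneg_left h4 hg.le
    have h10 := h3.1
    rw [← h2]
    push_cast
    linarith

/-- Overlap of kink pairs at different cuts. -/
theorem norm_inner_diag_kinkHat_le {q : ℝ} (hq0 : 0 < q) (hq1 : q < 1) {x y : ℤ} (hx : 0 ≤ x)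
    (hxy : x ≤ y) (hy : y ≤ L) (m n : ℕ) {f g : Config 1 L → ℝ} (hf : ∀ σ, |f σ| ≤ 1)
    (hg : ∀ σ, |g σ| ≤ 1) :
    ‖inner ℂ (diag f (kinkHat q x m n)) (diag g (kinkHat q y m n))‖
      ≤ (q ^ (n - m)) ^ (y - x).natAbs := by
  set H : Config 1 L → Prop := fun σ => ∀ z, x < z → z ≤ x + (y - x).natAbs → σ (st L z) = 0
    with hH
  set F : Config 1 L → ℝ := fun σ => f σ * g σ * ind H σ with hF
  have e : inner ℂ (diag f (kinkHat q x m n)) (diag g (kinkHat q y m n))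
      = inner ℂ (diag F (kinkHat q x m n)) (kinkHat (L := L) q y m n) := by
    rw [inner_eq_sum, inner_eq_sum]
    refine Finset.sum_congr rfl fun σ _ => ?_
    simp only [diag_apply, map_mul, Complex.conj_ofReal, hF, kinkHat, PiLp.smul_apply, smul_eq_mul]
    by_cases h1 : InSec x m n σ ∧ InSec y m n σ
    · have : H σ := by
        intro z hz hz'
        by_contra hc
        have hz1 : σ (st L z) = 1 := (fin2_cases _).resolve_left hc
        have h2 := cnt_lt hz (by omega) (by omega) hz1
        have h3 := cnt_mono (show z ≤ y by omega) σ
        have := h1.1.1; have := h1.2.1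
        omega
      simp only [ind, if_pos this, Complex.ofReal_mul, mul_one]
      ring
    · rcases not_and_or.1 h1 with h2 | h2
      · rw [kinkPair_of_not_inSec h2]; simp
      · rw [kinkPair_of_not_inSec h2]; simp
  rw [e]
  have hFle : ∀ σ, |F σ| ≤ 1 := by
    intro σ
    rw [hF]
    simp only [abs_mul]
    have h1 : |ind H σ| ≤ 1 := by unfold ind; split_ifs <;> simp
    exact mul_le_one₀ (mul_le_one₀ (hf σ) (abs_nonneg _) (hg σ)) (abs_nonneg _) h1
  have h1 := norm_diag_kinkHat_sq_le hq0 x m n (f := F) (P := H)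
    (κ := (q ^ ((n - m) * (y - x).natAbs)) ^ 2) (by positivity) hFle
    (fun σ _ h0 => by by_contra hc; exact h0 (by simp [hF, ind, hc]))
    (holes_right hq0 hq1 hx m n _ (by omega))
  have h2 := norm_inner_le_norm (𝕜 := ℂ) (diag F (kinkHat q x m n)) (kinkHat (L := L) q y m n)
  have h3 := norm_kinkHat_le (L := L) q y m n
  have h4 : ‖diag F (kinkHat (L := L) q x m n)‖ ≤ q ^ ((n - m) * (y - x).natAbs) :=
    le_of_sq_le_sq h1 (by positivity)
  rw [← pow_mul]
  nlinarith [norm_nonneg (diag F (kinkHat (L := L) q x m n))]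

theorem sum_pow_natAbs_le {r : ℝ} (hr0 : 0 < r) (hr1 : r < 1) (s : Finset ℤ) (x : ℤ) :
    ∑ y ∈ s.erase x, r ^ (y - x).natAbs ≤ 2 * (r / (1 - r)) := by
  have h1r : 0 < 1 - r := by linarith
  have key : ∀ t : Finset ℤ, (∀ y ∈ t, y ≠ x) →
      Set.InjOn (fun y : ℤ => (y - x).natAbs - 1) t →
      ∑ y ∈ t, r ^ (y - x).natAbs ≤ r / (1 - r) := by
    intro t ht hinj
    have e : ∑ y ∈ t, r ^ (y - x).natAbs
        = r * ∑ j ∈ t.image (fun y : ℤ => (y - x).natAbs - 1), r ^ j := by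
      rw [Finset.sum_image hinj, Finset.mul_sum]
      refine Finset.sum_congr rfl fun y hy => ?_
      have := ht y hy
      rw [← pow_succ']; congr 1; omega
    rw [e, div_eq_mul_inv, ← tsum_geometric_of_lt_one hr0.le hr1]
    gcongr
    exact (summable_geometric_of_lt_one hr0.le hr1).sum_le_tsum _ (fun _ _ => by positivity)
  have hsplit := Finset.sum_filter_add_sum_filter_not (s.erase x) (fun y => y < x)
    (fun y => r ^ (y - x).natAbs)
  rw [← hsplit, two_mul]
  refine add_le_add (key _ ?_ ?_) (key _ ?_ ?_)
  · intro y hy; rw [Finset.mem_filter, Finset.mem_erase] at hy; exact hy.1.1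
  · intro y hy z hz h
    simp only [Finset.coe_filter, Finset.mem_erase, Set.mem_ofPred_eq] at hy hz h
    omega
  · intro y hy; rw [Finset.mem_filter, Finset.mem_erase] at hy; exact hy.1.1
  · intro y hy z hz h
    simp only [Finset.coe_filter, Finset.mem_erase, Set.mem_ofPred_eq] at hy hz h
    omega

/-- Total overlap of a droplet state with the droplet states at other positions. -/
noncomputable def overlapErr (q : ℝ) (r : ℕ) : ℝ := 2 * (q ^ r / (1 - q ^ r))

theorem sum_overlap_le {q : ℝ} (hq0 : 0 < q) (hq1 : q < 1) {m n : ℕ} (hmn : m < n)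
    (s : Finset ℤ) (hs : ∀ x ∈ s, 0 ≤ x ∧ x ≤ L) (f : ℤ → Config 1 L → ℝ)
    (hf : ∀ x σ, |f x σ| ≤ 1) {x : ℤ} (hx : x ∈ s) :
    ∑ y ∈ s.erase x, ‖inner ℂ (diag (f x) (kinkHat q x m n)) (diag (f y) (kinkHat q y m n))‖
      ≤ overlapErr q (n - m) := by
  have hr1 : q ^ (n - m) < 1 := pow_lt_one₀ hq0.le hq1 (by omega)
  refine le_trans (Finset.sum_le_sum fun y hy => ?_)
    (sum_pow_natAbs_le (pow_pos hq0 _) hr1 s x)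
  have hy' := hs y (Finset.mem_of_mem_erase hy)
  have hx' := hs x hx
  rcases le_total x y with h | h
  · exact norm_inner_diag_kinkHat_le hq0 hq1 hx'.1 h hy'.2 m n (hf x) (hf y)
  · rw [← inner_conj_symm, RCLike.norm_conj]
    have := norm_inner_diag_kinkHat_le hq0 hq1 hy'.1 h hx'.2 m n (hf y) (hf x)
    rwa [show (x - y).natAbs = (y - x).natAbs by omega] at this

/-- States orthogonal to all kink pairs with `m` down spins to the left of the cut have energy above
the gap. The part with a block at the `m`-th down spin is a superposition over the positions of its
cut, each piece of which is gapped up to its component along a kink pair. -/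
theorem energy_gap {q : ℝ} (hq0 : 0 < q) (hq1 : q < 1) {R N n m : ℕ} (hR : 1 ≤ R)
    (hn : 2 * R * N ≤ n) (hRm : R ≤ m) (hm : 2 * m ≤ n)
    (hN : 2 * fA q + gam q ≤ gam q / 2 * N) {φ : Space 1 L} (hφ : SuppOn (fun σ => cnt L σ = n) φ)
    (horth : ∀ x ∈ Finset.Ico (1 : ℤ) L, inner ℂ (kinkPair q x m n) φ = 0) :
    (2 * fA q + gam q - gam q * (2 * tailErr q (m - R) + overlapErr q (n - m))) * ‖φ‖ ^ 2
      ≤ (1 + (N + 1) * locErr q R * (2 / gam q)) * energy q φ := by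
  have hg := gam_pos hq1
  have hκ := tailErr_nonneg hq0 hq1 (m - R)
  set s := diag (fun σ => Real.sin (angle R m σ)) φ with hs
  set c := diag (fun σ => Real.cos (angle R m σ)) φ with hc
  have h1 := energy_split hq0 hR m φ
  have h2 := norm_diag_sin_cos (angle R m) φ
  have hss := hφ.block_of_sin R m
  have h3 := energy_block_ge hq0 hq1 (k := m) (n := n) (φ := s) hss
  -- the cut-off differs from `1` only where the block is not large, and there kink pairs have
  -- little weight, so that orthogonality to the kink pairs survives the localization
  set w : ℤ → Config 1 L → ℝ := fun x σ => ind (CutAt m x) σ * Real.sin (angle R m σ) - 1 with hw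
  have hR0 : (R : ℝ) ≠ 0 := by exact_mod_cast (by omega : R ≠ 0)
  have hsin : ∀ σ : Config 1 L, 0 ≤ Real.sin (angle R m σ) := by
    intro σ
    have hle : (rad R m σ : ℝ) / R ≤ 1 := by
      rw [div_le_one (by positivity)]; exact_mod_cast rad_le R m σ
    have hpi := Real.pi_pos
    refine Real.sin_nonneg_of_nonneg_of_le_pi (by unfold angle; positivity) ?_
    unfold angle; nlinarith
  have hwle : ∀ x σ, |w x σ| ≤ 1 := by
    intro x σ
    have h4 := hsin σ
    have h5 := Real.sin_le_one (angle R m σ)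
    simp only [hw, ind]
    split_ifs
    · rw [abs_le]; constructor <;> linarith
    · simp
  have hwrad : ∀ x ∈ Finset.Ico (1 : ℤ) L, ∀ σ, InSec x m n σ → w x σ ≠ 0 → rad R m σ < R := by
    intro x hx σ hσ h0
    refine lt_of_le_of_ne (rad_le R m σ) fun he => h0 ?_
    have hb : Block m 1 σ := (block_rad (R := R) (by omega)).mono (by omega)
    obtain ⟨y, hy, hcut⟩ := hb.exists_cutAt
    rw [Finset.mem_Ico] at hy
    have hyx : y = x := CutAt.unique hy.1 hy.2 hσ.1 hcut
    subst hyx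
    have ha : angle R m σ = Real.pi / 2 := by rw [angle, he, div_self hR0, mul_one]
    simp [hw, ind, hcut, ha]
  have hinner : ∀ x ∈ Finset.Ico (1 : ℤ) L, inner ℂ (kinkHat q x m n) (diag (ind (CutAt m x)) s)
      = inner ℂ (diag (w x) (kinkHat q x m n)) φ := by
    intro x hx
    have h4 : inner ℂ (kinkHat q x m n) φ = 0 := by
      rw [kinkHat, inner_smul_left, horth x hx, mul_zero]
    have h5 : diag (w x) φ = diag (ind (CutAt m x)) s - φ := by
      ext σ
      simp only [PiLp.sub_apply, diag_apply, hs, hw]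
      push_cast; ring
    rw [inner_diag_comm, h5, inner_sub_right, h4, sub_zero]
  have hov : 0 ≤ overlapErr q (n - m) := by
    have : q ^ (n - m) ≤ 1 := pow_le_one₀ hq0.le hq1.le
    have : 0 ≤ 1 - q ^ (n - m) := by linarith
    unfold overlapErr; positivity
  have hmn : m < n := by omega
  have h4 : ∑ x ∈ Finset.Ico (1 : ℤ) L,
        ‖inner ℂ (kinkHat q x m n) (diag (ind (CutAt m x)) s)‖ ^ 2
        ≤ (tailErr q (m - R) + overlapErr q (n - m)) * ‖φ‖ ^ 2 := by
    rw [Finset.sum_congr rfl fun x hx => by rw [hinner x hx]]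
    refine sum_norm_inner_sq_le _ _ _ (by positivity) fun x hx => ?_
    rw [← Finset.add_sum_erase _ _ hx]
    have hx' := Finset.mem_Ico.1 hx
    refine add_le_add ?_ (sum_overlap_le hq0 hq1 hmn _ (fun y hy => by
      rw [Finset.mem_Ico] at hy; omega) w hwle hx)
    rw [inner_self_eq_norm_sq_to_K, norm_pow]
    have := norm_diag_kinkHat_rad (L := L) hq0 hq1 (x := x) (by omega) hx'.2.le hRm hm (hwle x)
      (hwrad x hx)
    simpa using this
  have h5 := energy_ge_of_rad_lt hq0 hq1 hR hn hRm hm hN N le_rfl (φ := c)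
    (hφ.diag fun σ h0 hP => ⟨hP, rad_lt_of_cos hR h0, fun i hi hiN => by omega⟩)
  have h6 := sum_walls_diag_le (f := fun σ => Real.cos (angle R m σ))
    (fun σ => Real.abs_cos_le_one _) walls φ
  have h7 := locErr_nonneg hq0 R
  have h8 : (N : ℝ) * locErr q R * ∑ σ, (walls σ : ℝ) * ‖c σ‖ ^ 2
      ≤ N * locErr q R * ∑ σ, (walls σ : ℝ) * ‖φ σ‖ ^ 2 := by gcongr
  have h9 := mul_le_mul_of_nonneg_left h4 hg.le
  have h10 := h3.1
  have h11 := energy_ge_walls hq0 hq1 φ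
  have h12 : (N + 1) * locErr q R * ∑ σ, (walls σ : ℝ) * ‖φ σ‖ ^ 2
      ≤ (N + 1) * locErr q R * (2 / gam q) * energy q φ := by
    have : ∑ σ, (walls σ : ℝ) * ‖φ σ‖ ^ 2 ≤ 2 / gam q * energy q φ := by
      rw [div_mul_eq_mul_div, le_div_iff₀ hg]; linarith
    calc _ ≤ (N + 1) * locErr q R * (2 / gam q * energy q φ) := by gcongr
      _ = _ := by ring
  have h13 : ‖c‖ ^ 2 ≤ ‖φ‖ ^ 2 := by rw [← h2]; nlinarith [sq_nonneg ‖s‖]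
  have h14 : gam q * tailErr q (m - R) * ‖c‖ ^ 2 ≤ gam q * tailErr q (m - R) * ‖φ‖ ^ 2 := by
    gcongr
  have h15 : (2 * fA q + gam q) * ‖s‖ ^ 2 + (2 * fA q + gam q) * ‖c‖ ^ 2
      = (2 * fA q + gam q) * ‖φ‖ ^ 2 := by rw [← h2]; ring
  have h16 : (1 + (N + 1) * locErr q R * (2 / gam q)) * energy q φ
      = energy q φ + (N + 1) * locErr q R * (2 / gam q) * energy q φ := by ring
  rw [h16]
  linarith

end DropletGap

/-! ### The coupling across the cut -/

section Seam

variable {L : ℕ} [NeZero L]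

theorem norm_kinkOp_le {u : Fin 2 → ℝ} (hu : u 0 ^ 2 + u 1 ^ 2 = 1) (i : ℤ) (φ : Space 1 L) :
    ‖kinkOp u i φ‖ ≤ ‖φ‖ := by
  have h1 : ‖kinkOp u i φ‖ ^ 2 ≤ ‖φ‖ * ‖kinkOp u i φ‖ := by
    have h2 := norm_inner_le_norm (𝕜 := ℂ) φ (kinkOp u i φ)
    rw [inner_kinkOp_self, ← norm_kinkOp_sq hu, Complex.norm_real,
      Real.norm_of_nonneg (by positivity)] at h2
    exact h2
  by_contra hc
  push Not at hc
  nlinarith [norm_nonneg φ]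

omit [NeZero L] in
theorem norm_diag_le {f : Config 1 L → ℝ} (hf : ∀ σ, |f σ| ≤ 1) (φ : Space 1 L) :
    ‖diag f φ‖ ≤ ‖φ‖ := by
  refine (sq_le_sq₀ (norm_nonneg _) (norm_nonneg _)).1 ?_
  rw [norm_sq_eq_sum, norm_sq_eq_sum]
  refine Finset.sum_le_sum fun σ _ => ?_
  rw [diag_apply, norm_mul, mul_pow, Complex.norm_real, Real.norm_eq_abs]
  have : |f σ| ^ 2 ≤ 1 := pow_le_one₀ (abs_nonneg _) (hf σ)
  nlinarith [sq_nonneg ‖φ σ‖]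

theorem norm_seamOp_le {q : ℝ} (hq0 : 0 < q) (hq1 : q < 1) (x : ℤ) (φ : Space 1 L) :
    ‖seamOp q x φ‖ ≤ 2 * ‖φ‖ := by
  have h1 : ‖bondOp q x φ‖ ≤ ‖φ‖ := by
    have h2 := norm_kinkOp_le (uL_norm q) x φ
    have h3 := norm_kinkOp_le (uR_norm q) x φ
    have h4 := norm_add_le (kinkOp (uL q) x φ) (kinkOp (uR q) x φ)
    have h5 : bondOp q x φ = (1 / 2 : ℂ) • (kinkOp (uL q) x φ + kinkOp (uR q) x φ) := rfl
    rw [h5, norm_smul]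
    norm_num
    linarith
  have h2 := norm_diag_le (f := fun σ : Config 1 L => fA q * (dn σ x + dn σ (x + 1) - 2))
    (fun σ => by
      have := fA_nonneg hq0 hq1
      have := fA_le_half q
      have := dn_nonneg σ x
      have := dn_nonneg σ (x + 1)
      have := dn_le_one σ x
      have := dn_le_one σ (x + 1)
      rw [abs_le]; constructor <;> nlinarith) φ
  have h3 : seamOp q x φ = bondOp q x φ
      + diag (fun σ : Config 1 L => fA q * (dn σ x + dn σ (x + 1) - 2)) φ := rfl
  rw [h3]
  exact (norm_add_le _ _).trans (by linarith)

/-- Functions that do not see the exchange of the spins at the cut commute with the coupling. -/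
theorem seamOp_diag (q : ℝ) {x : ℤ} {f : Config 1 L → ℝ} (hf : ∀ σ, f (sw x σ) = f σ)
    (φ : Space 1 L) : seamOp q x (diag f φ) = diag f (seamOp q x φ) := by
  ext σ
  rw [diag_apply, seamOp_apply, seamOp_apply, bondAmp, bondAmp, diag_apply, diag_apply, hf]
  split_ifs <;> ring

/-- The indicator of the event that the spins next to the cut are not both down. -/
noncomputable def openCut (x : ℤ) : Config 1 L → ℝ :=
  ind fun σ => ¬ (σ (st L x) = 1 ∧ σ (st L (x + 1)) = 1)

omit [NeZero L] in
theorem abs_ind_le (P : Config 1 L → Prop) (σ : Config 1 L) : |ind P σ| ≤ 1 := by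
  unfold ind; split_ifs <;> simp

omit [NeZero L] in
theorem of_ind_ne_zero {P : Config 1 L → Prop} {σ : Config 1 L} (h : ind P σ ≠ 0) : P σ := by
  by_contra hc; exact h (if_neg hc)

theorem diag_openCut_seamOp (q : ℝ) (x : ℤ) (φ : Space 1 L) :
    diag (openCut x) (seamOp q x φ) = seamOp q x φ := by
  ext σ
  rw [diag_apply]
  by_cases h : σ (st L x) = 1 ∧ σ (st L (x + 1)) = 1
  · rw [seamOp_apply, bondAmp, if_pos (h.1.trans h.2.symm), dn_of_one h.1, dn_of_one h.2]
    norm_num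
  · rw [openCut, ind, if_pos h]; simp

theorem seamOp_diag_openCut (q : ℝ) (x : ℤ) (φ : Space 1 L) :
    seamOp q x (diag (openCut x) φ) = seamOp q x φ := by
  rw [seamOp_diag, diag_openCut_seamOp]
  intro σ
  simp only [openCut, ind, sw_left, sw_right]
  congr 1
  rw [and_comm]

theorem norm_inner_seamOp_le {q : ℝ} (hq0 : 0 < q) (hq1 : q < 1) (x : ℤ) (φ χ : Space 1 L) :
    ‖inner ℂ φ (seamOp q x χ)‖ ≤ 2 * (‖diag (openCut x) φ‖ * ‖diag (openCut x) χ‖) := by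
  rw [← diag_openCut_seamOp, ← inner_diag_comm, ← seamOp_diag_openCut q x χ]
  refine (norm_inner_le_norm _ _).trans ?_
  have := norm_seamOp_le hq0 hq1 x (diag (openCut x) χ)
  calc _ ≤ ‖diag (openCut x) φ‖ * (2 * ‖diag (openCut x) χ‖) := by gcongr
    _ = _ := by ring

/-- Kink pairs are nearly filled with down spins around any cut close to their own. -/
theorem norm_openCut_kinkHat_le {q : ℝ} (hq0 : 0 < q) (hq1 : q < 1) {x y : ℤ} (hxy : x ≤ y)
    (hyx : y ≤ x + 2) (h0 : 0 ≤ y) (hL : y ≤ L) {m n : ℕ} (hm : 3 ≤ m) (hmn : 2 * m ≤ n) :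
    ‖diag (openCut x) (kinkHat (L := L) q y m n)‖ ^ 2 ≤ tailErr q (m - 3) := by
  by_cases hne : ∃ σ : Config 1 L, InSec y m n σ
  · obtain ⟨σ₀, hσ₀⟩ := hne
    obtain ⟨hk, hn, hkn⟩ := inSec_bounds hσ₀ h0 hL
    refine norm_diag_kinkHat_sq_le hq0 y m n (tailErr_nonneg hq0 hq1 _) (abs_ind_le _) ?_
      (hole_tail hq0 hq1 hk hn hkn (m - 3))
    intro σ _ hσ
    have h := of_ind_ne_zero hσ
    by_cases h1 : σ (st L x) = 1
    · exact ⟨x + 1, by omega, by omega, fin2_ne_one fun h2 => h ⟨h1, h2⟩⟩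
    · exact ⟨x, by omega, by omega, fin2_ne_one h1⟩
  · rw [kinkHat, kinkPair_eq_zero hne]
    simpa using tailErr_nonneg hq0 hq1 _

/-- The coupling across one cut hardly connects to states with few down spins far to the right. -/
theorem norm_inner_seamOp_far {q : ℝ} (hq0 : 0 < q) (hq1 : q < 1) {x y : ℤ} (h0 : 1 ≤ x)
    (hxy : x + 2 ≤ y) (hL : y ≤ L) {m : ℕ} (n : ℕ) {φ : Space 1 L}
    (hφ : SuppOn (fun σ => cnt (y - 1) σ ≤ m) φ) :
    ‖inner ℂ φ (seamOp q x (kinkHat q x m n))‖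
      ≤ 2 * ‖φ‖ * q ^ ((n - m) * (y - 1 - x).toNat) := by
  set P : Config 1 L → Prop := fun σ => cnt (y - 1) σ ≤ m with hP
  have h1 : diag (ind P) φ = φ := by
    ext σ
    rw [diag_apply]
    by_cases h : φ σ = 0
    · rw [h, mul_zero]
    · rw [ind, if_pos (hφ σ h)]; simp
  have hsw : ∀ σ, ind P (sw x σ) = ind P σ := fun σ => by
    simp only [hP, ind, cnt_sw h0 (by omega : x < L) (by omega : x ≠ y - 1)]
  rw [← h1, inner_diag_comm, ← seamOp_diag q hsw, h1]
  have h2 : ‖diag (ind P) (kinkHat q x m n)‖ ≤ q ^ ((n - m) * (y - 1 - x).toNat) := by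
    refine (sq_le_sq₀ (norm_nonneg _) (by positivity)).1 ?_
    refine norm_diag_kinkHat_sq_le hq0 x m n (by positivity) (abs_ind_le _) ?_
      (holes_right hq0 hq1 (by omega) m n (y - 1 - x).toNat (by omega))
    intro σ hσ h3 z hz hz'
    have h4 : cnt (y - 1) σ ≤ m := of_ind_ne_zero h3
    by_contra hc
    have h5 := cnt_lt (by omega : x < z) (by omega) (by omega)
      ((fin2_cases (σ (st L z))).resolve_left hc)
    have h6 := cnt_mono (by omega : z ≤ y - 1) σ
    have := hσ.1
    omega
  refine (norm_inner_le_norm _ _).trans ?_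
  have h3 := norm_seamOp_le hq0 hq1 x (diag (ind P) (kinkHat q x m n))
  calc _ ≤ ‖φ‖ * (2 * q ^ ((n - m) * (y - 1 - x).toNat)) := by gcongr; linarith
    _ = _ := by ring

/-- The decay rate of the matrix elements of the couplings between droplet states. -/
noncomputable def seamErr (q : ℝ) (n : ℕ) : ℝ := 8 / ((1 - q ^ 2) * q ^ 7) * q ^ n

theorem seamErr_nonneg {q : ℝ} (hq0 : 0 < q) (hq1 : q < 1) (n : ℕ) : 0 ≤ seamErr q n := by
  have : q ^ 2 < 1 := by nlinarith
  have : 0 < 1 - q ^ 2 := by linarith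
  unfold seamErr; positivity

theorem tailErr_le_seamErr {q : ℝ} (hq0 : 0 < q) (hq1 : q < 1) {m n : ℕ} (hm : 3 ≤ m)
    (hn : n ≤ 2 * m + 1) : 4 * tailErr q (m - 3) ≤ seamErr q n * q ^ 2 := by
  have : q ^ 2 < 1 := by nlinarith
  have h1 : 0 < 1 - q ^ 2 := by linarith
  unfold tailErr seamErr
  have h2 : (q ^ (m - 3 + 1)) ^ 2 * q ^ 5 ≤ q ^ n := by
    rw [← pow_mul, ← pow_add]
    exact pow_le_pow_of_le_one hq0.le hq1.le (by omega)
  have e : 8 / ((1 - q ^ 2) * q ^ 7) * q ^ n * q ^ 2 = 8 * q ^ n / ((1 - q ^ 2) * q ^ 5) := by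
    field_simp
  rw [e, le_div_iff₀ (by positivity)]
  have e2 : 4 * (2 * (q ^ (m - 3 + 1)) ^ 2 / (1 - q ^ 2)) * ((1 - q ^ 2) * q ^ 5)
      = 8 * ((q ^ (m - 3 + 1)) ^ 2 * q ^ 5) := by
    field_simp; ring
  rw [e2]
  linarith

theorem pow_le_seamErr {q : ℝ} (hq0 : 0 < q) (hq1 : q < 1) {m n s : ℕ} (hm : 2 * m ≤ n)
    (hn : 1 ≤ n - m) (hs : 3 ≤ s) : 4 * q ^ ((n - m) * (s - 1)) ≤ seamErr q n * q ^ s := by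
  have : q ^ 2 < 1 := by nlinarith
  have h1 : 0 < 1 - q ^ 2 := by linarith
  have h2 : q ^ ((n - m) * (s - 1)) * q ^ 3 ≤ q ^ n * q ^ s := by
    rw [← pow_add, ← pow_add]
    refine pow_le_pow_of_le_one hq0.le hq1.le ?_
    obtain ⟨t, rfl⟩ := Nat.exists_eq_add_of_le hs
    have : (n - m) * (3 + t - 1) = 2 * (n - m) + (n - m) * t := by
      rw [show 3 + t - 1 = 2 + t by omega]; ring
    have : t ≤ (n - m) * t := Nat.le_mul_of_pos_left _ hn
    omega
  have h3 : (1 - q ^ 2) * q ^ 4 ≤ 2 := by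
    have : q ^ 4 ≤ 1 := pow_le_one₀ hq0.le hq1.le
    nlinarith [pow_pos hq0 2, pow_pos hq0 4]
  unfold seamErr
  have e : 8 / ((1 - q ^ 2) * q ^ 7) * q ^ n * q ^ s = 8 * (q ^ n * q ^ s) / ((1 - q ^ 2) * q ^ 7) := by
    ring
  rw [e, le_div_iff₀ (by positivity)]
  have h4 : 0 ≤ q ^ ((n - m) * (s - 1)) * q ^ 3 := by positivity
  calc _ = 4 * (q ^ ((n - m) * (s - 1)) * q ^ 3) * ((1 - q ^ 2) * q ^ 4) := by ring
    _ ≤ 4 * (q ^ ((n - m) * (s - 1)) * q ^ 3) * 2 := by gcongr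
    _ ≤ 4 * (q ^ n * q ^ s) * 2 := by gcongr
    _ = _ := by ring

omit [NeZero L] in
theorem suppOn_kinkHat (q : ℝ) (x : ℤ) (k n : ℕ) :
    SuppOn (InSec (L := L) x k n) (kinkHat q x k n) := by
  intro σ hσ
  by_contra hc
  apply hσ
  rw [kinkHat, PiLp.smul_apply, kinkPair_of_not_inSec hc, smul_zero]

theorem SuppOn.seamOp (q : ℝ) {x : ℤ} {P : Config 1 L → Prop} (hP : ∀ σ, P (sw x σ) → P σ)
    {φ : Space 1 L} (hφ : SuppOn P φ) : SuppOn P (seamOp q x φ) := by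
  intro σ hσ
  by_contra hc
  apply hσ
  have h1 : φ σ = 0 := by by_contra h; exact hc (hφ σ h)
  have h2 : φ (sw x σ) = 0 := by by_contra h; exact hc (hP σ (hφ _ h))
  rw [seamOp_apply, bondAmp, h1, h2]; simp

/-- Matrix elements of the couplings between droplet states, with the left cut acting. -/
theorem norm_inner_seamOp_kinkHat {q : ℝ} (hq0 : 0 < q) (hq1 : q < 1) {x y : ℤ} (h0 : 1 ≤ x)
    (hxy : x ≤ y) (hL : y < L) {m n : ℕ} (hm : 3 ≤ m) (hmn : 2 * m ≤ n) (hnm : n ≤ 2 * m + 1) :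
    ‖inner ℂ (kinkHat q y m n) (seamOp q x (kinkHat (L := L) q x m n))‖
        ≤ seamErr q n * q ^ (y - x).natAbs ∧
      ‖inner ℂ (seamOp q y (kinkHat q y m n)) (seamOp q x (kinkHat (L := L) q x m n))‖
        ≤ seamErr q n * q ^ (y - x).natAbs := by
  have hu : ‖kinkHat (L := L) q y m n‖ ≤ 1 := norm_kinkHat_le _ _ _ _
  have hBu : ‖seamOp q y (kinkHat (L := L) q y m n)‖ ≤ 2 :=
    (norm_seamOp_le hq0 hq1 _ _).trans (by linarith)
  by_cases hnear : y ≤ x + 2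
  · have h1 := norm_openCut_kinkHat_le (L := L) hq0 hq1 hxy hnear (by omega) hL.le hm hmn
    have h2 := norm_openCut_kinkHat_le (L := L) hq0 hq1 le_rfl (by omega : x ≤ x + 2) (by omega)
      (by omega) hm hmn
    have h3 := norm_openCut_kinkHat_le (L := L) hq0 hq1 le_rfl (by omega : y ≤ y + 2) (by omega)
      hL.le hm hmn
    have h4 := (tailErr_le_seamErr hq0 hq1 hm hnm).trans (mul_le_mul_of_nonneg_left
      (pow_le_pow_of_le_one hq0.le hq1.le (by omega : (y - x).natAbs ≤ 2)) (seamErr_nonneg hq0 hq1 n))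
    have h5 := tailErr_nonneg hq0 hq1 (m - 3)
    constructor
    · refine (norm_inner_seamOp_le hq0 hq1 _ _ _).trans (le_trans ?_ h4)
      nlinarith [sq_nonneg (‖diag (openCut x) (kinkHat (L := L) q y m n)‖
        - ‖diag (openCut x) (kinkHat (L := L) q x m n)‖)]
    · refine (norm_inner_seamOp_le hq0 hq1 _ _ _).trans (le_trans ?_ h4)
      have h6 : ‖diag (openCut x) (seamOp q y (kinkHat (L := L) q y m n))‖
          ≤ 2 * ‖diag (openCut y) (kinkHat (L := L) q y m n)‖ := by
        refine (norm_diag_le (abs_ind_le _) _).trans ?_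
        rw [← seamOp_diag_openCut]
        exact norm_seamOp_le hq0 hq1 _ _
      have h7 := mul_le_mul_of_nonneg_right h6
        (norm_nonneg (diag (openCut x) (kinkHat (L := L) q x m n)))
      nlinarith [sq_nonneg (‖diag (openCut y) (kinkHat (L := L) q y m n)‖
        - ‖diag (openCut x) (kinkHat (L := L) q x m n)‖)]
  · have hs := suppOn_kinkHat (L := L) q y m n
    have hs1 : SuppOn (fun σ => cnt (y - 1) σ ≤ m) (kinkHat (L := L) q y m n) := fun σ hσ =>
      (cnt_mono (by omega) σ).trans (hs σ hσ).1.le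
    have hs2 := SuppOn.seamOp q (x := y) (fun σ h => by
      rwa [cnt_sw (by omega) hL (by omega)] at h) hs1
    have h1 := norm_inner_seamOp_far hq0 hq1 h0 (by omega) hL.le n hs1
    have h2 := norm_inner_seamOp_far hq0 hq1 h0 (by omega) hL.le n hs2
    have h3 := pow_le_seamErr hq0 hq1 (s := (y - x).natAbs) hmn (by omega) (by omega)
    rw [show (y - 1 - x).toNat = (y - x).natAbs - 1 by omega] at h1 h2
    have h4 : 0 ≤ q ^ ((n - m) * ((y - x).natAbs - 1)) := by positivity
    constructor
    · refine h1.trans (le_trans ?_ h3)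
      gcongr; linarith
    · refine h2.trans (le_trans ?_ h3)
      gcongr; linarith

end Seam

/-! ### The Hamiltonian on a sector -/

section Sector

variable {L : ℕ} [NeZero L]

theorem droplet_eq_sum {Δ q : ℝ} (hq0 : 0 < q) (hΔq : Δ = (q + q⁻¹) / 2) (φ : Space 1 L) :
    droplet Δ L φ = ∑ i ∈ Finset.Ico (1 : ℤ) L, bondOp q i φ
      + diag (fun σ => fieldA Δ * (dn σ 1 + dn σ L - 1)) φ := by
  ext σ
  rw [droplet_apply, inv_eq_of_anisotropy hq0 hΔq, PiLp.add_apply, diag_apply, WithLp.ofLp_sum,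
    Finset.sum_apply]
  congr 1
  · exact Finset.sum_congr rfl fun i _ => (bondOp_apply q i φ σ).symm
  · push_cast; ring

theorem inner_droplet_comm {Δ q : ℝ} (hq0 : 0 < q) (hΔq : Δ = (q + q⁻¹) / 2) (φ χ : Space 1 L) :
    inner ℂ (droplet Δ L φ) χ = inner ℂ φ (droplet Δ L χ) := by
  have hb : ∀ i, inner ℂ (bondOp q i φ) χ = inner ℂ φ (bondOp q i χ) := fun i => by
    simp only [bondOp, LinearMap.add_apply, LinearMap.smul_apply, inner_add_left,
      inner_add_right, inner_smul_left, inner_smul_right, inner_kinkOp_comm]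
    norm_num [Complex.conj_ofNat]
  rw [droplet_eq_sum hq0 hΔq, droplet_eq_sum hq0 hΔq, inner_add_left, inner_add_right,
    inner_diag_comm, sum_inner, inner_sum]
  simp only [hb]

theorem droplet_mem_sector (Δ : ℝ) {n : ℕ} {φ : Space 1 L} (hφ : φ ∈ sector L n) :
    droplet Δ L φ ∈ sector L n := by
  rw [mem_sector_iff] at hφ ⊢
  intro σ hσ
  by_contra hc
  apply hσ
  have h1 : φ σ = 0 := by by_contra h; exact hc (hφ σ h)
  rw [droplet_apply, h1, mul_zero, add_zero]
  refine Finset.sum_eq_zero fun i hi => ?_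
  rw [Finset.mem_Ico] at hi
  have h2 : φ (sw i σ) = 0 := by
    by_contra h
    have := hφ _ h
    rw [cnt_sw hi.1 hi.2 hi.2.ne] at this
    exact hc this
  rw [bondAmp, h1, h2]; simp

theorem exists_isOrderedEigenbasis {Δ q : ℝ} (hq0 : 0 < q) (hΔq : Δ = (q + q⁻¹) / 2) (n : ℕ) :
    ∃ lam ψ, IsOrderedEigenbasis Δ L n lam ψ := by
  have hinv : ∀ v ∈ sector L n, (droplet Δ L : Space 1 L →ₗ[ℂ] Space 1 L) v ∈ sector L n :=
    fun v hv => droplet_mem_sector Δ hv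
  have hsymm : ((droplet Δ L : Space 1 L →ₗ[ℂ] Space 1 L)).IsSymmetric :=
    fun φ χ => inner_droplet_comm hq0 hΔq φ χ
  have hT := hsymm.restrict_invariant hinv
  -- Mathlib orders eigenvalues decreasingly
  refine ⟨fun j => hT.eigenvalues rfl (Fin.rev j), (hT.eigenvectorBasis rfl).reindex Fin.revPerm,
    ⟨fun i j hij => hT.eigenvalues_antitone rfl (Fin.rev_le_rev.2 hij), fun j => ?_⟩⟩
  have h := congrArg Subtype.val (hT.apply_eigenvectorBasis rfl (Fin.rev j))
  rw [OrthonormalBasis.reindex_apply]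
  exact h

omit [NeZero L] in
theorem sub_add_one_le_choose {n : ℕ} (hn : 1 ≤ n) (h : n ≤ L) : L - n + 1 ≤ L.choose n := by
  obtain ⟨d, rfl⟩ := Nat.exists_eq_add_of_le h
  obtain ⟨k, rfl⟩ := Nat.exists_eq_add_of_le' hn
  clear hn h
  induction d with
  | zero => simp
  | succ d ih =>
    have h1 := Nat.choose_succ_succ (k + 1 + d) k
    have h2 : 0 < (k + 1 + d).choose k := Nat.choose_pos (by omega)
    rw [show k + 1 + (d + 1) = (k + 1 + d).succ by omega]
    simp only [Nat.succ_eq_add_one] at h1 ⊢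
    omega

omit [NeZero L] in
theorem finrank_sector (n : ℕ) : Module.finrank ℂ (sector L n) = L.choose n := by
  classical
  have h1 : sector L n
      = Submodule.span ℂ (Set.range fun D : {D : Finset (Sites 1 L) // D.card = n} => ket D.1) := by
    rw [sector]
    congr 1
    ext v
    simp only [Set.mem_ofPred_eq, Set.mem_range, Subtype.exists]
    constructor
    · rintro ⟨D, hD, rfl⟩; exact ⟨D, hD, rfl⟩
    · rintro ⟨D, hD, rfl⟩; exact ⟨D, hD, rfl⟩
  have h2 : LinearIndependent ℂ
      fun D : {D : Finset (Sites 1 L) // D.card = n} => (ket D.1 : Space 1 L) := by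
    have h3 := (EuclideanSpace.basisFun (Config 1 L) ℂ).orthonormal.linearIndependent
    have h4 : Function.Injective fun D : {D : Finset (Sites 1 L) // D.card = n} =>
        (fun x => if x ∈ D.1 then 1 else 0 : Config 1 L) := by
      intro D D' h
      apply Subtype.ext
      ext x
      have := congrFun h x
      by_cases hx : x ∈ D.1 <;> by_cases hx' : x ∈ D'.1 <;> simp_all
    have h5 := h3.comp _ h4
    have h6 : (fun D : {D : Finset (Sites 1 L) // D.card = n} => (ket D.1 : Space 1 L))
        = EuclideanSpace.basisFun (Config 1 L) ℂ ∘ fun D =>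
          (fun x => if x ∈ D.1 then 1 else 0 : Config 1 L) := by
      funext D
      simp [ket]
    rw [h6]
    exact h5
  rw [h1, finrank_span_eq_card h2, Fintype.card_finset_len]
  congr 1
  rw [Fintype.card_ofFinset]
  simp

end Sector

/-! ### The approximate droplet states as kink pairs -/

section Bridge

variable {L : ℕ}

theorem sum_sites_split {M : Type*} [AddCommMonoid M] {x : ℤ} (h0 : 1 ≤ x + 1) (hL : x ≤ L)
    (F : Sites 1 L → M) :
    ∑ y, F y = ∑ y : Sites 1 x, F (Set.inclusion (Set.Icc_subset_Icc_right hL) y)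
      + ∑ y : Sites (x + 1) L, F (Set.inclusion (Set.Icc_subset_Icc_left h0) y) := by
  have hb : Function.Bijective (Sum.elim
      (fun y : Sites 1 x => (Set.inclusion (Set.Icc_subset_Icc_right hL) y : Sites 1 L))
      (fun y : Sites (x + 1) L => Set.inclusion (Set.Icc_subset_Icc_left h0) y)) := by
    constructor
    · rintro (y | y) (z | z) h
      all_goals
        have h1 := congrArg Subtype.val h
        simp only [Sum.elim_inl, Sum.elim_inr, Set.coe_inclusion] at h1
        have h2 := y.2; have h3 := z.2
        rw [Set.mem_Icc] at h2 h3
      · exact congrArg _ (Subtype.ext h1)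
      · omega
      · omega
      · exact congrArg _ (Subtype.ext h1)
    · intro y
      have h2 := y.2
      rw [Set.mem_Icc] at h2
      by_cases h : y.1 ≤ x
      · exact ⟨Sum.inl ⟨y.1, h2.1, h⟩, rfl⟩
      · exact ⟨Sum.inr ⟨y.1, by omega, h2.2⟩, rfl⟩
  rw [← (Equiv.ofBijective _ hb).sum_comp, Fintype.sum_sum_type]
  rfl

theorem sum_smul_ket_apply {a b : ℤ} (n : ℕ) (w : Finset (Sites a b) → ℂ) (τ : Config a b) :
    (∑ D : Finset (Sites a b) with D.card = n, w D • (ket D : Space a b)) τ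
      = if (Finset.univ.filter fun y => τ y = 1).card = n
        then w (Finset.univ.filter fun y => τ y = 1) else 0 := by
  rw [WithLp.ofLp_sum, Finset.sum_apply]
  have e : ∀ D : Finset (Sites a b), (w D • (ket D : Space a b)) τ
      = if D = Finset.univ.filter (fun y => τ y = 1) then w D else 0 := by
    intro D
    rw [PiLp.smul_apply, ket_apply, smul_eq_mul, mul_ite, mul_one, mul_zero]
  simp only [PiLp.smul_apply] at e
  simp only [WithLp.ofLp_smul, Pi.smul_apply, e]
  rw [Finset.sum_ite_eq']
  simp

theorem sum_filter_one {a b : ℤ} (τ : Config a b) (g : Sites a b → ℤ) :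
    ∑ y ∈ Finset.univ.filter (fun y => τ y = 1), g y = ∑ y, ((τ y).val : ℤ) * g y := by
  rw [Finset.sum_filter]
  refine Finset.sum_congr rfl fun y _ => ?_
  rcases fin2_cases (τ y) with h | h <;> simp [h]

/-- The tensor product of the two kink states is the kink pair. -/
theorem xi_eq_kinkPair {q : ℝ} (hq0 : 0 < q) (n : ℕ) {x : ℤ} (h0 : 1 ≤ x + 1) (hL : x ≤ L) :
    xi q L n x h0 hL = kinkPair q x (n / 2) n := by
  classical
  ext σ
  set τ : Config 1 x := fun y => σ (Set.inclusion (Set.Icc_subset_Icc_right hL) y) with hτ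
  set τ' : Config (x + 1) L := fun y => σ (Set.inclusion (Set.Icc_subset_Icc_left h0) y) with hτ'
  have e : xi q L n x h0 hL σ = kinkPM q 1 x (n / 2) τ * kinkMP q (x + 1) L ((n + 1) / 2) τ' := rfl
  rw [e, kinkPM, kinkMP, sum_smul_ket_apply, sum_smul_ket_apply, kinkPair_apply]
  have hc1 : (Finset.univ.filter fun y => τ y = 1).card = cnt x σ := by
    rw [cnt, Finset.card_filter, Finset.card_filter, sum_sites_split h0 hL]
    rw [Finset.sum_eq_zero (s := (Finset.univ : Finset (Sites (x + 1) L))), add_zero]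
    · refine Finset.sum_congr rfl fun y _ => if_congr ?_ rfl rfl
      have := y.2.2
      simp [hτ, this]
    · intro y _
      have := y.2.1
      rw [if_neg]; rintro ⟨h, -⟩; simp at h; omega
  have hc2 : cnt x σ + (Finset.univ.filter fun y => τ' y = 1).card = cnt L σ := by
    rw [← hc1, cnt_top, Finset.card_filter, Finset.card_filter, Finset.card_filter,
      sum_sites_split h0 hL]
  have hd : ∑ y ∈ Finset.univ.filter (fun y => τ y = 1), (x + 1 - (y : ℤ))
      + ∑ y ∈ Finset.univ.filter (fun y => τ' y = 1), ((y : ℤ) + 1 - (x + 1))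
      = (totalDepth x σ : ℤ) := by
    rw [sum_filter_one, sum_filter_one, totalDepth, Nat.cast_sum, sum_sites_split h0 hL]
    congr 1
    · refine Finset.sum_congr rfl fun y _ => ?_
      have := y.2.2
      simp only [hτ, depth, if_pos this]
      push_cast
      rw [Int.toNat_of_nonneg (by omega)]
    · refine Finset.sum_congr rfl fun y _ => ?_
      have := y.2.1
      simp only [hτ', depth, if_neg (by omega : ¬ (y : ℤ) ≤ x)]
      push_cast
      rw [Int.toNat_of_nonneg (by omega)]
      ring
  rw [hc1]
  by_cases h1 : cnt x σ = n / 2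
  · by_cases h2 : cnt L σ = n
    · rw [if_pos h1, if_pos (by omega), if_pos ⟨h1, h2⟩, ← Complex.ofReal_mul,
        ← zpow_add₀ hq0.ne', hd, zpow_natCast]
    · rw [if_pos h1, if_neg (fun h => h2 (by omega)), mul_zero, if_neg (fun h => h2 h.2)]
  · rw [if_neg h1, zero_mul, if_neg (fun h => h1 h.1)]

end Bridge

/-! ### Almost orthonormal families -/

section AlmostOrthonormal

variable {E : Type*} [NormedAddCommGroup E] [InnerProductSpace ℂ E]

/-- Diagonal dominance of the Gram matrix bounds coefficients by the norm of a combination. -/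
theorem sum_norm_sq_le_norm_sum_smul_sq {ι : Type*} [DecidableEq ι] (s : Finset ι) (v : ι → E)
    (c : ι → ℂ) {M : ℝ} (hv : ∀ x ∈ s, ‖v x‖ = 1)
    (hM : ∀ x ∈ s, ∑ y ∈ s.erase x, ‖inner ℂ (v x) (v y)‖ ≤ M) :
    (1 - M) * ∑ x ∈ s, ‖c x‖ ^ 2 ≤ ‖∑ x ∈ s, c x • v x‖ ^ 2 := by
  set k : ι → ι → ℝ := fun x y => if x = y then 0 else ‖inner ℂ (v x) (v y)‖ with hk
  have h1 := schur_test s (k := k) (fun x y => by simp only [hk]; split_ifs <;> positivity)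
    (fun x y => by
      simp only [hk, eq_comm (a := x)]
      split_ifs
      · rfl
      · rw [← inner_conj_symm, RCLike.norm_conj])
    (fun x => ‖c x‖) (M := M) (fun x hx => by
      rw [← Finset.add_sum_erase _ _ hx]
      simp only [hk, if_true, zero_add]
      refine le_trans (le_of_eq (Finset.sum_congr rfl fun y hy => ?_)) (hM x hx)
      rw [if_neg (Finset.ne_of_mem_erase hy).symm])
  have h2 : ‖∑ x ∈ s, c x • v x‖ ^ 2
      = ∑ x ∈ s, ∑ y ∈ s, (inner ℂ (c x • v x) (c y • v y)).re := by
    have : ‖∑ x ∈ s, c x • v x‖ ^ 2 = (inner ℂ (∑ x ∈ s, c x • v x) (∑ x ∈ s, c x • v x)).re := by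
      rw [inner_self_eq_norm_sq_to_K, ← RCLike.ofReal_pow]; exact (Complex.ofReal_re _).symm
    rw [this, sum_inner, Complex.re_sum]
    exact Finset.sum_congr rfl fun x _ => by rw [inner_sum, Complex.re_sum]
  have h3 : ∑ x ∈ s, (‖c x‖ ^ 2 - ∑ y ∈ s, ‖c x‖ * ‖c y‖ * k x y)
      ≤ ∑ x ∈ s, ∑ y ∈ s, (inner ℂ (c x • v x) (c y • v y)).re := by
    refine Finset.sum_le_sum fun x hx => ?_
    have h4 : ‖c x‖ ^ 2 = ∑ y ∈ s, if y = x then ‖c x‖ ^ 2 else 0 := by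
      rw [Finset.sum_ite_eq' s x, if_pos hx]
    rw [h4, ← Finset.sum_sub_distrib]
    refine Finset.sum_le_sum fun y _ => ?_
    by_cases h : y = x
    · subst h
      rw [if_pos rfl, inner_self_eq_norm_sq_to_K, norm_smul, hv y hx, ← RCLike.ofReal_pow]
      simp only [hk, if_true, mul_one, mul_zero, sub_zero]
      exact (Complex.ofReal_re _).ge
    · have h5 := (abs_le.1 (Complex.abs_re_le_norm (inner ℂ (c x • v x) (c y • v y)))).1
      rw [inner_smul_left, inner_smul_right, norm_mul, norm_mul, RCLike.norm_conj] at h5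
      rw [if_neg h, inner_smul_left, inner_smul_right]
      simp only [hk, if_neg (Ne.symm h)]
      linarith
  rw [h2]
  refine le_trans ?_ h3
  rw [Finset.sum_sub_distrib]
  linarith

end AlmostOrthonormal

/-! ### The space of droplet states -/

section Droplets

variable {L : ℕ} [NeZero L]

/-- The cuts around which a droplet of `n` down spins fits into the chain. -/
noncomputable def cuts (L n : ℕ) : Finset ℤ := Finset.Icc ((n / 2 : ℕ) : ℤ) ((L : ℤ) - ((n + 1) / 2 : ℕ))

omit [NeZero L] in
theorem mem_cuts {n : ℕ} {x : ℤ} :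
    x ∈ cuts L n ↔ ((n / 2 : ℕ) : ℤ) ≤ x ∧ x ≤ (L : ℤ) - ((n + 1) / 2 : ℕ) := Finset.mem_Icc

omit [NeZero L] in
theorem card_cuts {n : ℕ} (h : n ≤ L) : (cuts L n).card = L - n + 1 := by
  rw [cuts, Int.card_Icc]; omega

theorem exists_inSec {n : ℕ} {x : ℤ} (hx : x ∈ cuts L n) :
    ∃ σ : Config 1 L, InSec x (n / 2) n σ := by
  classical
  rw [mem_cuts] at hx
  set a : ℤ := x - (n / 2 : ℕ) with ha
  set b : ℤ := x + ((n + 1) / 2 : ℕ) with hb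
  set σ : Config 1 L := fun y => if a < y.1 ∧ y.1 ≤ b then 1 else 0 with hσ
  have h1 : ∀ z, a < z → z ≤ b → σ (st L z) = 1 := by
    intro z hz hz'
    simp only [hσ]
    rw [st_val (by omega) (by omega), if_pos ⟨hz, hz'⟩]
  have h2 : cnt a σ = 0 := by
    rw [cnt, Finset.card_eq_zero, Finset.filter_eq_empty_iff]
    rintro y - ⟨hy, hy'⟩
    simp only [hσ] at hy'
    rw [if_neg (by omega)] at hy'
    exact absurd hy' (by decide)
  have h3 : cnt L σ = cnt b σ := by
    rw [cnt, cnt]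
    congr 1
    refine Finset.filter_congr fun y _ => ?_
    have h4 := y.2.2
    constructor
    · rintro ⟨-, hy⟩
      refine ⟨?_, hy⟩
      by_contra hc
      simp only [hσ] at hy
      rw [if_neg (by omega)] at hy
      exact absurd hy (by decide)
    · rintro ⟨-, hy⟩; exact ⟨h4, hy⟩
  have h4 := cnt_eq_add_of_down (L := L) (x := a) (y := x) (σ := σ) (by omega) (by omega) (by omega)
    (fun z hz hz' => h1 z hz (by omega))
  have h5 := cnt_eq_add_of_down (L := L) (x := a) (y := b) (σ := σ) (by omega) (by omega) (by omega)
    (fun z hz hz' => h1 z hz hz')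
  exact ⟨σ, by omega, by omega⟩

theorem kinkPair_ne_zero {q : ℝ} (hq0 : 0 < q) {n : ℕ} {x : ℤ} (hx : x ∈ cuts L n) :
    kinkPair (L := L) q x (n / 2) n ≠ 0 := by
  obtain ⟨σ, hσ⟩ := exists_inSec hx
  intro h
  have h1 := kinkPair_of_inSec (q := q) hσ
  rw [h] at h1
  exact Complex.ofReal_ne_zero.2 (pow_pos hq0 _).ne' h1.symm

theorem norm_kinkHat {q : ℝ} (hq0 : 0 < q) {n : ℕ} {x : ℤ} (hx : x ∈ cuts L n) :
    ‖kinkHat (L := L) q x (n / 2) n‖ = 1 := by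
  rw [kinkHat, norm_smul, Complex.norm_real, Real.norm_of_nonneg (by positivity)]
  exact inv_mul_cancel₀ (norm_ne_zero_iff.2 (kinkPair_ne_zero hq0 hx))

theorem approxDroplets_eq_span {q : ℝ} (hq0 : 0 < q) (n : ℕ) :
    approxDroplets q L n
      = Submodule.span ℂ ((fun x => kinkHat (L := L) q x (n / 2) n) '' cuts L n) := by
  have hmem : ∀ x ∈ cuts L n, 1 ≤ x + 1 ∧ x ≤ L := fun x hx => by
    rw [mem_cuts] at hx; omega
  apply le_antisymm
  · refine Submodule.span_le.2 ?_
    rintro _ ⟨x, h0, hL, h1, h2, rfl⟩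
    have hx : x ∈ cuts L n := mem_cuts.2 ⟨h1, h2⟩
    have hne := norm_ne_zero_iff.2 (kinkPair_ne_zero hq0 hx)
    have e : kinkPair (L := L) q x (n / 2) n
        = ((‖kinkPair (L := L) q x (n / 2) n‖ : ℝ) : ℂ) • kinkHat q x (n / 2) n := by
      rw [kinkHat, smul_smul, ← Complex.ofReal_mul, mul_inv_cancel₀ hne, Complex.ofReal_one,
        one_smul]
    rw [xi_eq_kinkPair hq0, e]
    exact Submodule.smul_mem _ _ (Submodule.subset_span ⟨x, hx, rfl⟩)
  · refine Submodule.span_le.2 ?_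
    rintro _ ⟨x, hx, rfl⟩
    obtain ⟨h0, hL⟩ := hmem x hx
    have h1 := mem_cuts.1 hx
    exact Submodule.smul_mem _ _ (Submodule.subset_span
      ⟨x, h0, hL, h1.1, h1.2, (xi_eq_kinkPair hq0 n h0 hL).symm⟩)

theorem exists_sum_of_mem_approxDroplets {q : ℝ} (hq0 : 0 < q) {n : ℕ} {φ : Space 1 L}
    (hφ : φ ∈ approxDroplets q L n) :
    ∃ c : ℤ → ℂ, ∑ x ∈ cuts L n, c x • kinkHat q x (n / 2) n = φ := by
  rw [approxDroplets_eq_span hq0] at hφ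
  obtain ⟨c, hc⟩ := (Submodule.mem_span_image_finset_iff_exists_fun ℂ).1 hφ
  refine ⟨fun y => if hy : y ∈ cuts L n then c ⟨y, hy⟩ else 0, ?_⟩
  rw [← hc, ← Finset.sum_coe_sort]
  exact Finset.sum_congr rfl fun y _ => by simp only [dif_pos y.2]

/-- The droplet states are almost orthonormal once their mutual overlaps are small. -/
theorem sum_norm_sq_le_of_overlap {q : ℝ} (hq0 : 0 < q) (hq1 : q < 1) {n : ℕ} (hn : 1 ≤ n)
    (hov : overlapErr q (n - n / 2) ≤ 1 / 2) (c : ℤ → ℂ) :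
    ∑ x ∈ cuts L n, ‖c x‖ ^ 2 ≤ 2 * ‖∑ x ∈ cuts L n, c x • kinkHat (L := L) q x (n / 2) n‖ ^ 2 := by
  have h := sum_norm_sq_le_norm_sum_smul_sq (cuts L n)
    (fun x => kinkHat (L := L) q x (n / 2) n) c (M := 1 / 2) (fun x hx => norm_kinkHat hq0 hx)
    (fun x hx => by
      refine le_trans (le_of_eq ?_) ((sum_overlap_le (L := L) hq0 hq1 (m := n / 2) (n := n)
        (by omega) (cuts L n) (fun y hy => by rw [mem_cuts] at hy; omega) (fun _ _ => 1)
        (by simp) hx).trans hov)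
      have e : ∀ φ : Space 1 L, diag (fun _ => 1) φ = φ := fun φ => by ext σ; simp
      simp only [e])
  linarith

theorem finrank_approxDroplets {q : ℝ} (hq0 : 0 < q) (hq1 : q < 1) {n : ℕ} (hn : 1 ≤ n)
    (hnL : n ≤ L) (hov : overlapErr q (n - n / 2) ≤ 1 / 2) :
    Module.finrank ℂ (approxDroplets q L n) = L - n + 1 := by
  classical
  have hli : LinearIndependent ℂ
      fun x : cuts L n => kinkHat (L := L) q x.1 (n / 2) n := by
    rw [Fintype.linearIndependent_iff]
    intro g hg x
    have h1 := sum_norm_sq_le_of_overlap (L := L) hq0 hq1 hn hov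
      (fun y => if hy : y ∈ cuts L n then g ⟨y, hy⟩ else 0)
    have h2 : ∑ y ∈ cuts L n, (if hy : y ∈ cuts L n then g ⟨y, hy⟩ else 0)
        • kinkHat (L := L) q y (n / 2) n = 0 := by
      rw [← Finset.sum_coe_sort, ← hg]
      exact Finset.sum_congr rfl fun y _ => by rw [dif_pos y.2]
    rw [h2, norm_zero] at h1
    have h3 := Finset.single_le_sum
      (f := fun y => ‖(if hy : y ∈ cuts L n then g ⟨y, hy⟩ else 0 : ℂ)‖ ^ 2)
      (fun y _ => by positivity) x.2
    simp only [dif_pos x.2] at h3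
    have h4 : ‖g x‖ ^ 2 ≤ 0 := by linarith
    have h5 := pow_eq_zero_iff (two_ne_zero) |>.1 (le_antisymm h4 (by positivity))
    exact norm_eq_zero.1 h5
  have h1 : ((fun x => kinkHat (L := L) q x (n / 2) n) '' cuts L n)
      = Set.range fun x : cuts L n => kinkHat (L := L) q x.1 (n / 2) n := by
    rw [Set.image_eq_range]; rfl
  rw [approxDroplets_eq_span hq0, h1, finrank_span_eq_card hli, Fintype.card_coe, card_cuts hnL]

theorem approxDroplets_le_sector {q : ℝ} (hq0 : 0 < q) (n : ℕ) :
    approxDroplets q L n ≤ sector L n := by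
  rw [approxDroplets_eq_span hq0, Submodule.span_le]
  rintro _ ⟨x, -, rfl⟩
  exact mem_sector_iff.2 fun σ hσ => (suppOn_kinkHat q x (n / 2) n σ hσ).2

/-- On a droplet state only the coupling across its own cut deviates from the droplet energy. -/
theorem droplet_kinkHat {Δ q : ℝ} (hq0 : 0 < q) (hq1 : q < 1) (hΔq : Δ = (q + q⁻¹) / 2) {x : ℤ}
    (hx : 1 ≤ x) (hx' : x < L) (k n : ℕ) :
    droplet Δ L (kinkHat q x k n) - (fA q : ℂ) • kinkHat q x k n = seamOp q x (kinkHat q x k n) := by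
  have h : cutOp q x (kinkHat (L := L) q x k n) = 0 := by
    rw [kinkHat, map_smul, cutOp_kinkPair, smul_zero]
  rw [droplet_eq_cut hq0 hq1 hΔq hx hx', h]; abel

/-- The row sums of a kernel that decays geometrically. -/
theorem sum_pow_natAbs_le_all {r : ℝ} (hr0 : 0 < r) (hr1 : r < 1) (s : Finset ℤ) {x : ℤ}
    (hx : x ∈ s) : ∑ y ∈ s, r ^ (y - x).natAbs ≤ 1 + 2 * (r / (1 - r)) := by
  rw [← Finset.add_sum_erase _ _ hx]
  have := sum_pow_natAbs_le hr0 hr1 s x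
  simpa using this

/-- The relative error with which droplet states are eigenvectors. -/
noncomputable def dropletErr (q : ℝ) (n : ℕ) : ℝ :=
  2 * (seamErr q n * (1 + 2 * (q / (1 - q))))

theorem dropletErr_nonneg {q : ℝ} (hq0 : 0 < q) (hq1 : q < 1) (n : ℕ) : 0 ≤ dropletErr q n := by
  have := seamErr_nonneg hq0 hq1 n
  have : 0 < 1 - q := by linarith
  unfold dropletErr; positivity

/-- Droplet states and their combinations are nearly eigenvectors, in form and in norm. -/
theorem droplet_near_eigen {Δ q : ℝ} (hq0 : 0 < q) (hq1 : q < 1) (hΔq : Δ = (q + q⁻¹) / 2)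
    {n : ℕ} (hn : 6 ≤ n) (hov : overlapErr q (n - n / 2) ≤ 1 / 2) {φ : Space 1 L}
    (hφ : φ ∈ approxDroplets q L n) :
    |(inner ℂ φ (droplet Δ L φ)).re - fA q * ‖φ‖ ^ 2| ≤ dropletErr q n * ‖φ‖ ^ 2 ∧
      ‖droplet Δ L φ - (fA q : ℂ) • φ‖ ^ 2 ≤ dropletErr q n * ‖φ‖ ^ 2 := by
  obtain ⟨c, rfl⟩ := exists_sum_of_mem_approxDroplets hq0 hφ
  set m := n / 2 with hm
  set v : ℤ → Space 1 L := fun x => kinkHat q x m n with hv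
  set w : ℤ → Space 1 L := fun x => seamOp q x (v x) with hw
  set ξ := ∑ x ∈ cuts L n, c x • v x with hξ
  set k : ℤ → ℤ → ℝ := fun x y => seamErr q n * q ^ (y - x).natAbs with hk
  have hk0 : ∀ x y, 0 ≤ k x y := fun x y => by
    have := seamErr_nonneg hq0 hq1 n
    simp only [hk]; positivity
  have hks : ∀ x y, k x y = k y x := fun x y => by
    simp only [hk]; rw [show (y - x).natAbs = (x - y).natAbs by omega]
  have hrange : ∀ x ∈ cuts L n, 1 ≤ x ∧ x < L := fun x hx => by
    rw [mem_cuts] at hx; omega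
  have hTv : ∀ x ∈ cuts L n, droplet Δ L (v x) - (fA q : ℂ) • v x = w x := fun x hx =>
    droplet_kinkHat hq0 hq1 hΔq (hrange x hx).1 (hrange x hx).2 m n
  have hTξ : droplet Δ L ξ - (fA q : ℂ) • ξ = ∑ x ∈ cuts L n, c x • w x := by
    rw [hξ, map_sum, Finset.smul_sum, ← Finset.sum_sub_distrib]
    refine Finset.sum_congr rfl fun x hx => ?_
    rw [map_smul, smul_comm, ← smul_sub, hTv x hx]
  have hent : ∀ x ∈ cuts L n, ∀ y ∈ cuts L n, x ≤ y →
      ‖inner ℂ (v y) (w x)‖ ≤ k x y ∧ ‖inner ℂ (w y) (w x)‖ ≤ k x y := fun x hx y hy hxy =>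
    norm_inner_seamOp_kinkHat hq0 hq1 (hrange x hx).1 hxy (hrange y hy).2 (by omega) (by omega)
      (by omega)
  have hvw : ∀ x ∈ cuts L n, ∀ y ∈ cuts L n, inner ℂ (v x) (w y) = inner ℂ (w x) (v y) := by
    intro x hx y hy
    rw [← hTv x hx, ← hTv y hy, inner_sub_left, inner_sub_right, inner_smul_left,
      inner_smul_right, inner_droplet_comm hq0 hΔq, Complex.conj_ofReal]
  have h1 : ∀ x ∈ cuts L n, ∀ y ∈ cuts L n, ‖inner ℂ (v x) (w y)‖ ≤ k x y := by
    intro x hx y hy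
    rcases le_total y x with h | h
    · rw [hks]; exact (hent y hy x hx h).1
    · rw [hvw x hx y hy, ← inner_conj_symm, RCLike.norm_conj]; exact (hent x hx y hy h).1
  have h2 : ∀ x ∈ cuts L n, ∀ y ∈ cuts L n, ‖inner ℂ (w x) (w y)‖ ≤ k x y := by
    intro x hx y hy
    rcases le_total y x with h | h
    · rw [hks]; exact (hent y hy x hx h).2
    · rw [← inner_conj_symm, RCLike.norm_conj]; exact (hent x hx y hy h).2
  have hrow : ∀ x ∈ cuts L n, ∑ y ∈ cuts L n, k x y
      ≤ seamErr q n * (1 + 2 * (q / (1 - q))) := by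
    intro x hx
    simp only [hk]
    rw [← Finset.mul_sum]
    exact mul_le_mul_of_nonneg_left (sum_pow_natAbs_le_all hq0 hq1 _ hx)
      (seamErr_nonneg hq0 hq1 n)
  have hM : 0 ≤ seamErr q n * (1 + 2 * (q / (1 - q))) := by
    have := dropletErr_nonneg hq0 hq1 n
    unfold dropletErr at this; linarith
  have hc := sum_norm_sq_le_of_overlap (L := L) hq0 hq1 (by omega) hov c
  have hc' : seamErr q n * (1 + 2 * (q / (1 - q))) * ∑ x ∈ cuts L n, ‖c x‖ ^ 2
      ≤ dropletErr q n * ‖ξ‖ ^ 2 := by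
    calc _ ≤ seamErr q n * (1 + 2 * (q / (1 - q))) * (2 * ‖ξ‖ ^ 2) := by gcongr
      _ = _ := by unfold dropletErr; ring
  have h3 := (norm_inner_sum_smul_le _ v w c hk0 hks hrow h1).trans hc'
  have h4 := (norm_inner_sum_smul_le _ w w c hk0 hks hrow h2).trans hc'
  rw [← hTξ] at h3 h4
  constructor
  · refine le_trans ?_ h3
    have e : (inner ℂ ξ (droplet Δ L ξ)).re - fA q * ‖ξ‖ ^ 2
        = (inner ℂ ξ (droplet Δ L ξ - (fA q : ℂ) • ξ)).re := by
      have e2 : ((fA q : ℂ) * inner ℂ ξ ξ).re = fA q * ‖ξ‖ ^ 2 := by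
        rw [inner_self_eq_norm_sq_to_K, Complex.re_ofReal_mul, ← RCLike.ofReal_pow]
        congr 1
      rw [inner_sub_right, inner_smul_right, Complex.sub_re, e2]
    rw [e]
    exact Complex.abs_re_le_norm _
  · rw [inner_self_eq_norm_sq_to_K] at h4
    simpa using h4

end Droplets

/-! ### Error terms -/

section Errors

theorem pow_le_inv_succ {q : ℝ} (hq0 : 0 < q) (hq1 : q < 1) (t : ℕ) :
    q ^ t ≤ 1 / ((1 - q) * (t + 1)) := by
  have h1 : 0 < 1 - q := by linarith
  rw [le_div_iff₀ (by positivity)]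
  have h2 : ((t : ℝ) + 1) * q ^ t ≤ ∑ i ∈ Finset.range (t + 1), q ^ i := by
    have : ∑ i ∈ Finset.range (t + 1), q ^ t = ((t : ℝ) + 1) * q ^ t := by simp
    rw [← this]
    refine Finset.sum_le_sum fun i hi => ?_
    rw [Finset.mem_range] at hi
    exact pow_le_pow_of_le_one hq0.le hq1.le (by omega)
  have h3 := geom_sum_mul_neg q (t + 1)
  have h4 : 0 < q ^ (t + 1) := by positivity
  calc q ^ t * ((1 - q) * (t + 1)) = ((t : ℝ) + 1) * q ^ t * (1 - q) := by ring
    _ ≤ (∑ i ∈ Finset.range (t + 1), q ^ i) * (1 - q) := by gcongr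
    _ ≤ 1 := by rw [h3]; linarith

theorem tailErr_le {q : ℝ} (hq0 : 0 < q) (hq1 : q < 1) {t n : ℕ} (hn : 1 ≤ n)
    (ht : n ≤ 4 * (t + 1)) : tailErr q t ≤ 8 / ((1 - q ^ 2) * (1 - q)) / n := by
  have h0 : q ^ 2 < 1 := by nlinarith
  have h1 : 0 < 1 - q := by linarith
  have h2 : 0 < 1 - q ^ 2 := by linarith
  have hn' : (0 : ℝ) < n := by exact_mod_cast hn
  have h3 : (q ^ (t + 1)) ^ 2 ≤ q ^ t := by
    rw [← pow_mul]; exact pow_le_pow_of_le_one hq0.le hq1.le (by omega)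
  have h4 : (n : ℝ) ≤ 4 * (t + 1) := by exact_mod_cast ht
  have h5 : q ^ t ≤ 4 / ((1 - q) * n) := by
    refine (pow_le_inv_succ hq0 hq1 t).trans ?_
    rw [div_le_div_iff₀ (by positivity) (by positivity)]
    nlinarith
  unfold tailErr
  calc _ ≤ 2 * (4 / ((1 - q) * n)) / (1 - q ^ 2) := by gcongr; exact h3.trans h5
    _ = _ := by field_simp; norm_num

theorem overlapErr_le {q : ℝ} (hq0 : 0 < q) (hq1 : q < 1) {r n : ℕ} (hn : 1 ≤ n)
    (hr : n ≤ 2 * r) : overlapErr q r ≤ 4 / (1 - q) ^ 2 / n := by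
  have h1 : 0 < 1 - q := by linarith
  have hn' : (0 : ℝ) < n := by exact_mod_cast hn
  have h4 : (n : ℝ) ≤ 2 * r := by exact_mod_cast hr
  have h5 : q ^ r ≤ 2 / ((1 - q) * n) := by
    refine (pow_le_inv_succ hq0 hq1 r).trans ?_
    rw [div_le_div_iff₀ (by positivity) (by positivity)]
    nlinarith
  have h6 : q ^ r ≤ q := by
    simpa using pow_le_pow_of_le_one hq0.le hq1.le (by omega : 1 ≤ r)
  unfold overlapErr
  calc _ ≤ 2 * (2 / ((1 - q) * n) / (1 - q)) := by gcongr
    _ = _ := by field_simp; norm_num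

theorem locErr_le {q : ℝ} (hq0 : 0 < q) (hq1 : q < 1) {R : ℕ} (hR : 1 ≤ R) :
    locErr q R ≤ 1 / R := by
  have h1 := gam_pos hq1
  have h2 : 0 < wa q * wb q := mul_pos (wa_pos hq0) (wb_pos q)
  have hR' : (1 : ℝ) ≤ R := by exact_mod_cast hR
  have h3 := Real.pi_le_four
  have h4 := Real.pi_pos
  unfold gam at h1
  unfold locErr
  have h5 : Real.pi / 2 / R ≤ 2 / R := by gcongr; linarith
  calc wa q * wb q * ((Real.pi / 2 / R) ^ 2 / 2) ≤ 1 / 2 * ((2 / (R : ℝ)) ^ 2 / 2) := by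
        gcongr
        linarith
    _ = 1 / (R : ℝ) * (1 / R) := by field_simp
    _ ≤ 1 / (R : ℝ) * 1 := by
        gcongr
        rw [div_le_one (by positivity)]; exact hR'
    _ = 1 / (R : ℝ) := mul_one _

/-- Choosing the localization length proportional to the droplet size makes all errors in the gap
estimate of order `1 / n`. -/
theorem exists_gap_error {q : ℝ} (hq0 : 0 < q) (hq1 : q < 1) {N : ℕ} (hN : 1 ≤ N) :
    ∃ C : ℝ, 0 ≤ C ∧ ∀ n, 2 * N + 2 ≤ n → ∃ R, 1 ≤ R ∧ 2 * R * N ≤ n ∧ R ≤ n / 2 ∧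
      2 * tailErr q (n / 2 - R) + overlapErr q (n - n / 2)
        + 2 * ((N + 1) * locErr q R * (2 / gam q)) ≤ C / n := by
  have h0 : q ^ 2 < 1 := by nlinarith
  have h1 : 0 < 1 - q := by linarith
  have h2 : 0 < 1 - q ^ 2 := by linarith
  have hg := gam_pos hq1
  refine ⟨2 * (8 / ((1 - q ^ 2) * (1 - q))) + 4 / (1 - q) ^ 2
    + 2 * ((N + 1) * (4 * N + 4) * (2 / gam q)), by positivity, fun n hn => ?_⟩
  set R := n / (2 * N + 2) with hR
  have hR1 : 1 ≤ R := (Nat.one_le_div_iff (by omega)).2 hn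
  have hR2 : R * (2 * N + 2) ≤ n := Nat.div_mul_le_self n (2 * N + 2)
  have hR3 : n < (R + 1) * (2 * N + 2) := by
    have h3 := Nat.div_add_mod n (2 * N + 2)
    have h4 := Nat.mod_lt n (by omega : 2 * N + 2 > 0)
    rw [← hR] at h3
    linarith
  have hR4 : 4 * R ≤ n := by nlinarith
  have hn' : (0 : ℝ) < n := by exact_mod_cast (by omega : 0 < n)
  have hR0 : (0 : ℝ) < R := by exact_mod_cast hR1
  refine ⟨R, hR1, by nlinarith, by omega, ?_⟩
  have h3 := tailErr_le hq0 hq1 (t := n / 2 - R) (n := n) (by omega) (by omega)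
  have h4 := overlapErr_le hq0 hq1 (r := n - n / 2) (n := n) (by omega) (by omega)
  have h5 : locErr q R ≤ (4 * N + 4) / n := by
    refine (locErr_le hq0 hq1 hR1).trans ?_
    rw [div_le_div_iff₀ hR0 hn']
    have : n ≤ (4 * N + 4) * R := by nlinarith
    rw [one_mul]
    exact_mod_cast this
  calc _ ≤ 2 * (8 / ((1 - q ^ 2) * (1 - q)) / n) + 4 / (1 - q) ^ 2 / n
        + 2 * ((N + 1) * ((4 * N + 4) / n) * (2 / gam q)) := by gcongr
    _ = _ := by ring

end Errors

/-! ### The gap above the droplet states -/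

section GapEstimate

/-- Above the droplet states the energy in a sector is at least `A(Δ) + γ`, up to an error that
decays with the number of down spins. -/
theorem exists_droplet_gap {Δ q : ℝ} (hq0 : 0 < q) (hq1 : q < 1) (hΔq : Δ = (q + q⁻¹) / 2) :
    ∃ C : ℝ, 0 ≤ C ∧ ∃ n₀ : ℕ, ∀ (L n : ℕ) [NeZero L], n₀ ≤ n → ∀ φ ∈ sector L n,
      (∀ χ ∈ approxDroplets q L n, inner ℂ χ φ = 0) →
      (fA q + gam q - C / n) * ‖φ‖ ^ 2 ≤ (inner ℂ φ (droplet Δ L φ)).re := by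
  have hg := gam_pos hq1
  have hg1 := gam_le_one hq0
  have hA0 := fA_nonneg hq0 hq1
  have hA := fA_le_half q
  -- `N` walls cost more than the energy of the first excited states
  obtain ⟨N, hN⟩ := exists_nat_ge ((2 * fA q + gam q) / (gam q / 2))
  rw [div_le_iff₀ (by positivity)] at hN
  have hN1 : 1 ≤ N := by
    by_contra hc
    have : N = 0 := by omega
    rw [this] at hN
    norm_num at hN
    linarith
  obtain ⟨C, hC0, hC⟩ := exists_gap_error hq0 hq1 hN1
  refine ⟨C, hC0, 2 * N + 2, fun L n _ hn φ hφ horth => ?_⟩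
  obtain ⟨R, hR1, hR2, hR3, hR4⟩ := hC n hn
  have h1 := energy_gap hq0 hq1 (L := L) (R := R) (N := N) (n := n) (m := n / 2) hR1 hR2 hR3
    (by omega) (by linarith) (φ := φ) (fun σ hσ => mem_sector_iff.1 hφ σ hσ) (fun x hx => by
      rw [Finset.mem_Ico] at hx
      by_cases hne : ∃ σ : Config 1 L, InSec x (n / 2) n σ
      · obtain ⟨σ, hσ⟩ := hne
        have hb := inSec_bounds hσ (by omega) hx.2.le
        rw [← xi_eq_kinkPair hq0 n (by omega : 1 ≤ x + 1) hx.2.le]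
        exact horth _ (Submodule.subset_span ⟨x, by omega, hx.2.le, by omega, by omega, rfl⟩)
      · rw [kinkPair_eq_zero hne, inner_zero_left])
  rw [energy_eq hq0 hq1 hΔq] at h1
  set X := (inner ℂ φ (droplet Δ L φ)).re
  set e := ((N : ℝ) + 1) * locErr q R * (2 / gam q) with he
  have he0 : 0 ≤ e := by
    have := locErr_nonneg hq0 R
    positivity
  set t := 2 * tailErr q (n / 2 - R) + overlapErr q (n - n / 2) with ht
  have ht0 : 0 ≤ t := by
    have h2 := tailErr_nonneg hq0 hq1 (n / 2 - R)
    have h3 : q ^ (n - n / 2) ≤ 1 := pow_le_one₀ hq0.le hq1.le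
    have h4 : 0 ≤ 1 - q ^ (n - n / 2) := by linarith
    have h5 : 0 ≤ overlapErr q (n - n / 2) := by unfold overlapErr; positivity
    linarith
  have hX0 : 0 ≤ ‖φ‖ ^ 2 := by positivity
  -- `(a - t) / (1 + e) ≥ a - t - e a`, and `a ≤ 2`
  have h2 : (1 + e) * ((2 * fA q + gam q - t - 2 * e) * ‖φ‖ ^ 2)
      ≤ (1 + e) * (X + fA q * ‖φ‖ ^ 2) := by
    refine le_trans ?_ h1
    rw [← mul_assoc]
    refine mul_le_mul_of_nonneg_right ?_ hX0
    have h3 : gam q * t ≤ t := by nlinarith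
    have h4 : 0 ≤ e * t := by positivity
    nlinarith [mul_nonneg he0 (by linarith : (0 : ℝ) ≤ 2 - 2 * fA q - gam q), mul_nonneg he0 he0]
  have h3 := le_of_mul_le_mul_left h2 (by linarith)
  have h4 : C / n * ‖φ‖ ^ 2 ≥ (t + 2 * e) * ‖φ‖ ^ 2 := mul_le_mul_of_nonneg_right hR4 hX0
  nlinarith

end GapEstimate

/-! ### The spectral estimates -/

section Spectral

/-- The estimates on eigenvalues and low-energy space of a sector, with constant `C`. -/
structure SpectralBounds (Δ q : ℝ) (L n : ℕ)
    (lam : Fin (Module.finrank ℂ (sector L n)) → ℝ)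
    (ψ : OrthonormalBasis (Fin (Module.finrank ℂ (sector L n))) ℂ (sector L n))
    (C : ℝ) : Prop where
  low : ∀ j, j.val < L - n + 1 → lam j ∈ Set.Icc (fieldA Δ - C * q ^ n) (fieldA Δ + C * q ^ n)
  gap : ∀ j, j.val = L - n + 1 →
    fieldA Δ + (1 - Δ⁻¹) - C * (n : ℝ) ^ (-(1 / 4) : ℝ) ≤ lam j
  proj : ‖(approxDroplets q L n).starProjection - (lowSpan ψ (L - n + 1)).starProjection‖
    ≤ C * q ^ ((n : ℝ) / 2)
  near_low : ∀ φ ∈ approxDroplets q L n, φ ≠ 0 →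
    ⨅ φ' : lowSpan ψ (L - n + 1), ‖φ - (φ' : Space 1 L)‖ ^ 2 / ‖φ‖ ^ 2 ≤ C * q ^ n
  near_droplets : ∀ φ' ∈ lowSpan ψ (L - n + 1), φ' ≠ 0 →
    ⨅ φ : approxDroplets q L n, ‖(φ : Space 1 L) - φ'‖ ^ 2 / ‖φ'‖ ^ 2 ≤ C * q ^ n

theorem SpectralBounds.mono {Δ q : ℝ} (hq0 : 0 < q) {L n : ℕ}
    {lam : Fin (Module.finrank ℂ (sector L n)) → ℝ}
    {ψ : OrthonormalBasis (Fin (Module.finrank ℂ (sector L n))) ℂ (sector L n)}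
    {C C' : ℝ} (hC : C ≤ C') (h : SpectralBounds Δ q L n lam ψ C) :
    SpectralBounds Δ q L n lam ψ C' := by
  have h1 : C * q ^ n ≤ C' * q ^ n := by gcongr
  have h2 : C * (n : ℝ) ^ (-(1 / 4) : ℝ) ≤ C' * (n : ℝ) ^ (-(1 / 4) : ℝ) := by gcongr
  have h3 : C * q ^ ((n : ℝ) / 2) ≤ C' * q ^ ((n : ℝ) / 2) := by gcongr
  refine ⟨fun j hj => ?_, fun j hj => ?_, h.proj.trans h3,
    fun φ hφ h0 => (h.near_low φ hφ h0).trans h1,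
    fun φ hφ h0 => (h.near_droplets φ hφ h0).trans h1⟩
  · have := h.low j hj
    exact ⟨by linarith [this.1], by linarith [this.2]⟩
  · have := h.gap j hj; linarith

theorem iInf_norm_sq_div_le {E : Type*} [NormedAddCommGroup E] [InnerProductSpace ℂ E]
    {K : Submodule ℂ E} {x y : E} {δ : ℝ} (hx : x ≠ 0) (hy : y ∈ K)
    (h : ‖x - y‖ ^ 2 ≤ δ * ‖x‖ ^ 2) : ⨅ z : K, ‖x - (z : E)‖ ^ 2 / ‖x‖ ^ 2 ≤ δ := by
  have hb : BddBelow (Set.range fun z : K => ‖x - (z : E)‖ ^ 2 / ‖x‖ ^ 2) :=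
    ⟨0, by rintro _ ⟨z, rfl⟩; positivity⟩
  refine (ciInf_le hb ⟨y, hy⟩).trans ?_
  have := norm_pos_iff.2 hx
  rw [div_le_iff₀ (by positivity)]
  exact h

theorem sqrt_pow_eq_rpow {q : ℝ} (hq0 : 0 < q) (n : ℕ) : Real.sqrt (q ^ n) = q ^ ((n : ℝ) / 2) := by
  rw [Real.sqrt_eq_rpow, ← Real.rpow_natCast, ← Real.rpow_mul hq0.le]
  congr 1; ring

theorem one_sub_inv_eq_gam {Δ q : ℝ} (hq0 : 0 < q) (hΔq : Δ = (q + q⁻¹) / 2) :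
    1 - Δ⁻¹ = gam q := by rw [inv_eq_of_anisotropy hq0 hΔq, gam]

theorem fieldA_eq_fA {Δ q : ℝ} (hq0 : 0 < q) (hq1 : q < 1) (hΔq : Δ = (q + q⁻¹) / 2) :
    fieldA Δ = fA q := by rw [fieldA_eq hq0 hq1 hΔq, fA]

/-- The energies in a sector are bounded in terms of the number of down spins only. -/
theorem eigenvalue_bounds {Δ q : ℝ} (hq0 : 0 < q) (hq1 : q < 1) (hΔq : Δ = (q + q⁻¹) / 2)
    {L n : ℕ} [NeZero L] {lam : Fin (Module.finrank ℂ (sector L n)) → ℝ}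
    {ψ : OrthonormalBasis (Fin (Module.finrank ℂ (sector L n))) ℂ (sector L n)}
    (h : IsOrderedEigenbasis Δ L n lam ψ) (j) :
    -fA q ≤ lam j ∧ lam j ≤ 2 * n + 1 - fA q := by
  have hn : ‖(ψ j : Space 1 L)‖ = 1 := ψ.orthonormal.1 j
  have h1 := energy_eq hq0 hq1 hΔq (ψ j : Space 1 L)
  have h2 : (inner ℂ (ψ j : Space 1 L) (droplet Δ L (ψ j : Space 1 L))).re = lam j := by
    rw [h.eigen, inner_smul_right, inner_self_eq_norm_sq_to_K, hn]; simp
  rw [h2, hn] at h1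
  have h3 := energy_ge_walls hq0 hq1 (ψ j : Space 1 L)
  have h4 := energy_le_walls hq0 hq1 (ψ j : Space 1 L)
  have hg := gam_pos hq1
  have h5 : 0 ≤ gam q / 2 * ∑ σ, (walls σ : ℝ) * ‖(ψ j : Space 1 L) σ‖ ^ 2 :=
    mul_nonneg (by linarith) (Finset.sum_nonneg fun σ _ => by positivity)
  have h6 : ∑ σ, ((walls σ : ℝ) + 1) * ‖(ψ j : Space 1 L) σ‖ ^ 2
      ≤ ∑ σ, (2 * n + 1) * ‖(ψ j : Space 1 L) σ‖ ^ 2 := by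
    refine Finset.sum_le_sum fun σ _ => ?_
    by_cases h0 : (ψ j : Space 1 L) σ = 0
    · simp [h0]
    · have h7 := walls_le σ
      rw [mem_sector_iff.1 (ψ j).2 σ h0] at h7
      have : (walls σ : ℝ) ≤ 2 * n := by exact_mod_cast h7
      gcongr
  rw [← Finset.mul_sum, ← norm_sq_eq_sum, hn] at h6
  constructor <;> linarith

/-- For boundedly many down spins the estimates hold with a large enough constant. -/
theorem exists_spectralBounds_small {Δ q : ℝ} (hq0 : 0 < q) (hq1 : q < 1)
    (hΔq : Δ = (q + q⁻¹) / 2) (n₀ : ℕ) :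
    ∃ C : ℝ, ∀ (L n : ℕ) [NeZero L], 1 ≤ n → n < n₀ → ∀ lam ψ,
      IsOrderedEigenbasis Δ L n lam ψ → SpectralBounds Δ q L n lam ψ C := by
  refine ⟨(2 * n₀ + 2) / q ^ n₀, fun L n _ hn1 hn lam ψ h => ?_⟩
  have hq : 0 < q ^ n₀ := by positivity
  have hnn : (n : ℝ) ≤ n₀ := by exact_mod_cast hn.le
  have hn0 : (1 : ℝ) ≤ n := by exact_mod_cast hn1
  have hC : (2 * n₀ + 2 : ℝ) ≤ (2 * n₀ + 2) / q ^ n₀ := by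
    rw [le_div_iff₀ hq]
    have : q ^ n₀ ≤ 1 := pow_le_one₀ hq0.le hq1.le
    nlinarith
  have h1 : (2 * n₀ + 2 : ℝ) ≤ (2 * n₀ + 2) / q ^ n₀ * q ^ n := by
    have : q ^ n₀ ≤ q ^ n := pow_le_pow_of_le_one hq0.le hq1.le hn.le
    calc (2 * n₀ + 2 : ℝ) = (2 * n₀ + 2) / q ^ n₀ * q ^ n₀ := by field_simp
      _ ≤ _ := by gcongr
  have h2 : (2 * n₀ + 2 : ℝ) ≤ (2 * n₀ + 2) / q ^ n₀ * q ^ ((n : ℝ) / 2) := by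
    refine h1.trans ?_
    gcongr
    rw [← Real.rpow_natCast]
    exact Real.rpow_le_rpow_of_exponent_ge hq0 hq1.le (by linarith)
  have h3 : 2 ≤ (2 * n₀ + 2) / q ^ n₀ * (n : ℝ) ^ (-(1 / 4) : ℝ) := by
    have h4 : (n : ℝ)⁻¹ ≤ (n : ℝ) ^ (-(1 / 4) : ℝ) := by
      rw [← Real.rpow_neg_one]
      exact Real.rpow_le_rpow_of_exponent_le hn0 (by norm_num)
    calc (2 : ℝ) ≤ (2 * n₀ + 2) * (n : ℝ)⁻¹ := by
          rw [← div_eq_mul_inv, le_div_iff₀ (by linarith)]; linarith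
      _ ≤ _ := by gcongr
  have hA0 := fA_nonneg hq0 hq1
  have hA := fA_le_half q
  have hg := gam_le_one hq0
  rw [← fieldA_eq_fA hq0 hq1 hΔq] at hA0 hA
  have hlam := fun j => eigenvalue_bounds hq0 hq1 hΔq h j
  simp only [← fieldA_eq_fA hq0 hq1 hΔq] at hlam
  refine ⟨fun j _ => ?_, fun j _ => ?_, ?_, fun φ _ h0 => ?_, fun φ _ h0 => ?_⟩
  · have := hlam j
    constructor <;> linarith
  · have := hlam j
    rw [one_sub_inv_eq_gam hq0 hΔq]
    linarith
  · have h4 := norm_starProjection_sub_le (approxDroplets q L n) (lowSpan ψ (L - n + 1)) 1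
      zero_le_one (fun x _ => ⟨0, Submodule.zero_mem _, by simp⟩)
      (fun x _ => ⟨0, Submodule.zero_mem _, by simp⟩)
    linarith
  · refine (iInf_norm_sq_div_le (δ := 1) h0 (Submodule.zero_mem _) (by simp)).trans (by linarith)
  · simp only [norm_sub_rev _ φ]
    refine (iInf_norm_sq_div_le (δ := 1) h0 (Submodule.zero_mem _) (by simp)).trans (by linarith)

theorem dropletErr_eq (q : ℝ) (n : ℕ) : dropletErr q n = dropletErr q 0 * q ^ n := by
  simp only [dropletErr, seamErr, pow_zero]; ring

/-- For many down spins the droplet states span a nearly invariant subspace with a gap above it. -/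
theorem exists_spectralBounds_large {Δ q : ℝ} (hq0 : 0 < q) (hq1 : q < 1)
    (hΔq : Δ = (q + q⁻¹) / 2) :
    ∃ C : ℝ, ∃ n₀ : ℕ, ∀ (L n : ℕ) [NeZero L], n₀ ≤ n → n ≤ L → ∀ lam ψ,
      IsOrderedEigenbasis Δ L n lam ψ → SpectralBounds Δ q L n lam ψ C := by
  have hg := gam_pos hq1
  obtain ⟨C₁, hC₁, n₁, hgap⟩ := exists_droplet_gap hq0 hq1 hΔq
  have h1q : 0 < 1 - q := by linarith
  obtain ⟨n₂, hn₂⟩ := exists_nat_ge (8 / (1 - q) ^ 2)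
  obtain ⟨n₃, hn₃⟩ := exists_nat_ge (C₁ / (gam q / 2))
  set D := dropletErr q 0 with hD
  have hD0 : 0 ≤ D := dropletErr_nonneg hq0 hq1 0
  set κ := 2 * (2 + 2 / (gam q / 2)) / (gam q / 2) with hκ
  have hκ0 : 0 ≤ κ := by positivity
  refine ⟨D * (1 + 2 / (gam q / 2)) + C₁ + 2 * Real.sqrt (D * κ) + D * κ,
    n₁ + n₂ + n₃ + 6, fun L n _ hn hnL lam ψ h => ?_⟩
  have hn0 : (0 : ℝ) < n := by exact_mod_cast (by omega : 0 < n)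
  have hqn : 0 < q ^ n := by positivity
  have hov : overlapErr q (n - n / 2) ≤ 1 / 2 := by
    refine (overlapErr_le hq0 hq1 (n := n) (by omega) (by omega)).trans ?_
    rw [div_le_iff₀ hn0]
    have h2 : (n₂ : ℝ) ≤ n := by exact_mod_cast (by omega : n₂ ≤ n)
    have h3 : 8 / (1 - q) ^ 2 = 2 * (4 / (1 - q) ^ 2) := by ring
    linarith
  have hC₁n : C₁ / n ≤ gam q / 2 := by
    rw [div_le_iff₀ hn0]
    rw [div_le_iff₀ (by positivity)] at hn₃
    have h2 : (n₃ : ℝ) ≤ n := by exact_mod_cast (by omega : n₃ ≤ n)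
    nlinarith
  have hε : Real.sqrt (D * q ^ n) ^ 2 = D * q ^ n := Real.sq_sqrt (by positivity)
  -- the gap is used twice: `γ / 2` for the eigenvectors, `γ - C₁ / n` for the next eigenvalue
  have hNI : ∀ g, 0 < g → g ≤ gam q - C₁ / n → NearlyInvariant (droplet Δ L) (sector L n)
      (approxDroplets q L n) (fA q) g (Real.sqrt (D * q ^ n)) := by
    intro g hg0 hgle
    refine ⟨approxDroplets_le_sector hq0 n, inner_droplet_comm hq0 hΔq, hg0, Real.sqrt_nonneg _,
      fun x hx => ?_, fun x hx => ?_, fun v hv hort => ?_⟩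
    · rw [hε, ← dropletErr_eq]
      exact (droplet_near_eigen hq0 hq1 hΔq (by omega) hov hx).1
    · have h2 := (droplet_near_eigen hq0 hq1 hΔq (by omega) hov hx).2
      rw [dropletErr_eq, ← hD, ← hε, ← mul_pow] at h2
      exact (sq_le_sq₀ (norm_nonneg _) (by positivity)).1 h2
    · refine le_trans ?_ (hgap L n (by omega) v hv hort)
      gcongr
      linarith
  have hN1 := hNI (gam q / 2) (by positivity) (by linarith)
  have hN2 := hNI (gam q - C₁ / n) (by linarith) le_rfl
  have hfr := finrank_approxDroplets (L := L) hq0 hq1 (by omega) hnL hov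
  have hc1 : 0 ≤ D * (1 + 2 / (gam q / 2)) := by positivity
  have hc2 : 0 ≤ D * κ := by positivity
  have hc3 := Real.sqrt_nonneg (D * κ)
  have hlow : ∀ x ∈ approxDroplets q L n, ∃ y ∈ lowSpan ψ (L - n + 1),
      ‖x - y‖ ^ 2 ≤ D * κ * q ^ n * ‖x‖ ^ 2 := by
    intro x hx
    obtain ⟨y, hy, hxy⟩ := hN1.exists_near_low h.mono h.eigen hx
    rw [hfr] at hy
    refine ⟨y, hy, hxy.trans ?_⟩
    rw [hε]
    have h2 : (2 + 2 / (gam q / 2)) / (gam q / 2) ≤ κ := by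
      rw [hκ, mul_div_assoc]
      have : 0 ≤ (2 + 2 / (gam q / 2)) / (gam q / 2) := by positivity
      linarith
    calc _ ≤ D * q ^ n * κ * ‖x‖ ^ 2 := by gcongr
      _ = _ := by ring
  have hdrop : ∀ x ∈ lowSpan ψ (L - n + 1), ∃ y ∈ approxDroplets q L n,
      ‖x - y‖ ^ 2 ≤ D * κ * q ^ n * ‖x‖ ^ 2 := by
    intro x hx
    obtain ⟨y, hy, hxy⟩ := hN1.low_near h.mono h.eigen (x := x) (by rw [hfr]; exact hx)
    refine ⟨y, hy, hxy.trans (le_of_eq ?_)⟩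
    rw [hε]; ring
  have hDκ : D * κ * q ^ n ≤ (D * (1 + 2 / (gam q / 2)) + C₁ + 2 * Real.sqrt (D * κ) + D * κ)
      * q ^ n := by
    gcongr; linarith
  refine ⟨fun j hj => ?_, fun j hj => ?_, ?_, fun φ hφ h0 => ?_, fun φ hφ h0 => ?_⟩
  · rw [fieldA_eq_fA hq0 hq1 hΔq]
    have h2 := hN1.le_eigenvalue h.eigen j
    have h3 := hN1.eigenvalue_le h.mono h.eigen (j := j) (by omega)
    rw [hε] at h2 h3
    have h4 : D * q ^ n * (1 + 2 / (gam q / 2))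
        ≤ (D * (1 + 2 / (gam q / 2)) + C₁ + 2 * Real.sqrt (D * κ) + D * κ) * q ^ n := by
      calc _ = D * (1 + 2 / (gam q / 2)) * q ^ n := by ring
        _ ≤ _ := by gcongr; linarith
    have h5 : D * q ^ n ≤ D * q ^ n * (1 + 2 / (gam q / 2)) := by
      have h6 : 0 ≤ 2 / (gam q / 2) := by positivity
      have h7 : 0 ≤ D * q ^ n := by positivity
      nlinarith
    constructor <;> linarith
  · rw [fieldA_eq_fA hq0 hq1 hΔq, one_sub_inv_eq_gam hq0 hΔq]
    have h2 := hN2.add_gap_le_eigenvalue h.mono h.eigen (j := j) (by omega)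
    have h3 : C₁ / n ≤ (D * (1 + 2 / (gam q / 2)) + C₁ + 2 * Real.sqrt (D * κ) + D * κ)
        * (n : ℝ) ^ (-(1 / 4) : ℝ) := by
      have h4 : (n : ℝ)⁻¹ ≤ (n : ℝ) ^ (-(1 / 4) : ℝ) := by
        rw [← Real.rpow_neg_one]
        exact Real.rpow_le_rpow_of_exponent_le (by exact_mod_cast (by omega : 1 ≤ n))
          (by norm_num)
      rw [div_eq_mul_inv]
      gcongr
      linarith
    linarith
  · have hη : ∀ x y : Space 1 L, ‖x - y‖ ^ 2 ≤ D * κ * q ^ n * ‖x‖ ^ 2 →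
        ‖x - y‖ ≤ Real.sqrt (D * κ * q ^ n) * ‖x‖ := by
      intro x y hxy
      refine (sq_le_sq₀ (norm_nonneg _) (by positivity)).1 ?_
      rwa [mul_pow, Real.sq_sqrt (by positivity)]
    refine (norm_starProjection_sub_le _ _ (Real.sqrt (D * κ * q ^ n)) (Real.sqrt_nonneg _)
      (fun x hx => ?_) (fun x hx => ?_)).trans ?_
    · obtain ⟨y, hy, hxy⟩ := hlow x hx
      exact ⟨y, hy, hη x y hxy⟩
    · obtain ⟨y, hy, hxy⟩ := hdrop x hx
      exact ⟨y, hy, hη x y hxy⟩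
    · rw [Real.sqrt_mul hc2, sqrt_pow_eq_rpow hq0, ← mul_assoc]
      gcongr
      linarith
  · obtain ⟨y, hy, hxy⟩ := hlow φ hφ
    exact (iInf_norm_sq_div_le h0 hy hxy).trans hDκ
  · simp only [norm_sub_rev _ φ]
    obtain ⟨y, hy, hxy⟩ := hdrop φ hφ
    exact (iInf_norm_sq_div_le h0 hy hxy).trans hDκ

end Spectral

end XXZ

theorem mainTheorem3 (Δ q : ℝ) (hΔ : 1 < Δ) (hq0 : 0 < q) (hq1 : q < 1)
    (hΔq : Δ = (q + q⁻¹) / 2) :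
    ∃ C : ℝ, ∀ L n : ℕ, 1 ≤ n → n ≤ L →
      L - n + 1 ≤ Module.finrank ℂ (XXZ.sector L n) ∧
      (∃ lam ψ, XXZ.IsOrderedEigenbasis Δ L n lam ψ) ∧
      ∀ (lam : Fin (Module.finrank ℂ (XXZ.sector L n)) → ℝ)
        (ψ : OrthonormalBasis (Fin (Module.finrank ℂ (XXZ.sector L n))) ℂ (XXZ.sector L n)),
        XXZ.IsOrderedEigenbasis Δ L n lam ψ →
        (∀ j, j.val < L - n + 1 →
          lam j ∈ Set.Icc (XXZ.fieldA Δ - C * q ^ n) (XXZ.fieldA Δ + C * q ^ n)) ∧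
        (∀ j, j.val = L - n + 1 →
          XXZ.fieldA Δ + (1 - Δ⁻¹) - C * (n : ℝ) ^ (-(1 / 4) : ℝ) ≤ lam j) ∧
        ‖(XXZ.approxDroplets q L n).starProjection
            - (XXZ.lowSpan ψ (L - n + 1)).starProjection‖ ≤ C * q ^ ((n : ℝ) / 2) ∧
        (∀ φ ∈ XXZ.approxDroplets q L n, φ ≠ 0 →
          ⨅ φ' : XXZ.lowSpan ψ (L - n + 1), ‖φ - (φ' : XXZ.Space 1 L)‖ ^ 2 / ‖φ‖ ^ 2
            ≤ C * q ^ n) ∧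
        (∀ φ' ∈ XXZ.lowSpan ψ (L - n + 1), φ' ≠ 0 →
          ⨅ φ : XXZ.approxDroplets q L n, ‖(φ : XXZ.Space 1 L) - φ'‖ ^ 2 / ‖φ'‖ ^ 2
            ≤ C * q ^ n) := by
  obtain ⟨C₁, n₀, h₁⟩ := XXZ.exists_spectralBounds_large hq0 hq1 hΔq
  obtain ⟨C₂, h₂⟩ := XXZ.exists_spectralBounds_small hq0 hq1 hΔq n₀
  refine ⟨max C₁ C₂, fun L n hn hnL => ?_⟩
  have : NeZero L := ⟨by omega⟩
  refine ⟨?_, XXZ.exists_isOrderedEigenbasis hq0 hΔq n, fun lam ψ h => ?_⟩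
  · rw [XXZ.finrank_sector]
    exact XXZ.sub_add_one_le_choose hn hnL
  have hb : XXZ.SpectralBounds Δ q L n lam ψ (max C₁ C₂) := by
    by_cases hlt : n < n₀
    · exact (h₂ L n hn hlt lam ψ h).mono hq0 (le_max_right _ _)
    · exact (h₁ L n (by omega) hnL lam ψ h).mono hq0 (le_max_left _ _)
  exact ⟨hb.low, hb.gap, hb.proj, hb.near_low, hb.near_droplets⟩
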